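/- Let $w$ be a symmetric $n\times n$ matrix with nonnegative rational entries. The Quantum Max Cut Hamiltonian of $w$ is the operator on $n$ qubits \[H_w=\sum_{1\le i<j\le n} w_{ij}H_{ij},\] where $H_{ij}$ is the projection onto the singlet state $\frac{|01\rangle-|10\rangle}{\sqrt2}$ on qubits $i$ and $j$, tensored with the identity on the other qubits. Call $w$ bipartite if $[n]$ can be partitioned into two sets $A$ and $B$ such that $w_{ij}=0$ whenever $i\ne j$ lie both in $A$ or both in $B$. Let $\lambda_{\max}(H_w)$ denote the maximum eigenvalue of $H_w$, i.e. the maximum of $\operatorname{tr}(\rho H_w)$ over all density matrices $\rho$. Then there is a deterministic classical algorithm which, given a bipartite $w$ (with entries written in binary; the partition is not given), runs in time polynomial in the bit length of $w$ and outputs a classical description of an $n$-qubit (mixed) state $\rho$ with \[\operatorname{tr}(\rho H_w)\ \ge\ \frac{1+\sqrt5}{4}\,\lambda_{\max}(H_w).\] Here time is measured on a random access machine with logarithmic cost. The description consists of a partition of the qubits into blocks together with, for each block, the list of all entries of a density matrix on that block, the real and imaginary part of each entry being an algebraic number given by an integer polynomial and a rational interval that isolates one of its roots; $\rho$ is the tensor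 product of the density matrices of the blocks. -/

import Mathlib

noncomputable section

/-! ## Random access machines with logarithmic cost

Programs are structured programs over natural-number variables and natural-number arrays with
computed addresses. Every operation is charged the bit lengths of the numbers it handles
(including addresses), so the cost of a run is its time on a random access machine under the
logarithmic cost criterion. -/

namespace RAM

/-- The contents of the registers and of the arrays. -/
structure Store where
  var : ℕ → ℕ
  arr : ℕ → ℕ → ℕ

/-- Arithmetic operations; `sub` is truncated at zero, `div` is the integer quotient. -/
inductive Op
  | add | sub | mul | div

def Op.eval : Op → ℕ → ℕ → ℕ
  | .add, a, b => a + b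
  | .sub, a, b => a - b
  | .mul, a, b => a * b
  | .div, a, b => a / b

/-- Expressions: constants, registers, array cells at a computed address, operations. -/
inductive Expr
  | const (c : ℕ)
  | var (x : ℕ)
  | read (k : ℕ) (e : Expr)
  | op (o : Op) (e f : Expr)

def Expr.eval (s : Store) : Expr → ℕ
  | .const c => c
  | .var x => s.var x
  | .read k e => s.arr k (e.eval s)
  | .op o e f => o.eval (e.eval s) (f.eval s)

/-- Logarithmic cost: each node costs one plus the bit length of its value. -/
def Expr.cost (s : Store) : Expr → ℕ
  | .const c => 1 + c.size
  | .var x => 1 + (s.var x).size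
  | .read k e => 1 + ((Expr.read k e).eval s).size + e.cost s
  | .op o e f => 1 + ((Expr.op o e f).eval s).size + e.cost s + f.cost s

/-- Programs. Conditions are true when the value of the expression is nonzero. -/
inductive Cmd
  | skip
  | assign (x : ℕ) (e : Expr)
  | write (k : ℕ) (i e : Expr)
  | seq (c d : Cmd)
  | cond (e : Expr) (c d : Cmd)
  | loop (e : Expr) (c : Cmd)

def Store.setVar (s : Store) (x v : ℕ) : Store :=
  { s with var := Function.update s.var x v }

def Store.setArr (s : Store) (k i v : ℕ) : Store :=
  { s with arr := Function.update s.arr k (Function.update (s.arr k) i v) }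

/-- `Exec c s t s'`: started in `s`, the program `c` halts in `s'` at total cost `t`. -/
inductive Exec : Cmd → Store → ℕ → Store → Prop
  | skip (s : Store) : Exec .skip s 1 s
  | assign (s : Store) (x : ℕ) (e : Expr) :
      Exec (.assign x e) s (1 + e.cost s) (s.setVar x (e.eval s))
  | write (s : Store) (k : ℕ) (i e : Expr) :
      Exec (.write k i e) s (1 + i.cost s + e.cost s) (s.setArr k (i.eval s) (e.eval s))
  | seq {c d : Cmd} {s s' s'' : Store} {t t' : ℕ} :
      Exec c s t s' → Exec d s' t' s'' → Exec (.seq c d) s (t + t') s''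
  | cond_true {e : Expr} {c d : Cmd} {s s' : Store} {t : ℕ} :
      e.eval s ≠ 0 → Exec c s t s' → Exec (.cond e c d) s (1 + e.cost s + t) s'
  | cond_false {e : Expr} {c d : Cmd} {s s' : Store} {t : ℕ} :
      e.eval s = 0 → Exec d s t s' → Exec (.cond e c d) s (1 + e.cost s + t) s'
  | loop_true {e : Expr} {c : Cmd} {s s' s'' : Store} {t t' : ℕ} :
      e.eval s ≠ 0 → Exec c s t s' → Exec (.loop e c) s' t' s'' →
        Exec (.loop e c) s (1 + e.cost s + t + t') s''
  | loop_false {e : Expr} {c : Cmd} {s : Store} :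
      e.eval s = 0 → Exec (.loop e c) s (1 + e.cost s) s

/-- Programs are deterministic. -/
theorem Exec.det {c : Cmd} {s s₁ s₂ : Store} {t₁ t₂ : ℕ}
    (h₁ : Exec c s t₁ s₁) (h₂ : Exec c s t₂ s₂) : t₁ = t₂ ∧ s₁ = s₂ := by
  induction h₁ generalizing t₂ s₂ with
  | skip => cases h₂; exact ⟨rfl, rfl⟩
  | assign => cases h₂; exact ⟨rfl, rfl⟩
  | write => cases h₂; exact ⟨rfl, rfl⟩
  | seq _ _ ih ih' =>
    cases h₂ with
    | seq a b =>
      obtain ⟨rfl, rfl⟩ := ih a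
      obtain ⟨rfl, rfl⟩ := ih' b
      exact ⟨rfl, rfl⟩
  | cond_true he _ ih =>
    cases h₂ with
    | cond_true _ a => obtain ⟨rfl, rfl⟩ := ih a; exact ⟨rfl, rfl⟩
    | cond_false h _ => exact absurd h he
  | cond_false he _ ih =>
    cases h₂ with
    | cond_true h _ => exact absurd he h
    | cond_false _ a => obtain ⟨rfl, rfl⟩ := ih a; exact ⟨rfl, rfl⟩
  | loop_true he _ _ ih ih' =>
    cases h₂ with
    | loop_true _ a b =>
      obtain ⟨rfl, rfl⟩ := ih a
      obtain ⟨rfl, rfl⟩ := ih' b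
      exact ⟨rfl, rfl⟩
    | loop_false h => exact absurd h he
  | loop_false he =>
    cases h₂ with
    | loop_true h _ _ => exact absurd he h
    | loop_false _ => exact ⟨rfl, rfl⟩

/-- Initially array 0 holds the input, register 0 its length, and everything else is zero. -/
def initStore (input : List ℕ) : Store where
  var x := if x = 0 then input.length else 0
  arr k i := if k = 0 then input.getD i 0 else 0

/-- The output is the content of array 1 up to the length held in register 1. -/
def Store.output (s : Store) : List ℕ :=
  (List.range (s.var 1)).map (s.arr 1)

/-- Total bit length of a list of numbers (with one delimiter for each). -/
def bitLength (l : List ℕ) : ℕ :=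
  (l.map fun a => a.size + 1).sum

/-- On the given input the program `c` halts with the given output at cost `t`, where delivering
the output is charged its bit length. -/
def Computes (c : Cmd) (input output : List ℕ) (t : ℕ) : Prop :=
  ∃ t₀ s, Exec c (initStore input) t₀ s ∧ s.output = output ∧ t = t₀ + bitLength output

end RAM

/-! ## Encodings as lists of natural numbers written in binary -/

namespace Enc

/-- Sign and absolute value. -/
def int (z : ℤ) : List ℕ :=
  [if z < 0 then 1 else 0, z.natAbs]

def rat (q : ℚ) : List ℕ :=
  int q.num ++ [q.den]

/-- The length followed by the codes of the elements. -/
def list {α : Type*} (f : α → List ℕ) (l : List α) : List ℕ :=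
  l.length :: l.flatMap f

/-- The dimension followed by the entries in row-major order. -/
def matrix {n : ℕ} (w : Matrix (Fin n) (Fin n) ℚ) : List ℕ :=
  n :: (List.finRange n).flatMap fun i => (List.finRange n).flatMap fun j => rat (w i j)

end Enc

/-! ## Quantum states and Hamiltonians on `n` qubits -/

namespace Quantum

open scoped ComplexOrder

/-- Operators on `k` qubits, as matrices in the computational basis. -/
abbrev Operator (k : ℕ) := Matrix (Fin k → Fin 2) (Fin k → Fin 2) ℂ

/-- Density matrices, i.e. (mixed) states. -/
def IsState {k : ℕ} (ρ : Operator k) : Prop :=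
  ρ.PosSemidef ∧ ρ.trace = 1

/-- The energy `tr (ρ H)`, which is real for Hermitian `ρ` and `H`. -/
def energy {k : ℕ} (ρ H : Operator k) : ℝ :=
  (ρ * H).trace.re

/-- The maximum eigenvalue of a Hermitian operator. -/
def lambdaMax {k : ℕ} (H : Operator k) : ℝ :=
  sSup (spectrum ℝ H)

/-- The singlet `(|01⟩ - |10⟩) / √2`. -/
def singlet : Fin 2 × Fin 2 → ℂ := fun p =>
  if p = (0, 1) then 1 / (√2 : ℝ) else if p = (1, 0) then -1 / (√2 : ℝ) else 0

/-- The projection onto the singlet on qubits `i ≠ j`, tensored with the identity on the rest. -/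
def singletProj {n : ℕ} (i j : Fin n) : Operator n := Matrix.of fun x y =>
  if ∀ k, k ≠ i → k ≠ j → x k = y k then
    singlet (x i, x j) * star (singlet (y i, y j)) else 0

/-- The Quantum Max Cut Hamiltonian `∑_{i<j} w_{ij} H_{ij}`. -/
def qmcHamiltonian {n : ℕ} (w : Matrix (Fin n) (Fin n) ℚ) : Operator n :=
  ∑ i, ∑ j with i < j, (w i j : ℂ) • singletProj i j

/-- Interaction matrices: symmetric with nonnegative (rational) entries. -/
def IsInteraction {n : ℕ} (w : Matrix (Fin n) (Fin n) ℚ) : Prop :=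
  w.IsSymm ∧ ∀ i j, 0 ≤ w i j

/-- The qubits split into `A` and its complement with no interaction inside either part. -/
def IsBipartite {n : ℕ} (w : Matrix (Fin n) (Fin n) ℚ) : Prop :=
  ∃ A : Set (Fin n), ∀ i j, i ≠ j → (i ∈ A ↔ j ∈ A) → w i j = 0

/-! ### Classical descriptions of states -/

/-- A real algebraic number, given by an integer polynomial (coefficients in increasing degree)
and a rational interval that isolates one of its roots. -/
structure AlgReal where
  coeffs : List ℤ
  lo : ℚ
  hi : ℚ

def AlgReal.polyEval (a : AlgReal) (x : ℝ) : ℝ :=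
  a.coeffs.foldr (fun c r => (c : ℝ) + x * r) 0

/-- `x` is the only root of the polynomial in the interval. -/
def AlgReal.Represents (a : AlgReal) (x : ℝ) : Prop :=
  ∀ y : ℝ, ((a.lo : ℝ) ≤ y ∧ y ≤ a.hi ∧ a.polyEval y = 0) ↔ y = x

/-- A complex algebraic number, given by its real and imaginary parts. -/
structure AlgComplex where
  re : AlgReal
  im : AlgReal

def AlgComplex.Represents (a : AlgComplex) (z : ℂ) : Prop :=
  a.re.Represents z.re ∧ a.im.Represents z.im

/-- A group of qubits, with the list (row-major) of all entries of a density matrix on it. -/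
structure Block (n : ℕ) where
  qubits : List (Fin n)
  entries : List AlgComplex

/-- The position of a basis state of `k` qubits: its bits read as a binary number. -/
def basisIndex {k : ℕ} (x : Fin k → Fin 2) : ℕ :=
  (finFunctionFinEquiv x : ℕ)

/-- The list of entries of the block is the list of entries of the density matrix `K`. -/
def Block.Describes {n : ℕ} (b : Block n) (K : Operator b.qubits.length) : Prop :=
  IsState K ∧ b.entries.length = 4 ^ b.qubits.length ∧
    ∀ x y, ∃ c, b.entries[basisIndex x * 2 ^ b.qubits.length + basisIndex y]? = some c ∧
      c.Represents (K x y)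

/-- A description of a state: a list of blocks. -/
abbrev Description (n : ℕ) := List (Block n)

/-- The blocks partition the `n` qubits, and `ρ` is the tensor product of their states. -/
def Describes {n : ℕ} (D : Description n) (ρ : Operator n) : Prop :=
  (D.flatMap Block.qubits).Perm (List.finRange n) ∧
    ∃ K : (b : Fin D.length) → Operator (D.get b).qubits.length,
      (∀ b, (D.get b).Describes (K b)) ∧
      ∀ x y, ρ x y = ∏ b, K b (fun a => x ((D.get b).qubits.get a))
        (fun a => y ((D.get b).qubits.get a))

end Quantum

namespace Enc

open Quantum

def algReal (a : AlgReal) : List ℕ :=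
  list int a.coeffs ++ rat a.lo ++ rat a.hi

def algComplex (a : AlgComplex) : List ℕ :=
  algReal a.re ++ algReal a.im

def block {n : ℕ} (b : Block n) : List ℕ :=
  list (fun q : Fin n => [(q : ℕ)]) b.qubits ++ list algComplex b.entries

def description {n : ℕ} (D : Description n) : List ℕ :=
  list block D

/-! The code of a description determines the description. -/

/-- Codes can be read off the front of a longer list unambiguously. -/
def Readable {α : Type*} (f : α → List ℕ) : Prop :=
  ∀ a b s t, f a ++ s = f b ++ t → a = b ∧ s = t

theorem readable_int : Readable int := by
  intro a b s t h
  simp only [int, List.cons_append, List.nil_append, List.cons.injEq] at h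
  obtain ⟨h1, h2, h3⟩ := h
  refine ⟨?_, h3⟩
  split_ifs at h1 <;> omega

theorem readable_rat : Readable rat := by
  intro a b s t h
  simp only [rat, List.append_assoc] at h
  obtain ⟨h1, h2⟩ := readable_int _ _ _ _ h
  simp only [List.cons_append, List.nil_append, List.cons.injEq] at h2
  exact ⟨Rat.ext h1 h2.1, h2.2⟩

theorem readable_list {α : Type*} {f : α → List ℕ} (hf : Readable f) : Readable (list f) := by
  intro a
  induction a with
  | nil =>
    intro b s t h
    cases b with
    | nil => simpa [list] using h
    | cons y b => simp [list] at h
  | cons x a ih =>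
    intro b s t h
    cases b with
    | nil => simp [list] at h
    | cons y b =>
      simp only [list, List.length_cons, List.flatMap_cons, List.cons_append, List.append_assoc,
        List.cons.injEq, Nat.add_right_cancel_iff] at h
      obtain ⟨rfl, h2⟩ := hf _ _ _ _ h.2
      obtain ⟨rfl, h4⟩ := ih b s t (by simp [list, h.1, h2])
      exact ⟨rfl, h4⟩

theorem readable_algReal : Readable algReal := by
  rintro ⟨a, b, c⟩ ⟨a', b', c'⟩ s t h
  simp only [algReal, List.append_assoc] at h
  obtain ⟨rfl, h1⟩ := readable_list readable_int _ _ _ _ h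
  obtain ⟨rfl, h2⟩ := readable_rat _ _ _ _ h1
  obtain ⟨rfl, h3⟩ := readable_rat _ _ _ _ h2
  exact ⟨rfl, h3⟩

theorem readable_algComplex : Readable algComplex := by
  rintro ⟨a, b⟩ ⟨a', b'⟩ s t h
  simp only [algComplex, List.append_assoc] at h
  obtain ⟨rfl, h1⟩ := readable_algReal _ _ _ _ h
  obtain ⟨rfl, h2⟩ := readable_algReal _ _ _ _ h1
  exact ⟨rfl, h2⟩

theorem readable_block {n : ℕ} : Readable (block (n := n)) := by
  rintro ⟨a, b⟩ ⟨a', b'⟩ s t h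
  simp only [block, List.append_assoc] at h
  have hq : Readable (fun q : Fin n => [(q : ℕ)]) := by
    intro a b s t h
    simpa [Fin.ext_iff] using h
  obtain ⟨rfl, h1⟩ := readable_list hq _ _ _ _ h
  obtain ⟨rfl, h2⟩ := readable_list readable_algComplex _ _ _ _ h1
  exact ⟨rfl, h2⟩

theorem description_injective {n : ℕ} : Function.Injective (description (n := n)) := by
  intro D D' h
  exact (readable_list readable_block D D' [] [] (by simpa [description] using h)).1

end Enc

/-- `c` is a polynomial-time `α`-approximation algorithm for the Hamiltonians `H w`, where `w`
ranges over the rational matrices in the family `F`: given `w`, in time polynomial in the bit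
length of `w` it outputs a description of a state of energy at least `α * lambdaMax (H w)`. -/
def IsPolyTimeApproxAlgorithm (α : ℝ)
    (F : (n : ℕ) → Matrix (Fin n) (Fin n) ℚ → Prop)
    (H : (n : ℕ) → Matrix (Fin n) (Fin n) ℚ → Quantum.Operator n) (c : RAM.Cmd) : Prop :=
  ∃ p : Polynomial ℕ, ∀ (n : ℕ) (w : Matrix (Fin n) (Fin n) ℚ), F n w →
    ∃ (t : ℕ) (D : Quantum.Description n) (ρ : Quantum.Operator n),
      RAM.Computes c (Enc.matrix w) (Enc.description D) t ∧
      t ≤ p.eval (RAM.bitLength (Enc.matrix w)) ∧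
      Quantum.Describes D ρ ∧ Quantum.IsState ρ ∧
      α * Quantum.lambdaMax (H n w) ≤ Quantum.energy ρ (H n w)

end

noncomputable section

/-! ### A language of bounded loops that compiles to the machine -/

namespace RAM

/-- Programs whose loops run once for each `x < n`, where `n` is the first input number. -/
inductive Prog
  | assign (x : ℕ) (e : Expr)
  | write (k : ℕ) (i e : Expr)
  | seq (c d : Prog)
  | ite (e : Expr) (c d : Prog)
  | loop (x : ℕ) (c : Prog)
  | skip

namespace Prog

/-- A total functional semantics, possible because the number of rounds is fixed in advance: cell 0
of array 0 holds the dimension. Correctness is proved for `run` alone; `Prog.Tame.exec` transfers it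
to `Exec` and adds the cost. -/
def run : Prog → Store → Store
  | assign x e, s => s.setVar x (e.eval s)
  | write k i e, s => s.setArr k (i.eval s) (e.eval s)
  | seq c d, s => d.run (c.run s)
  | ite e c d, s => if e.eval s = 0 then d.run s else c.run s
  | loop x c, s =>
    (fun s' => (c.run s').setVar x ((c.run s').var x + 1))^[s.arr 0 0] (s.setVar x 0)
  | skip, s => s

def compile : Prog → Cmd
  | assign x e => .assign x e
  | write k i e => .write k i e
  | seq c d => .seq c.compile d.compile
  | ite e c d => .cond e c.compile d.compile
  | loop x c => .seq (.assign x (.const 0))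
      -- Truncated subtraction makes the guard nonzero exactly while the counter is below the
      -- dimension.
      (.loop (.op .sub (.read 0 (.const 0)) (.var x))
        (.seq c.compile (.assign x (.op .add (.var x) (.const 1)))))
  | skip => .skip

/-- The registers a program may change. -/
def modVars : Prog → List ℕ
  | assign x _ => [x]
  | write _ _ _ => []
  | seq c d => c.modVars ++ d.modVars
  | ite _ c d => c.modVars ++ d.modVars
  | loop x c => x :: c.modVars
  | skip => []

/-- The arrays a program may change. -/
def modArrs : Prog → List ℕ
  | assign _ _ => []
  | write k _ _ => [k]
  | seq c d => c.modArrs ++ d.modArrs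
  | ite _ c d => c.modArrs ++ d.modArrs
  | loop _ c => c.modArrs
  | skip => []

end Prog

/-- Products have an input number as their second factor. -/
def Expr.Tame : Expr → Prop
  | .const _ => True
  | .var _ => True
  | .read _ e => e.Tame
  | .op .mul e (.read 0 f) => e.Tame ∧ f.Tame
  | .op .mul _ _ => False
  | .op _ e f => e.Tame ∧ f.Tame

/-- Expressions are tame, loop variables are not changed by the body, the input is not changed. -/
def Prog.Tame : Prog → Prop
  | .assign _ e => e.Tame
  | .write k i e => k ≠ 0 ∧ i.Tame ∧ e.Tame
  | .seq c d => c.Tame ∧ d.Tame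
  | .ite e c d => e.Tame ∧ c.Tame ∧ d.Tame
  | .loop x c => x ∉ c.modVars ∧ c.Tame
  | .skip => True

@[simp] theorem Store.setVar_arr (s : Store) (x v : ℕ) : (s.setVar x v).arr = s.arr := rfl

theorem Store.setVar_var (s : Store) (x v y : ℕ) :
    (s.setVar x v).var y = if y = x then v else s.var y := by
  simp [Store.setVar, Function.update_apply]

@[simp] theorem Store.setArr_var (s : Store) (k i v : ℕ) : (s.setArr k i v).var = s.var := rfl

theorem Store.setArr_arr (s : Store) (k i v l : ℕ) :
    (s.setArr k i v).arr l = if l = k then Function.update (s.arr k) i v else s.arr l := by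
  simp [Store.setArr, Function.update_apply]

namespace Prog

theorem run_var (c : Prog) (s : Store) {x : ℕ} (h : x ∉ c.modVars) :
    (c.run s).var x = s.var x := by
  induction c generalizing s with
  | assign y e => simp_all [modVars, run, Store.setVar_var]
  | write k i e => simp [run]
  | seq c d ihc ihd => simp_all [modVars, run]
  | ite e c d ihc ihd =>
    simp only [modVars, List.mem_append, not_or] at h
    simp only [run]
    split_ifs
    exacts [ihd s h.2, ihc s h.1]
  | loop y c ih =>
    simp only [modVars, List.mem_cons, not_or] at h
    simp only [run]
    have key : ∀ k (s' : Store), ((fun s' => (c.run s').setVar y ((c.run s').var y + 1))^[k] s').var x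
        = s'.var x := by
      intro k
      induction k with
      | zero => intro s'; rfl
      | succ k ihk =>
        intro s'
        rw [Function.iterate_succ_apply, ihk, Store.setVar_var, if_neg h.1, ih _ h.2]
    rw [key, Store.setVar_var, if_neg h.1]
  | skip => rfl

theorem run_arr (c : Prog) (s : Store) {k : ℕ} (h : k ∉ c.modArrs) :
    (c.run s).arr k = s.arr k := by
  induction c generalizing s with
  | assign y e => simp [run]
  | write l i e => simp_all [modArrs, run, Store.setArr_arr]
  | seq c d ihc ihd => simp_all [modArrs, run]
  | ite e c d ihc ihd =>
    simp only [modArrs, List.mem_append, not_or] at h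
    simp only [run]
    split_ifs
    exacts [ihd s h.2, ihc s h.1]
  | loop y c ih =>
    simp only [modArrs] at h
    simp only [run]
    have key : ∀ m (s' : Store), ((fun s' => (c.run s').setVar y ((c.run s').var y + 1))^[m] s').arr k
        = s'.arr k := by
      intro m
      induction m with
      | zero => intro s'; rfl
      | succ m ihk =>
        intro s'
        rw [Function.iterate_succ_apply, ihk, Store.setVar_arr, ih _ h]
    rw [key, Store.setVar_arr]
  | skip => rfl

/-- Invariants of loops: `P k` holds when the loop variable has reached `k`. -/
theorem run_loop_induct {x : ℕ} {c : Prog} {s : Store} (P : ℕ → Store → Prop)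
    (hx : x ∉ c.modVars) (h0 : 0 ∉ c.modArrs) (start : P 0 (s.setVar x 0))
    (step : ∀ k < s.arr 0 0, ∀ s' : Store, s'.var x = k → s'.arr 0 = s.arr 0 → P k s' →
      P (k + 1) ((c.run s').setVar x (k + 1))) :
    P (s.arr 0 0) ((loop x c).run s) := by
  simp only [run]
  have key : ∀ m ≤ s.arr 0 0, ∀ s'', s'' =
      ((fun s' => (c.run s').setVar x ((c.run s').var x + 1))^[m] (s.setVar x 0)) →
      s''.var x = m ∧ s''.arr 0 = s.arr 0 ∧ P m s'' := by
    intro m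
    induction m with
    | zero => rintro - s'' rfl; exact ⟨by simp [Store.setVar_var], rfl, start⟩
    | succ m ih =>
      rintro hm s'' rfl
      rw [Function.iterate_succ_apply']
      obtain ⟨h1, h2, h3⟩ := ih (by omega) _ rfl
      generalize ((fun s' => (c.run s').setVar x ((c.run s').var x + 1))^[m] (s.setVar x 0)) = s'
        at h1 h2 h3
      have h4 : (c.run s').var x = m := by rw [run_var _ _ hx, h1]
      refine ⟨by simp [Store.setVar_var, h4], by simp [run_arr _ _ h0, h2], ?_⟩
      simp only [h4]
      exact step m (by omega) s' h1 h2 h3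
  exact (key _ le_rfl _ rfl).2.2

theorem Tame.zero_notMem {c : Prog} (h : c.Tame) : 0 ∉ c.modArrs := by
  induction c with
  | assign => simp [modArrs]
  | write k i e => simp only [Tame] at h; simp [modArrs]; omega
  | seq c d ihc ihd => simp only [Tame] at h; simp [modArrs, ihc h.1, ihd h.2]
  | ite e c d ihc ihd => simp only [Tame] at h; simp [modArrs, ihc h.2.1, ihd h.2.2]
  | loop x c ih => simp only [Tame] at h; exact ih h.2
  | skip => simp [modArrs]

end Prog

/-! ### Cost of tame programs -/

/-- All numbers in the store have at most `B` bits. -/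
def Store.Bounded (s : Store) (B : ℕ) : Prop :=
  (∀ x, (s.var x).size ≤ B) ∧ ∀ k i, (s.arr k i).size ≤ B

theorem size_add_le (a b B : ℕ) (ha : a.size ≤ B) (hb : b.size ≤ B) : (a + b).size ≤ B + 1 := by
  rw [Nat.size_le] at *
  rw [pow_succ]; omega

theorem size_mul_le (a b A B : ℕ) (ha : a.size ≤ A) (hb : b.size ≤ B) :
    (a * b).size ≤ A + B := by
  rw [Nat.size_le] at *
  rw [pow_add]
  exact Nat.mul_lt_mul'' ha hb

/-- Bit lengths grow only additively: a sum adds one bit, truncated differences and quotients add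
none, and a product adds at most `X` bits because its second factor is an input number. Unrestricted
products would allow repeated squaring, hence doubling of the bit length in every round of a loop.
-/
theorem Expr.Tame.bound {e : Expr} (he : e.Tame) :
    ∃ C, ∀ (s : Store) (X B : ℕ), 1 ≤ X → (∀ i, (s.arr 0 i).size ≤ X) → s.Bounded B →
      (e.eval s).size ≤ B + C * X ∧ e.cost s ≤ C * X * (B + 1) := by
  induction e with
  | const c =>
    refine ⟨1 + c.size, fun s X B hX _ _ => ⟨?_, ?_⟩⟩
    · simp only [eval]; nlinarith
    · simp only [cost]; nlinarith [Nat.zero_le ((1 + c.size) * X * B), Nat.zero_le c.size]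
  | var x =>
    refine ⟨1, fun s X B hX _ h => ⟨?_, ?_⟩⟩
    · simp only [eval]; have := h.1 x; omega
    · simp only [cost]; have := h.1 x; nlinarith
  | read k e ih =>
    obtain ⟨C, hC⟩ := ih he
    refine ⟨C + 1, fun s X B hX hX' h => ⟨?_, ?_⟩⟩
    · simp only [eval]; have := h.2 k (e.eval s); nlinarith
    · simp only [cost, eval]
      have := h.2 k (e.eval s)
      have h2 := (hC s X B hX hX' h).2
      nlinarith
  | op o e f ihe ihf =>
    obtain ⟨het, hft, hmul⟩ : e.Tame ∧ f.Tame ∧ (o = .mul → ∃ g, f = .read 0 g) := by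
      cases o with
      | mul =>
        cases f with
        | read k g =>
          cases k with
          | zero => exact ⟨he.1, he.2, fun _ => ⟨g, rfl⟩⟩
          | succ k => exact he.elim
        | const | var | op => exact he.elim
      | add | sub | div => exact ⟨he.1, he.2, fun h => by cases h⟩
    obtain ⟨C, hC⟩ := ihe het
    obtain ⟨D, hD⟩ := ihf hft
    refine ⟨2 * (C + D + 2), fun s X B hX hX' h => ?_⟩
    obtain ⟨h1, h2⟩ := hC s X B hX hX' h
    obtain ⟨h3, h4⟩ := hD s X B hX hX' h
    have hv : ((Expr.op o e f).eval s).size ≤ B + (C + D + 1) * X := by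
      simp only [eval]
      cases o with
      | add =>
        have := size_add_le (e.eval s) (f.eval s) (B + (C + D) * X) (by nlinarith) (by nlinarith)
        simp only [Op.eval]; nlinarith
      | sub =>
        have := Nat.size_le_size (Nat.sub_le (e.eval s) (f.eval s))
        simp only [Op.eval]; nlinarith
      | div =>
        have := Nat.size_le_size (Nat.div_le_self (e.eval s) (f.eval s))
        simp only [Op.eval]; nlinarith
      | mul =>
        obtain ⟨g, rfl⟩ := hmul rfl
        have := size_mul_le (e.eval s) _ _ _ h1 (hX' (g.eval s))
        simp only [Op.eval, eval]; nlinarith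
    refine ⟨by nlinarith, ?_⟩
    simp only [cost]
    calc _ ≤ 1 + (B + (C + D + 1) * X) + C * X * (B + 1) + D * X * (B + 1) := by gcongr
      _ ≤ _ := by
        have : B ≤ X * (B + 1) := by nlinarith
        have : 1 ≤ X * (B + 1) := by nlinarith
        have : (C + D + 1) * X ≤ (C + D + 1) * X * (B + 1) := Nat.le_mul_of_pos_right _ (by omega)
        nlinarith

theorem Store.Bounded.setVar {s : Store} {B B' : ℕ} (h : s.Bounded B) (hB : B ≤ B') {x v : ℕ}
    (hv : v.size ≤ B') : (s.setVar x v).Bounded B' := by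
  refine ⟨fun y => ?_, fun k i => (h.2 k i).trans hB⟩
  rw [Store.setVar_var]
  split_ifs
  exacts [hv, (h.1 y).trans hB]

theorem Store.Bounded.setArr {s : Store} {B B' : ℕ} (h : s.Bounded B) (hB : B ≤ B') {k i v : ℕ}
    (hv : v.size ≤ B') : (s.setArr k i v).Bounded B' := by
  refine ⟨fun y => (h.1 y).trans hB, fun l j => ?_⟩
  rw [Store.setArr_arr]
  split_ifs with hl
  · rw [Function.update_apply]
    split_ifs
    exacts [hv, (h.2 k j).trans hB]
  · exact (h.2 l j).trans hB

theorem Store.Bounded.mono {s : Store} {B B' : ℕ} (h : s.Bounded B) (hB : B ≤ B') :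
    s.Bounded B' :=
  ⟨fun x => (h.1 x).trans hB, fun k i => (h.2 k i).trans hB⟩

/-- A tame program runs in polynomial time: `X` bounds the first input number and the bit lengths
of the input, `B` bounds the bit lengths of the numbers in the store. -/
theorem Prog.Tame.exec {c : Prog} (hc : c.Tame) :
    ∃ C d, ∀ (s : Store) (X B : ℕ), s.arr 0 0 + 1 ≤ X → (∀ i, (s.arr 0 i).size ≤ X) →
      s.Bounded B → ∃ t, Exec c.compile s t (c.run s) ∧ t ≤ C * X ^ d * (B + 1) ∧
        (c.run s).Bounded (B + C * X ^ d) := by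
  induction c with
  | skip =>
    refine ⟨1, 0, fun s X B _ _ h => ⟨1, .skip s, by simp, h.mono (by simp)⟩⟩
  | assign x e =>
    obtain ⟨C, hC⟩ := Expr.Tame.bound (e := e) hc
    refine ⟨C + 1, 1, fun s X B hX hX' h => ⟨_, .assign s x e, ?_, ?_⟩⟩
    · have := (hC s X B (by omega) hX' h).2
      nlinarith
    · have := (hC s X B (by omega) hX' h).1
      exact h.setVar (by omega) (by nlinarith)
  | write k i e =>
    obtain ⟨C, hC⟩ := Expr.Tame.bound (e := e) hc.2.2
    obtain ⟨D, hD⟩ := Expr.Tame.bound (e := i) hc.2.1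
    refine ⟨C + D + 1, 1, fun s X B hX hX' h => ⟨_, .write s k i e, ?_, ?_⟩⟩
    · have := (hC s X B (by omega) hX' h).2
      have := (hD s X B (by omega) hX' h).2
      nlinarith
    · have := (hC s X B (by omega) hX' h).1
      exact h.setArr (by omega) (by nlinarith)
  | seq c d ihc ihd =>
    obtain ⟨C, p, hC⟩ := ihc hc.1
    obtain ⟨D, q, hD⟩ := ihd hc.2
    -- The term `D * C` arises because the second program starts with numbers of up to `B + C * X ^
    -- p` bits.
    refine ⟨C + D + D * C, p + q, fun s X B hX hX' h => ?_⟩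
    obtain ⟨t, h1, h2, h3⟩ := hC s X B hX hX' h
    have ha : (c.run s).arr 0 = s.arr 0 := run_arr _ _ hc.1.zero_notMem
    obtain ⟨t', h4, h5, h6⟩ := hD (c.run s) X _ (by rwa [ha]) (by rwa [ha]) h3
    have hp : 1 ≤ X ^ p := Nat.one_le_pow _ _ (by omega)
    have hq : 1 ≤ X ^ q := Nat.one_le_pow _ _ (by omega)
    refine ⟨_, .seq h1 h4, ?_, h6.mono ?_⟩
    · rw [pow_add]
      generalize X ^ p = x at *
      generalize X ^ q = y at *
      calc t + t' ≤ C * x * (B + 1) + D * y * (B + C * x + 1) := by omega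
        _ ≤ C * (x * y) * (B + 1) + (D * (x * y) * (B + 1) + D * C * (x * y) * (B + 1)) := by
          gcongr
          · exact Nat.le_mul_of_pos_right _ hq
          · have : D * y * (B + 1) ≤ D * (x * y) * (B + 1) := by
              gcongr; exact Nat.le_mul_of_pos_left _ hp
            have : D * y * (C * x) ≤ D * C * (x * y) * (B + 1) := by
              calc _ = D * C * (x * y) := by ring
                _ ≤ _ := Nat.le_mul_of_pos_right _ (by omega)
            nlinarith
        _ = _ := by ring
    · rw [pow_add]
      have : C * X ^ p ≤ C * (X ^ p * X ^ q) := by gcongr; exact Nat.le_mul_of_pos_right _ hq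
      have : D * X ^ q ≤ D * (X ^ p * X ^ q) := by gcongr; exact Nat.le_mul_of_pos_left _ hp
      nlinarith [Nat.zero_le (D * C * (X ^ p * X ^ q))]
  | ite e c d ihc ihd =>
    obtain ⟨E, hE⟩ := Expr.Tame.bound (e := e) hc.1
    obtain ⟨C, p, hC⟩ := ihc hc.2.1
    obtain ⟨D, q, hD⟩ := ihd hc.2.2
    refine ⟨C + D + E + 1, p + q + 1, fun s X B hX hX' h => ?_⟩
    obtain ⟨-, h0⟩ := hE s X B (by omega) hX' h
    have hX1 : 1 ≤ X := by omega
    have hp : X ^ p ≤ X ^ (p + q + 1) := Nat.pow_le_pow_right hX1 (by omega)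
    have hq : X ^ q ≤ X ^ (p + q + 1) := Nat.pow_le_pow_right hX1 (by omega)
    have hx : X ≤ X ^ (p + q + 1) := Nat.le_self_pow (by omega) _
    have hpb : C * X ^ p ≤ C * X ^ (p + q + 1) := Nat.mul_le_mul_left _ hp
    have hqb : D * X ^ q ≤ D * X ^ (p + q + 1) := Nat.mul_le_mul_left _ hq
    have hxb : E * X ≤ E * X ^ (p + q + 1) := Nat.mul_le_mul_left _ hx
    have hx1 : 1 ≤ X ^ (p + q + 1) := hX1.trans hx
    generalize X ^ (p + q + 1) = Y at *
    have k1 := Nat.mul_le_mul_right (B + 1) hpb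
    have k2 := Nat.mul_le_mul_right (B + 1) hqb
    have k3 := Nat.mul_le_mul_right (B + 1) hxb
    have k4 : 1 ≤ Y * (B + 1) := Nat.mul_pos hx1 (by omega)
    have k5 : (C + D + E + 1) * Y * (B + 1)
        = C * Y * (B + 1) + D * Y * (B + 1) + E * Y * (B + 1) + Y * (B + 1) := by ring
    simp only [run, compile]
    split_ifs with hz
    · obtain ⟨t, h1, h2, h3⟩ := hD s X B hX hX' h
      refine ⟨_, .cond_false hz h1, ?_, h3.mono (by nlinarith)⟩
      omega
    · obtain ⟨t, h1, h2, h3⟩ := hC s X B hX hX' h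
      refine ⟨_, .cond_true hz h1, ?_, h3.mono (by nlinarith)⟩
      omega
  | loop x c ih =>
    obtain ⟨C, d, hC⟩ := ih hc.2
    have h0 := hc.2.zero_notMem
    set body : Prog := .seq c (.assign x (.op .add (.var x) (.const 1))) with hbody
    -- One round of the loop.
    have hround : ∃ K e, ∀ (s : Store) (X B : ℕ), s.arr 0 0 + 1 ≤ X →
        (∀ i, (s.arr 0 i).size ≤ X) → s.Bounded B → ∃ t, Exec body.compile s t (body.run s) ∧
          t + 1 + (Expr.op .sub (.read 0 (.const 0)) (.var x)).cost s ≤ K * X ^ e * (B + 1) ∧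
        (body.run s).Bounded (B + K * X ^ e) := by
      obtain ⟨E, hE⟩ := Expr.Tame.bound (e := .op .add (.var x) (.const 1)) (by simp [Expr.Tame])
      obtain ⟨F, hF⟩ := Expr.Tame.bound (e := .op .sub (.read 0 (.const 0)) (.var x))
        (by simp [Expr.Tame])
      refine ⟨C + E * (1 + C) + F + 2, d + 1, fun s X B hX hX' h => ?_⟩
      obtain ⟨t, h1, h2, h3⟩ := hC s X B hX hX' h
      have ha : (c.run s).arr 0 = s.arr 0 := run_arr _ _ h0
      obtain ⟨h4, h5⟩ := hE (c.run s) X _ (by omega) (by rwa [ha]) h3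
      obtain ⟨-, h6⟩ := hF s X B (by omega) hX' h
      have hX1 : 1 ≤ X := by omega
      have hd : 1 ≤ X ^ d := Nat.one_le_pow _ _ hX1
      refine ⟨_, .seq h1 (.assign _ _ _), ?_, h3.setVar ?_ (h4.trans ?_)⟩
      · rw [pow_succ]
        generalize X ^ d = y at *
        have e1 : C * y * (B + 1) ≤ C * (y * X) * (B + 1) := by
          gcongr; exact Nat.le_mul_of_pos_right _ hX1
        have e2 : E * X * (B + C * y + 1) ≤ E * (1 + C) * (y * X) * (B + 1) := by
          have : E * X * (B + 1) ≤ E * (y * X) * (B + 1) := by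
            gcongr; exact Nat.le_mul_of_pos_left _ hd
          have : E * X * (C * y) ≤ E * C * (y * X) * (B + 1) := by
            calc _ = E * C * (y * X) := by ring
              _ ≤ _ := Nat.le_mul_of_pos_right _ (by omega)
          nlinarith
        have e3 : F * X * (B + 1) ≤ F * (y * X) * (B + 1) := by
          gcongr; exact Nat.le_mul_of_pos_left _ hd
        have e4 : 1 ≤ (y * X) * (B + 1) := Nat.mul_pos (Nat.mul_pos hd hX1) (by omega)
        nlinarith
      · rw [pow_succ]
        have : C * X ^ d ≤ C * (X ^ d * X) := by gcongr; exact Nat.le_mul_of_pos_right _ hX1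
        nlinarith [Nat.zero_le ((E * (1 + C) + F + 2) * (X ^ d * X))]
      · rw [pow_succ]
        have e1 : C * X ^ d ≤ C * (X ^ d * X) := by gcongr; exact Nat.le_mul_of_pos_right _ hX1
        have e2 : E * X ≤ E * (X ^ d * X) := by gcongr; exact Nat.le_mul_of_pos_left _ hd
        nlinarith [Nat.zero_le ((E * C + F + 2) * (X ^ d * X))]
    obtain ⟨K, e, hK⟩ := hround
    have hrun : ∀ s, body.run s = (c.run s).setVar x ((c.run s).var x + 1) := fun s => rfl
    have hbv : ∀ s : Store, (body.run s).var x = s.var x + 1 := fun s => by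
      rw [hrun, Store.setVar_var, if_pos rfl, run_var _ _ hc.1]
    have hba : ∀ s : Store, (body.run s).arr 0 = s.arr 0 := fun s => by
      rw [hrun, Store.setVar_arr, run_arr _ _ h0]
    -- Here `m` is the number of rounds still to run; the factor `m + 1` also pays for the last,
    -- failing test of the guard.
    have hloop : ∀ (m : ℕ) (s : Store) (X B : ℕ), s.arr 0 0 + 1 ≤ X →
        (∀ i, (s.arr 0 i).size ≤ X) → s.Bounded B → s.arr 0 0 = s.var x + m →
        ∃ t, Exec (.loop (.op .sub (.read 0 (.const 0)) (.var x)) body.compile) s t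
            (body.run^[m] s) ∧
          t ≤ (m + 1) * (K * X ^ e * (B + m * (K * X ^ e) + 1)) ∧
          (body.run^[m] s).Bounded (B + m * (K * X ^ e)) := by
      intro m
      induction m with
      | zero =>
        intro s X B hX hX' h hm
        obtain ⟨t, -, h2, -⟩ := hK s X B hX hX' h
        refine ⟨_, .loop_false ?_, ?_, by simpa using h⟩
        · simp [Expr.eval, Op.eval]; omega
        · simp only [zero_mul, add_zero, zero_add, one_mul]; omega
      | succ m ihm =>
        intro s X B hX hX' h hm
        obtain ⟨t, h1, h2, h3⟩ := hK s X B hX hX' h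
        obtain ⟨t', h4, h5, h6⟩ := ihm (body.run s) X _ (by rwa [hba]) (by rwa [hba]) h3
          (by rw [hba, hbv]; omega)
        refine ⟨_, .loop_true ?_ h1 h4, ?_, ?_⟩
        · simp [Expr.eval, Op.eval]; omega
        · have e1 : B + K * X ^ e + m * (K * X ^ e) = B + (m + 1) * (K * X ^ e) := by ring
          rw [e1] at h5
          have e2 : K * X ^ e * (B + 1) ≤ K * X ^ e * (B + (m + 1) * (K * X ^ e) + 1) := by
            gcongr; exact Nat.le_add_right _ _
          calc _ = (t + 1 + (Expr.op .sub (.read 0 (.const 0)) (.var x)).cost s) + t' := by ring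
            _ ≤ K * X ^ e * (B + (m + 1) * (K * X ^ e) + 1)
                + (m + 1) * (K * X ^ e * (B + (m + 1) * (K * X ^ e) + 1)) :=
              Nat.add_le_add (h2.trans e2) h5
            _ = _ := by ring
        · rw [Function.iterate_succ_apply]
          exact h6.mono (by rw [add_assoc, add_mul, one_mul]; omega)
    -- There are fewer than `X` rounds, each adding at most `K * X ^ e` bits, so the cost is at most
    -- `X * (K * X ^ e) * (B + 1 + X * (K * X ^ e))`. This explains `K * K` and the doubled
    -- exponent; the 3 covers the initial assignment.
    refine ⟨3 + K + K * K, 2 * e + 2, fun s X B hX hX' h => ?_⟩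
    have hs : (s.setVar x 0).Bounded B := h.setVar le_rfl (by simp)
    obtain ⟨t, h1, h2, h3⟩ := hloop (s.arr 0 0) (s.setVar x 0) X B hX hX' hs
      (by simp [Store.setVar_var])
    have hX1 : 1 ≤ X := by omega
    have he : 1 ≤ X ^ e := Nat.one_le_pow _ _ hX1
    have hpow : X ^ (2 * e + 2) = X ^ e * X ^ e * X * X := by ring
    have hn : s.arr 0 0 ≤ X := by omega
    refine ⟨_, .seq (.assign _ _ _) h1, ?_, h3.mono ?_⟩
    · rw [hpow]
      generalize X ^ e = y at *
      have e0 : (1 : ℕ) ≤ y * y * X * X * (B + 1) := by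
        have : 0 < y * y * X * X := by positivity
        nlinarith
      have e1 : y * X ≤ y * y * X * X := by
        calc y * X = (y * X) * 1 := by ring
          _ ≤ (y * X) * (y * X) := Nat.mul_le_mul_left _ (Nat.mul_pos he hX1)
          _ = _ := by ring
      have e2 : t ≤ X * (K * y * (B + 1 + X * (K * y))) := by
        refine h2.trans ?_
        have k1 := Nat.mul_le_mul_right (K * y) hn
        exact Nat.mul_le_mul hX (Nat.mul_le_mul_left _ (by omega))
      have e3 : X * (K * y * (B + 1 + X * (K * y)))
          = K * (y * X) * (B + 1) + K * K * (y * y * X * X) := by ring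
      have e4 : K * (y * X) * (B + 1) ≤ K * (y * y * X * X) * (B + 1) := by gcongr
      have e5 : K * K * (y * y * X * X) ≤ K * K * (y * y * X * X) * (B + 1) :=
        Nat.le_mul_of_pos_right _ (by omega)
      simp only [Expr.cost, Nat.size_zero]
      nlinarith
    · rw [hpow]
      have e1 : s.arr 0 0 * (K * X ^ e) ≤ X * (K * X ^ e) := by gcongr
      have e2 : X * X ^ e ≤ X ^ e * X ^ e * X * X := by
        calc X * X ^ e = (X ^ e * X) * 1 := by ring
          _ ≤ (X ^ e * X) * (X ^ e * X) := Nat.mul_le_mul_left _ (Nat.mul_pos he hX1)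
          _ = _ := by ring
      have e3 : X * (K * X ^ e) ≤ K * (X ^ e * X ^ e * X * X) := by
        calc _ = K * (X * X ^ e) := by ring
          _ ≤ _ := Nat.mul_le_mul_left _ e2
      nlinarith [Nat.zero_le ((3 + K * K) * (X ^ e * X ^ e * X * X))]

end RAM

/-! ## The Hungarian method

Rows and columns are the numbers below `n`. A matching is a function `m` on columns, where
`m j = i + 1` means that column `j` is matched to row `i`, and `m j = 0` that it is free. -/

namespace Assignment

/-- `m` matches exactly the rows in `R`. -/
structure Matching (n : ℕ) (R : ℕ → Prop) (m : ℕ → ℕ) : Prop where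
  range : ∀ j < n, ∀ i, m j = i + 1 → i < n ∧ R i
  inj : ∀ j < n, ∀ j' < n, ∀ i, m j = i + 1 → m j' = i + 1 → j = j'
  surj : ∀ i < n, R i → ∃ j < n, m j = i + 1

def Tight (n : ℕ) (a : ℕ → ℕ → ℕ) (u v m : ℕ → ℕ) : Prop :=
  ∀ j < n, ∀ i, m j = i + 1 → a i j = u i + v j

def Feasible (n : ℕ) (a : ℕ → ℕ → ℕ) (u v : ℕ → ℕ) : Prop :=
  ∀ i < n, ∀ j < n, a i j ≤ u i + v j

/-- `p` is an optimal matching of the rows below `r`, certified by the dual solution `u`, `v`. -/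
structure Optimal (n r : ℕ) (a : ℕ → ℕ → ℕ) (u v p : ℕ → ℕ) : Prop where
  feas : Feasible n a u v
  free : ∀ j < n, p j = 0 → v j = 0
  matching : Matching n (· < r) p
  tight : Tight n a u v p

/-- The search for an augmenting path from row `r`: `S` and `T` are the rows and columns reached,
and `m i` is the matching obtained from `p` by exposing the row `i` of `S` instead of `r`. -/
structure Search (n r : ℕ) (a : ℕ → ℕ → ℕ) (p u v S T : ℕ → ℕ) (m : ℕ → ℕ → ℕ) : Prop where
  feas : Feasible n a u v
  free : ∀ j < n, p j = 0 → v j = 0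
  matching : Matching n (· < r) p
  matched : ∀ j < n, T j ≠ 0 → p j ≠ 0
  mem_iff : ∀ i < n, S i ≠ 0 ↔ i = r ∨ ∃ j < n, T j ≠ 0 ∧ p j = i + 1
  exposed : ∀ i < n, S i ≠ 0 → Matching n (fun k => k ≤ r ∧ k ≠ i) (m i)
  tight : ∀ i < n, S i ≠ 0 → Tight n a u v (m i)
  eq_zero_iff : ∀ i < n, S i ≠ 0 → ∀ j < n, m i j = 0 ↔ p j = 0
  outside : ∀ i < n, S i ≠ 0 → ∀ j < n, T j = 0 → m i j = p j
  inside : ∀ i < n, S i ≠ 0 → ∀ j < n, T j ≠ 0 → ∀ k, m i j = k + 1 → S k ≠ 0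

/-- `(i, j)` is a pair of least slack `δ` among the rows reached and the columns not reached. -/
structure MinSlack (n : ℕ) (a : ℕ → ℕ → ℕ) (u v S T : ℕ → ℕ) (i j δ : ℕ) : Prop where
  row_lt : i < n
  row_mem : S i ≠ 0
  col_lt : j < n
  col_notMem : T j = 0
  eq : δ = u i + v j - a i j
  le : ∀ i' < n, S i' ≠ 0 → ∀ j' < n, T j' = 0 → δ ≤ u i' + v j' - a i' j'

/-- Pigeonhole: if all columns were matched, `n` columns would inject into `r` rows. -/
theorem Matching.exists_free {n r : ℕ} {p : ℕ → ℕ} (h : Matching n (· < r) p) (hr : r < n) :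
    ∃ j < n, p j = 0 := by
  by_contra! hp
  have := Finset.card_le_card_of_injOn (s := Finset.range n) (t := Finset.range r)
    (fun j => p j - 1)
    (fun j hj => by
      have hj : j < n := by simpa using hj
      have h1 := hp j hj
      have h2 := (h.range j hj (p j - 1) (by omega)).2
      simpa using h2)
    (fun j hj j' hj' e => by
      have hj : j < n := by simpa using hj
      have hj' : j' < n := by simpa using hj'
      have h1 := hp j hj
      have h2 := hp j' hj'
      simp only at e
      exact h.inj j hj j' hj' (p j - 1) (by omega) (by omega))
  simp at this
  omega

section

variable {n r : ℕ} {a : ℕ → ℕ → ℕ} {p u v S T : ℕ → ℕ} {m : ℕ → ℕ → ℕ}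

/-- At the start only row `r` is reached, and exposing it leaves `p` unchanged. Keeping a full
matching for each reached row, instead of a tree of predecessors, means that an augmentation never
has to trace a path back. -/
theorem Optimal.search (h : Optimal n r a u v p) (hr : r < n)
    (hS : ∀ i < n, S i ≠ 0 ↔ i = r) (hT : ∀ j < n, T j = 0) (hm : ∀ j < n, m r j = p j) :
    Search n r a p u v S T m where
  feas := h.feas
  free := h.free
  matching := h.matching
  matched j hj h1 := absurd (hT j hj) h1
  mem_iff i hi := by
    rw [hS i hi]
    refine ⟨Or.inl, ?_⟩
    rintro (h1 | ⟨j, hj, h1, -⟩)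
    exacts [h1, absurd (hT j hj) h1]
  exposed i hi h1 := by
    obtain rfl := (hS i hi).1 h1
    refine ⟨fun j hj k hk => ?_, fun j hj j' hj' k hk hk' => ?_, fun k hk hk' => ?_⟩
    · rw [hm j hj] at hk
      have := h.matching.range j hj k hk
      omega
    · rw [hm j hj] at hk
      rw [hm j' hj'] at hk'
      exact h.matching.inj j hj j' hj' k hk hk'
    · obtain ⟨j, hj, e⟩ := h.matching.surj k hk (by omega)
      exact ⟨j, hj, by rw [hm j hj, e]⟩
  tight i hi h1 := by
    obtain rfl := (hS i hi).1 h1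
    intro j hj k hk
    rw [hm j hj] at hk
    exact h.tight j hj k hk
  eq_zero_iff i hi h1 j hj := by
    obtain rfl := (hS i hi).1 h1
    rw [hm j hj]
  outside i hi h1 j hj _ := by
    obtain rfl := (hS i hi).1 h1
    rw [hm j hj]
  inside i hi h1 j hj h2 := absurd (hT j hj) h2

theorem Search.exists_free (h : Search n r a p u v S T m) (hr : r < n) :
    ∃ j < n, p j = 0 ∧ T j = 0 := by
  obtain ⟨j, hj, e⟩ := h.matching.exists_free hr
  exact ⟨j, hj, e, by_contra fun h1 => h.matched j hj h1 e⟩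

/-- A free column is never reached. This strict bound is what makes `n` rounds of the search enough.
-/
theorem Search.card_lt (h : Search n r a p u v S T m) (hr : r < n) :
    ((Finset.range n).filter fun j => T j ≠ 0).card < n := by
  obtain ⟨j, hj, -, e⟩ := h.exists_free hr
  calc _ < (Finset.range n).card := Finset.card_lt_card (Finset.filter_ssubset.2 ⟨j, by simpa, by simpa⟩)
    _ = n := by simp

variable {bi bj δ : ℕ}

/-- An unreached free column has dual value 0, so its slack with row `i` is at most `u i`. Hence the
subtraction in the dual update is never truncated and the duals remain nonnegative. -/
theorem Search.le_of_minSlack (h : Search n r a p u v S T m) (hr : r < n)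
    (hb : MinSlack n a u v S T bi bj δ) {i : ℕ} (hi : i < n) (hS : S i ≠ 0) : δ ≤ u i := by
  obtain ⟨j, hj, hp, hT⟩ := h.exists_free hr
  have h1 := hb.le i hi hS j hj hT
  have h2 := h.free j hj hp
  omega

/-- After the dual update the search is still valid, and the chosen pair is tight. -/
theorem Search.dualUpdate (h : Search n r a p u v S T m) (hr : r < n)
    (hb : MinSlack n a u v S T bi bj δ) {u' v' : ℕ → ℕ}
    (hu : ∀ i < n, u' i = if S i ≠ 0 then u i - δ else u i)
    (hv : ∀ j < n, v' j = if T j ≠ 0 then v j + δ else v j) :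
    Search n r a p u' v' S T m ∧ a bi bj = u' bi + v' bj := by
  refine ⟨{ h with feas := ?_, free := ?_, tight := ?_ }, ?_⟩
  -- Only pairs of a reached row and an unreached column see their dual sum decrease, and their
  -- slack is at least `δ`.
  · intro i hi j hj
    rw [hu i hi, hv j hj]
    have h1 := h.feas i hi j hj
    by_cases hS : S i ≠ 0 <;> by_cases hT : T j ≠ 0
    · have := h.le_of_minSlack hr hb hi hS
      rw [if_pos hS, if_pos hT]
      omega
    · have := h.le_of_minSlack hr hb hi hS
      have := hb.le i hi hS j hj (not_not.1 hT)
      rw [if_pos hS, if_neg hT]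
      omega
    · rw [if_neg hS, if_pos hT]
      omega
    · rw [if_neg hS, if_neg hT]
      omega
  · intro j hj hp
    rw [hv j hj, if_neg, h.free j hj hp]
    exact fun hT => h.matched j hj hT hp
  -- Pairs of the stored matchings keep their dual sum: a reached column is matched to a reached
  -- row, so the changes cancel, while an unreached column is matched as in `p`, to an unreached
  -- row.
  · intro i hi hS j hj k hk
    have hkn := ((h.exposed i hi hS).range j hj k hk).1
    rw [hu k hkn, hv j hj, h.tight i hi hS j hj k hk]
    by_cases hT : T j ≠ 0
    · have hSk := h.inside i hi hS j hj hT k hk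
      have := h.le_of_minSlack hr hb hkn hSk
      rw [if_pos hT, if_pos hSk]
      omega
    · have hp := h.outside i hi hS j hj (not_not.1 hT)
      rw [hk] at hp
      have hSk : ¬ S k ≠ 0 := by
        rw [h.mem_iff k hkn]
        rintro (rfl | ⟨j', hj', hT', e⟩)
        · exact lt_irrefl _ (h.matching.range j hj k hp.symm).2
        · obtain rfl := h.matching.inj j hj j' hj' k hp.symm e
          exact hT hT'
      rw [if_neg hT, if_neg hSk]
  · rw [hu bi hb.row_lt, hv bj hb.col_lt, if_pos hb.row_mem, if_neg (not_not.2 hb.col_notMem)]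
    have h1 := h.feas bi hb.row_lt bj hb.col_lt
    have h2 := h.le_of_minSlack hr hb hb.row_lt hb.row_mem
    have h3 := hb.eq
    omega

/-- A matched column `bj` joined to a reached row by a tight pair extends the search. -/
theorem Search.grow (h : Search n r a p u v S T m) (hbi : bi < n) (hSi : S bi ≠ 0)
    (hbj : bj < n) (hTj : T bj = 0) (htight : a bi bj = u bi + v bj) {k : ℕ} (hk : p bj = k + 1)
    {S' T' : ℕ → ℕ} {m' : ℕ → ℕ → ℕ} (hS' : ∀ i, S' i = if i = k then 1 else S i)
    (hT' : ∀ j, T' j = if j = bj then 1 else T j)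
    (hm' : ∀ i < n, ∀ j < n,
      m' i j = if i = k then if j = bj then bi + 1 else m bi j else m i j) :
    Search n r a p u v S' T' m' := by
  obtain ⟨hkn, hkr⟩ := h.matching.range bj hbj k hk
  -- Row `k` is new: `p` leaves `r` exposed, and it matches `k` to `bj` only, which is not yet
  -- reached.
  have hSk : S k = 0 := by
    by_contra hc
    rcases (h.mem_iff k hkn).1 hc with rfl | ⟨j, hj, hT, e⟩
    · exact lt_irrefl _ hkr
    · obtain rfl := h.matching.inj j hj bj hbj k e hk
      exact hT hTj
  have hbik : bi ≠ k := by rintro rfl; exact hSi hSk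
  have hmb : m bi bj = k + 1 := by rw [h.outside bi hbi hSi bj hbj hTj, hk]
  have hold : ∀ i < n, S' i ≠ 0 → i ≠ k → S i ≠ 0 := fun i _ h1 h2 => by
    rwa [hS', if_neg h2] at h1
  have hTold : ∀ j, j ≠ bj → T' j = T j := fun j hj => by rw [hT', if_neg hj]
  have hSmono : ∀ i, S i ≠ 0 → S' i ≠ 0 := fun i hi => by
    rw [hS']; split_ifs <;> simp_all
  refine { h with matched := ?_, mem_iff := ?_, exposed := ?_, tight := ?_, eq_zero_iff := ?_,
                  outside := ?_, inside := ?_ }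
  · intro j hj hT
    by_cases e : j = bj
    · rw [e, hk]; omega
    · exact h.matched j hj (by rwa [hTold j e] at hT)
  · intro i hi
    constructor
    · intro hS
      by_cases e : i = k
      · exact Or.inr ⟨bj, hbj, by simp [hT'], by rw [hk, e]⟩
      · rcases (h.mem_iff i hi).1 (hold i hi hS e) with h1 | ⟨j, hj, h1, h2⟩
        · exact Or.inl h1
        · exact Or.inr ⟨j, hj, by rw [hT']; split_ifs <;> simp_all, h2⟩
    · rintro (h1 | ⟨j, hj, h1, h2⟩)
      · exact hSmono i ((h.mem_iff i hi).2 (Or.inl h1))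
      · by_cases e : j = bj
        · have : i = k := by rw [e, hk] at h2; omega
          simp [hS', this]
        · exact hSmono i ((h.mem_iff i hi).2 (Or.inr ⟨j, hj, by rwa [hTold j e] at h1, h2⟩))
  · intro i hi hS
    by_cases e : i = k
    -- To expose the new row, start from the matching that exposes `bi` and pass column `bj` from
    -- the new row to `bi`.
    · subst e
      have hM := h.exposed bi hbi hSi
      refine ⟨fun j hj l hl => ?_, fun j hj j' hj' l hl hl' => ?_, fun l hl hl' => ?_⟩
      · rw [hm' i hi j hj, if_pos rfl] at hl
        split_ifs at hl with e
        · obtain rfl : bi = l := by omega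
          refine ⟨hbi, ?_, hbik⟩
          rcases (h.mem_iff bi hbi).1 hSi with rfl | ⟨j', hj', -, h2⟩
          · exact le_rfl
          · exact (h.matching.range j' hj' bi h2).2.le
        · obtain ⟨h1, h2, h3⟩ := hM.range j hj l hl
          refine ⟨h1, h2, ?_⟩
          rintro rfl
          exact e (hM.inj j hj bj hbj l hl hmb)
      · rw [hm' i hi j hj, if_pos rfl] at hl
        rw [hm' i hi j' hj', if_pos rfl] at hl'
        split_ifs at hl hl' with e e' e'
        · rw [e, e']
        · exact absurd (by omega) ((hM.range j' hj' l hl').2.2)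
        · exact absurd (by omega) ((hM.range j hj l hl).2.2)
        · exact hM.inj j hj j' hj' l hl hl'
      · by_cases e : l = bi
        · exact ⟨bj, hbj, by rw [hm' i hi bj hbj, if_pos rfl, if_pos rfl, e]⟩
        · obtain ⟨j, hj, h1⟩ := hM.surj l hl ⟨hl'.1, e⟩
          refine ⟨j, hj, ?_⟩
          rw [hm' i hi j hj, if_pos rfl, if_neg, h1]
          rintro rfl
          rw [hmb] at h1
          exact hl'.2 (by omega)
    · have hM := h.exposed i hi (hold i hi hS e)
      refine ⟨fun j hj l hl => ?_, fun j hj j' hj' l hl hl' => ?_, fun l hl hl' => ?_⟩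
      · rw [hm' i hi j hj, if_neg e] at hl
        exact hM.range j hj l hl
      · rw [hm' i hi j hj, if_neg e] at hl
        rw [hm' i hi j' hj', if_neg e] at hl'
        exact hM.inj j hj j' hj' l hl hl'
      · obtain ⟨j, hj, h1⟩ := hM.surj l hl hl'
        exact ⟨j, hj, by rw [hm' i hi j hj, if_neg e, h1]⟩
  · intro i hi hS j hj l hl
    rw [hm' i hi j hj] at hl
    split_ifs at hl with e e'
    · obtain rfl : bi = l := by omega
      rw [e', htight]
    · exact h.tight bi hbi hSi j hj l hl
    · exact h.tight i hi (hold i hi hS e) j hj l hl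
  · intro i hi hS j hj
    rw [hm' i hi j hj]
    split_ifs with e e'
    · rw [e', hk]; simp
    · exact h.eq_zero_iff bi hbi hSi j hj
    · exact h.eq_zero_iff i hi (hold i hi hS e) j hj
  · intro i hi hS j hj hT
    have hjb : j ≠ bj := by rintro rfl; simp [hT'] at hT
    rw [hTold j hjb] at hT
    rw [hm' i hi j hj, if_neg hjb]
    split_ifs with e
    · exact h.outside bi hbi hSi j hj hT
    · exact h.outside i hi (hold i hi hS e) j hj hT
  · intro i hi hS j hj hT l hl
    rw [hm' i hi j hj] at hl
    split_ifs at hl with e e'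
    · obtain rfl : bi = l := by omega
      exact hSmono _ hSi
    · exact hSmono _ (h.inside bi hbi hSi j hj (by rwa [hTold j e'] at hT) l hl)
    · by_cases e' : j = bj
      · have := h.outside i hi (hold i hi hS e) bj hbj hTj
        rw [← e', hl, e', hk] at this
        simp [hS', show l = k by omega]
      · exact hSmono _ (h.inside i hi (hold i hi hS e) j hj (by rwa [hTold j e'] at hT) l hl)

/-- A free column joined to a reached row by a tight pair yields a larger optimal matching. -/
theorem Search.augment (h : Search n r a p u v S T m) (hbi : bi < n) (hSi : S bi ≠ 0)
    (hbj : bj < n) (htight : a bi bj = u bi + v bj) (hp : p bj = 0)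
    {p' : ℕ → ℕ} (hp' : ∀ j < n, p' j = if j = bj then bi + 1 else m bi j) :
    Optimal n (r + 1) a u v p' := by
  have hM := h.exposed bi hbi hSi
  have hbir : bi ≤ r := by
    rcases (h.mem_iff bi hbi).1 hSi with rfl | ⟨j', hj', -, h2⟩
    · exact le_rfl
    · exact (h.matching.range j' hj' bi h2).2.le
  refine ⟨h.feas, fun j hj e => ?_, ⟨fun j hj l hl => ?_, fun j hj j' hj' l hl hl' => ?_,
    fun l hl hl' => ?_⟩, fun j hj l hl => ?_⟩
  · rw [hp' j hj] at e
    split_ifs at e with e'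
    exact h.free j hj ((h.eq_zero_iff bi hbi hSi j hj).1 e)
  · rw [hp' j hj] at hl
    split_ifs at hl with e
    · obtain rfl : bi = l := by omega
      omega
    · have := hM.range j hj l hl
      omega
  · rw [hp' j hj] at hl
    rw [hp' j' hj'] at hl'
    split_ifs at hl hl' with e e' e'
    · rw [e, e']
    · exact absurd (by omega) ((hM.range j' hj' l hl').2.2)
    · exact absurd (by omega) ((hM.range j hj l hl).2.2)
    · exact hM.inj j hj j' hj' l hl hl'
  · by_cases e : l = bi
    · exact ⟨bj, hbj, by rw [hp' bj hbj, if_pos rfl, e]⟩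
    · obtain ⟨j, hj, h1⟩ := hM.surj l hl ⟨by omega, e⟩
      refine ⟨j, hj, ?_⟩
      rw [hp' j hj, if_neg, h1]
      rintro rfl
      rw [(h.eq_zero_iff bi hbi hSi j hj).2 hp] at h1
      omega
  · rw [hp' j hj] at hl
    split_ifs at hl with e
    · obtain rfl : bi = l := by omega
      rw [e, htight]
    · exact h.tight bi hbi hSi j hj l hl

/-- Strong duality: the dual solution has the value of the matching. -/
theorem Optimal.sum_eq (h : Optimal n n a u v p) :
    ∑ j ∈ Finset.range n, (if p j = 0 then 0 else a (p j - 1) j) =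
      ∑ i ∈ Finset.range n, u i + ∑ j ∈ Finset.range n, v j := by
  -- Complementary slackness: matched pairs are tight and free columns have dual value 0. The row
  -- duals are then reindexed along the matching, which covers every row.
  have h1 : ∀ j ∈ Finset.range n, (if p j = 0 then 0 else a (p j - 1) j)
      = (if p j = 0 then 0 else u (p j - 1)) + v j := by
    intro j hj
    have hj : j < n := by simpa using hj
    split_ifs with e
    · simp [h.free j hj e]
    · exact h.tight j hj (p j - 1) (by omega)
  rw [Finset.sum_congr rfl h1, Finset.sum_add_distrib]
  congr 1
  rw [← Finset.sum_filter_add_sum_filter_not _ (fun j => p j = 0)]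
  rw [Finset.sum_eq_zero (fun j hj => by simp_all), zero_add]
  refine Finset.sum_bij (fun j _ => p j - 1) ?_ ?_ ?_ ?_
  · intro j hj
    simp only [Finset.mem_filter, Finset.mem_range] at hj
    simpa using (h.matching.range j hj.1 (p j - 1) (by omega)).1
  · intro j hj j' hj' e
    simp only [Finset.mem_filter, Finset.mem_range] at hj hj'
    exact h.matching.inj j hj.1 j' hj'.1 (p j - 1) (by omega) (by omega)
  · intro i hi
    have hi : i < n := by simpa using hi
    obtain ⟨j, hj, e⟩ := h.matching.surj i hi hi
    exact ⟨j, by simp [hj, e], by simp [e]⟩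
  · intro j hj
    simp only [Finset.mem_filter, Finset.mem_range] at hj
    rw [if_neg hj.2]

end

end Assignment

namespace RAM

/-! ## The program -/

namespace Expr

instance : Add Expr := ⟨.op .add⟩
instance : Sub Expr := ⟨.op .sub⟩
instance : Mul Expr := ⟨.op .mul⟩
instance : Div Expr := ⟨.op .div⟩

theorem eval_const (s : Store) (c : ℕ) : (const c).eval s = c := rfl
theorem eval_var (s : Store) (x : ℕ) : (var x).eval s = s.var x := rfl
theorem eval_read (s : Store) (k : ℕ) (e : Expr) : (read k e).eval s = s.arr k (e.eval s) := rfl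
theorem eval_add (s : Store) (e f : Expr) : (e + f).eval s = e.eval s + f.eval s := rfl
theorem eval_sub (s : Store) (e f : Expr) : (e - f).eval s = e.eval s - f.eval s := rfl
theorem eval_mul (s : Store) (e f : Expr) : (e * f).eval s = e.eval s * f.eval s := rfl
theorem eval_div (s : Store) (e f : Expr) : (e / f).eval s = e.eval s / f.eval s := rfl

/-- Nonzero if and only if the values differ. -/
def ne (e f : Expr) : Expr := (e - f) + (f - e)

theorem eval_ne_eq_zero (s : Store) (e f : Expr) : (ne e f).eval s = 0 ↔ e.eval s = f.eval s := by
  simp only [ne, eval_add, eval_sub]; omega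

/-- The position of entry `(e, f)` of an `n × n` matrix in row-major order. -/
def idx (e f : Expr) : Expr := e * read 0 (const 0) + f

theorem eval_idx (s : Store) (e f : Expr) :
    (idx e f).eval s = e.eval s * s.arr 0 0 + f.eval s := rfl

/-- The absolute value of the numerator of the entry at a position of the input matrix. -/
def numer (e : Expr) : Expr := read 0 (e + e + e + const 2)

/-- The denominator of the entry at a position of the input matrix. -/
def denom (e : Expr) : Expr := read 0 (e + e + e + const 3)

/-- Cell 0 holds the dimension, and each rational occupies three cells (sign, absolute numerator,
denominator), so entry `q` occupies cells `3q + 1` to `3q + 3`. Tripling is done by addition because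
3 is not an input number and the product would not be tame. -/
theorem eval_numer (s : Store) (e : Expr) : (numer e).eval s = s.arr 0 (3 * e.eval s + 2) := by
  simp only [numer, eval_read, eval_add, eval_const]; congr 1; omega

theorem eval_denom (s : Store) (e : Expr) : (denom e).eval s = s.arr 0 (3 * e.eval s + 3) := by
  simp only [denom, eval_read, eval_add, eval_const]; congr 1; omega

theorem tame_const (c : ℕ) : (const c).Tame := trivial
theorem tame_var (x : ℕ) : (var x).Tame := trivial
theorem tame_read (k : ℕ) (e : Expr) : (read k e).Tame ↔ e.Tame := Iff.rfl
theorem tame_add (e f : Expr) : (e + f).Tame ↔ e.Tame ∧ f.Tame := Iff.rfl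
theorem tame_sub (e f : Expr) : (e - f).Tame ↔ e.Tame ∧ f.Tame := Iff.rfl
theorem tame_div (e f : Expr) : (e / f).Tame ↔ e.Tame ∧ f.Tame := Iff.rfl
theorem tame_mul_read (e f : Expr) : (e * read 0 f).Tame ↔ e.Tame ∧ f.Tame := Iff.rfl

theorem tame_ne (e f : Expr) : (ne e f).Tame ↔ e.Tame ∧ f.Tame := by
  simp only [ne, tame_add, tame_sub]; tauto

theorem tame_idx (e f : Expr) : (idx e f).Tame ↔ e.Tame ∧ f.Tame := by
  simp [idx, tame_add, tame_mul_read, tame_const]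

theorem tame_numer (e : Expr) : (numer e).Tame ↔ e.Tame := by
  simp [numer, tame_add, tame_read, tame_const]

theorem tame_denom (e : Expr) : (denom e).Tame ↔ e.Tame := by
  simp [denom, tame_add, tame_read, tame_const]

theorem tame_mul_numer (e f : Expr) : (e * numer f).Tame ↔ e.Tame ∧ f.Tame := by
  simp [numer, tame_add, tame_mul_read, tame_const]

theorem tame_mul_denom (e f : Expr) : (e * denom f).Tame ↔ e.Tame ∧ f.Tame := by
  simp [denom, tame_add, tame_mul_read, tame_const]

end Expr

namespace Prog

open RAM.Expr

/-- Execution of a list of programs one after the other. -/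
def block : List Prog → Prog
  | [] => skip
  | c :: l => seq c (block l)

theorem run_block_nil (s : Store) : (block []).run s = s := rfl
theorem run_block_cons (c : Prog) (l : List Prog) (s : Store) :
    (block (c :: l)).run s = (block l).run (c.run s) := rfl
theorem run_assign (x : ℕ) (e : Expr) (s : Store) :
    (assign x e).run s = s.setVar x (e.eval s) := rfl
theorem run_write (k : ℕ) (i e : Expr) (s : Store) :
    (write k i e).run s = s.setArr k (i.eval s) (e.eval s) := rfl
theorem run_ite (e : Expr) (c d : Prog) (s : Store) :
    (ite e c d).run s = if e.eval s = 0 then d.run s else c.run s := rfl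
theorem run_skip (s : Store) : skip.run s = s := rfl

/-! Registers: 2, 3, 4 are counters (`i`, `j`, `k`), 5 the current row, 6 counts search steps,
7 tells whether the search is over, 8 whether a pair was found, 9, 10, 11 are its slack, row and
column, 12 and 13 two components to be merged, 14 tells whether colours differ, 15 is the common
denominator, 16 the number of blocks.

Arrays: 2 components, 3 colours, 4 integral weights, 5 and 6 the dual solution on rows and columns,
7 the matching, 8 and 9 the rows and columns reached, 10 the alternating matchings, 11 the mates. -/

/-! ### Two-colouring by merging components -/

/-- Move the vertices of component `cj` to component `ci`, exchanging the colours if necessary. -/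
def renumber : Prog :=
  loop 4 <| ite (ne (read 2 (var 4)) (var 13)) skip <| block
    [ite (var 14) skip (write 3 (var 4) (const 1 - read 3 (var 4))), write 2 (var 4) (var 12)]

/-- Merge the components of the vertices `i` and `j`. -/
def merge : Prog := block
  [assign 12 (read 2 (var 2)), assign 13 (read 2 (var 3)),
    assign 14 (ne (read 3 (var 2)) (read 3 (var 3))), renumber]

/-- Colour the vertices by 0 and 1 such that no interaction joins vertices of equal colour. -/
def colour : Prog := block
  [loop 2 (write 2 (var 2) (var 2)),
    loop 2 <| loop 3 <| ite (numer (idx (var 2) (var 3)))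
      (ite (ne (var 2) (var 3)) merge skip) skip]

theorem renumber_spec (s : Store) :
    (∀ v < s.arr 0 0, (renumber.run s).arr 2 v =
      if s.arr 2 v = s.var 13 then s.var 12 else s.arr 2 v) ∧
    (∀ v < s.arr 0 0, (renumber.run s).arr 3 v =
      if s.arr 2 v = s.var 13 ∧ s.var 14 = 0 then 1 - s.arr 3 v else s.arr 3 v) := by
  have := run_loop_induct (x := 4) (s := s)
    (c := ite (ne (read 2 (var 4)) (var 13)) skip <| block
      [ite (var 14) skip (write 3 (var 4) (const 1 - read 3 (var 4))), write 2 (var 4) (var 12)])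
    (fun k s' => s'.var 12 = s.var 12 ∧ s'.var 13 = s.var 13 ∧ s'.var 14 = s.var 14 ∧
      (s'.arr 2 = fun v => if v < k ∧ s.arr 2 v = s.var 13 then s.var 12 else s.arr 2 v) ∧
      (s'.arr 3 = fun v => if v < k ∧ s.arr 2 v = s.var 13 ∧ s.var 14 = 0 then 1 - s.arr 3 v
        else s.arr 3 v))
    (by decide) (by decide) (by simp [Store.setVar_var]) ?_
  · obtain ⟨-, -, -, h2, h3⟩ := this
    refine ⟨fun v hv => ?_, fun v hv => ?_⟩
    · rw [renumber, h2]; simp [hv]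
    · rw [renumber, h3]; simp [hv]
  · rintro k hk s' hx - ⟨h12, h13, h14, h2, h3⟩
    simp only [run_ite, eval_ne_eq_zero, eval_read, eval_var, run_block_cons, run_block_nil,
      run_skip, run_write, hx, h13, h14, eval_sub, eval_const]
    have e2 : s'.arr 2 k = s.arr 2 k := by simp [h2]
    have e3 : s'.arr 3 k = s.arr 3 k := by simp [h3]
    rw [e2]
    by_cases hc : s.arr 2 k = s.var 13
    · by_cases h0 : s.var 14 = 0
      · simp only [hc, h0, if_true, Store.setVar_var, Store.setVar_arr, Store.setArr_var,
          Store.setArr_arr]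
        refine ⟨h12, h13, by simp [h14, h0], ?_, ?_⟩
        · funext v
          simp only [Function.update_apply, h12, h2]
          grind
        · funext v
          simp only [h3]
          grind
      · simp only [hc, h0, if_true, if_false, Store.setVar_var, Store.setVar_arr, Store.setArr_var,
          Store.setArr_arr]
        refine ⟨h12, h13, h14, ?_, ?_⟩
        · funext v
          simp only [Function.update_apply, h12, h2]
          grind
        · funext v
          simp [h3, h0]
    · simp only [hc, if_false, Store.setVar_var, Store.setVar_arr]
      refine ⟨h12, h13, h14, ?_, ?_⟩
      · rw [h2]
        funext v
        grind
      · rw [h3]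
        funext v
        grind

/-- Within each component, the colours `col` distinguish the two sides of the bipartition `A`. -/
def Consistent (n : ℕ) (A : ℕ → Prop) (comp col : ℕ → ℕ) : Prop :=
  (∀ v < n, col v ≤ 1) ∧
    ∀ u < n, ∀ v < n, comp u = comp v → (col u = col v ↔ (A u ↔ A v))

/-- On a component, a consistent colouring is the side function up to a global exchange of the
colours. Exchanging them on the component of `j` exactly when `i` and `j` have the same colour
aligns the two components. -/
theorem Consistent.merge {n : ℕ} {A : ℕ → Prop} {comp col comp' col' : ℕ → ℕ}
    (h : Consistent n A comp col) {i j : ℕ} (hi : i < n) (hj : j < n) (hA : A i ↔ ¬ A j)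
    (hcomp : ∀ v < n, comp' v = if comp v = comp j then comp i else comp v)
    (hcol : ∀ v < n, col' v = if comp v = comp j ∧ col i = col j then 1 - col v else col v) :
    Consistent n A comp' col' := by
  obtain ⟨h1, h2⟩ := h
  refine ⟨fun v hv => ?_, fun u hu v hv => ?_⟩
  · rw [hcol v hv]
    have := h1 v hv
    split_ifs <;> omega
  · rw [hcomp u hu, hcomp v hv, hcol u hu, hcol v hv]
    have a1 := h1 u hu
    have a2 := h1 v hv
    have a3 := h1 i hi
    have a4 := h1 j hj
    by_cases cu : comp u = comp j <;> by_cases cv : comp v = comp j <;>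
      simp only [cu, cv, true_and, false_and, if_true, if_false] <;> intro hc
    · have b1 := h2 u hu v hv (cu.trans cv.symm)
      grind
    · have b1 := h2 u hu j hj cu
      have b2 := h2 v hv i hi hc.symm
      grind
    · have b1 := h2 v hv j hj cv
      have b2 := h2 u hu i hi hc
      grind
    · exact h2 u hu v hv hc

/-- The bipartition `A` occurs only in the invariant, not in the program. Once all pairs are
processed, adjacent vertices share a component, where colours separate the sides. The requirement `i
≠ j` matters since diagonal entries may be nonzero. -/
theorem colour_spec (s : Store) (A : ℕ → Prop) (h3 : s.arr 3 = fun _ => 0)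
    (hA : ∀ i < s.arr 0 0, ∀ j < s.arr 0 0, i ≠ j → s.arr 0 (3 * (i * s.arr 0 0 + j) + 2) ≠ 0 →
      (A i ↔ ¬ A j)) :
    (∀ i < s.arr 0 0, (colour.run s).arr 3 i ≤ 1) ∧
    ∀ i < s.arr 0 0, ∀ j < s.arr 0 0, i ≠ j → s.arr 0 (3 * (i * s.arr 0 0 + j) + 2) ≠ 0 →
      (colour.run s).arr 3 i ≠ (colour.run s).arr 3 j := by
  set x := s.arr 0 with hx
  set n := x 0 with hn
  -- Every vertex starts as its own component, which makes the invariant trivial.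
  have e1 : ((loop 2 (write 2 (var 2) (var 2))).run s).arr 2 = fun v => if v < n then v else s.arr 2 v := by
    refine run_loop_induct (x := 2) (s := s) (c := write 2 (var 2) (var 2))
      (fun k s' => s'.arr 2 = fun v => if v < k then v else s.arr 2 v) (by decide) (by decide)
      (by simp) ?_
    rintro k hk s' hv - h
    simp only [run_write, Store.setVar_arr, Store.setArr_arr, eval_var, hv, if_true]
    funext v
    simp only [Function.update_apply, h]
    grind
  have f3 : ((loop 2 (write 2 (var 2) (var 2))).run s).arr 3 = s.arr 3 := run_arr _ _ (by decide)
  have f0 : ((loop 2 (write 2 (var 2) (var 2))).run s).arr 0 = s.arr 0 := run_arr _ _ (by decide)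
  simp only [colour, run_block_cons, run_block_nil]
  generalize ((loop 2 (write 2 (var 2) (var 2))).run s) = s₁ at *
  have hn1 : s₁.arr 0 0 = n := by rw [f0]
  let E : ℕ → ℕ → Prop := fun i j => i ≠ j ∧ x (3 * (i * n + j) + 2) ≠ 0
  -- One pair of vertices.
  have hbody : ∀ (s' : Store) (i j : ℕ), i < n → j < n → s'.arr 0 = x → s'.var 2 = i →
      s'.var 3 = j → Consistent n A (s'.arr 2) (s'.arr 3) →
      ∀ s'', s'' = (ite (numer (idx (var 2) (var 3))) (ite (ne (var 2) (var 3)) Prog.merge skip)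
        skip).run s' →
      Consistent n A (s''.arr 2) (s''.arr 3) ∧ (E i j → s''.arr 2 i = s''.arr 2 j) ∧
        ∀ u < n, ∀ v < n, s'.arr 2 u = s'.arr 2 v → s''.arr 2 u = s''.arr 2 v := by
    rintro s' i j hi hj h0 hvi hvj hc s'' rfl
    simp only [run_ite, eval_numer, eval_ne_eq_zero, eval_idx, eval_var, h0, hvi, hvj, run_skip,
      ← hn]
    by_cases hE : E i j
    · rw [if_neg hE.2, if_neg hE.1]
      have hmerge : Prog.merge.run s' = renumber.run ((block [assign 12 (read 2 (var 2)),
        assign 13 (read 2 (var 3)), assign 14 (ne (read 3 (var 2)) (read 3 (var 3)))]).run s') := rfl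
      rw [hmerge]
      obtain ⟨t, ht⟩ : ∃ t, t = (block [assign 12 (read 2 (var 2)),
        assign 13 (read 2 (var 3)), assign 14 (ne (read 3 (var 2)) (read 3 (var 3)))]).run s' :=
        ⟨_, rfl⟩
      have ta : t.arr = s'.arr := by rw [ht]; rfl
      have t12 : t.var 12 = s'.arr 2 i := by
        rw [ht]; simp [run_block_cons, run_block_nil, run_assign, Store.setVar_var, eval_read, eval_var, hvi]
      have t13 : t.var 13 = s'.arr 2 j := by
        rw [ht]; simp [run_block_cons, run_block_nil, run_assign, Store.setVar_var, eval_read, eval_var, hvj]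
      have t14 : t.var 14 = 0 ↔ s'.arr 3 i = s'.arr 3 j := by
        rw [ht]
        simp only [run_block_cons, run_block_nil, run_assign]
        rw [Store.setVar_var, if_pos rfl, eval_ne_eq_zero]
        simp [Store.setVar_var, eval_read, eval_var, hvi, hvj]
      rw [← ht]
      obtain ⟨k1, k2⟩ := renumber_spec t
      simp only [ta, h0, ← hn, t12, t13, t14] at k1 k2
      generalize renumber.run _ = t at *
      refine ⟨hc.merge hi hj ?_ k1 ?_, fun _ => ?_, fun u hu v hv huv => ?_⟩
      · exact hA i hi j hj hE.1 hE.2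
      · intro v hv
        rw [k2 v hv]
      · rw [k1 i hi, k1 j hj]; simp
      · rw [k1 u hu, k1 v hv, huv]
    · have : (if x (3 * (i * n + j) + 2) = 0 then s' else if i = j then s' else Prog.merge.run s') = s' := by
        split_ifs with a b
        · rfl
        · rfl
        · exact absurd ⟨b, a⟩ hE
      rw [this]
      exact ⟨hc, fun h => absurd h hE, fun u _ v _ h => h⟩
  have main := run_loop_induct (x := 2) (s := s₁)
    (c := loop 3 <| ite (numer (idx (var 2) (var 3)))
      (ite (ne (var 2) (var 3)) Prog.merge skip) skip)
    (fun i s' => Consistent n A (s'.arr 2) (s'.arr 3) ∧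
      ∀ u < i, ∀ v < n, E u v → s'.arr 2 u = s'.arr 2 v)
    (by decide) (by decide) ?_ ?_
  · rw [hn1] at main
    obtain ⟨m1, m2⟩ := main
    refine ⟨m1.1, fun i hi j hj hij hne => ?_⟩
    have := m1.2 i hi j hj (m2 i hi j hj ⟨hij, hne⟩)
    rw [ne_eq, this]
    have := hA i hi j hj hij hne
    tauto
  · refine ⟨⟨fun v hv => ?_, fun u hu v hv h => ?_⟩, by simp⟩
    · simp [f3, h3]
    · simp only [Store.setVar_arr, e1, hu, hv, if_true] at h
      simp [h]
  · rintro i hi s' hvi h0 ⟨c1, c2⟩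
    rw [hn1] at hi
    have inner := run_loop_induct (x := 3) (s := s')
      (c := ite (numer (idx (var 2) (var 3))) (ite (ne (var 2) (var 3)) Prog.merge skip) skip)
      (fun j s'' => s''.var 2 = i ∧ Consistent n A (s''.arr 2) (s''.arr 3) ∧
        (∀ u < i, ∀ v < n, E u v → s''.arr 2 u = s''.arr 2 v) ∧
        ∀ v < j, E i v → s''.arr 2 i = s''.arr 2 v)
      (by decide) (by decide) ⟨by simp [Store.setVar_var, hvi], by simpa using c1, by simpa using c2,
        by simp⟩ ?_
    · rw [h0, hn1] at inner
      refine ⟨by simpa using inner.2.1, fun u hu v hv => ?_⟩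
      rcases Nat.lt_succ_iff_lt_or_eq.1 hu with h | rfl
      · exact inner.2.2.1 u h v hv
      · exact inner.2.2.2 v hv
    · rintro j hj t hvj ht0 ⟨d1, d2, d3, d4⟩
      rw [h0, hn1] at hj
      obtain ⟨g1, g2, g3⟩ := hbody t i j hi hj (by rw [ht0, h0, f0]) d1 hvj d2 _ rfl
      have hv2 : ((ite (numer (idx (var 2) (var 3))) (ite (ne (var 2) (var 3)) Prog.merge skip)
        skip).run t).var 2 = i := by rw [run_var _ _ (by decide), d1]
      generalize ((ite (numer (idx (var 2) (var 3))) (ite (ne (var 2) (var 3)) Prog.merge skip)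
        skip).run t) = t' at *
      refine ⟨by simp [Store.setVar_var, hv2], by simpa using g1, fun u hu v hv huv => ?_,
        fun v hv hiv => ?_⟩
      · exact g3 u (by omega) v hv (d3 u hu v hv huv)
      · rcases Nat.lt_succ_iff_lt_or_eq.1 hv with h | rfl
        · exact g3 i hi v (by omega) (d4 v h hiv)
        · exact g2 hiv

end Prog
end RAM

namespace RAM
namespace Prog

open RAM.Expr

theorem idx_lt {n i j : ℕ} (hi : i < n) (hj : j < n) : i * n + j < n * n := by
  calc i * n + j < i * n + n := by omega
    _ = (i + 1) * n := by ring
    _ ≤ n * n := Nat.mul_le_mul_right _ hi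

theorem idx_inj {n i j i' j' : ℕ} (hj : j < n) (hj' : j' < n) :
    i * n + j = i' * n + j' ↔ i = i' ∧ j = j' := by
  refine ⟨fun h => ?_, by rintro ⟨rfl, rfl⟩; rfl⟩
  have hn : 0 < n := by omega
  have h1 : (i * n + j) / n = i := by
    rw [mul_comm, Nat.mul_add_div hn, Nat.div_eq_of_lt hj, add_zero]
  have h2 : (i' * n + j') / n = i' := by
    rw [mul_comm, Nat.mul_add_div hn, Nat.div_eq_of_lt hj', add_zero]
  have : i = i' := by rw [← h1, h, h2]
  subst this
  exact ⟨rfl, by omega⟩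

/-- Invariants of double loops: `P q` holds after the first `q` pairs in lexicographic order. -/
theorem run_loop_loop_induct {x y : ℕ} {c : Prog} {s : Store} (P : ℕ → Store → Prop)
    (hxy : x ≠ y) (hx : x ∉ c.modVars) (hy : y ∉ c.modVars) (h0 : 0 ∉ c.modArrs)
    (hPx : ∀ q s' k, P q s' → P q (s'.setVar x k)) (hPy : ∀ q s' k, P q s' → P q (s'.setVar y k))
    (start : P 0 s)
    (step : ∀ i < s.arr 0 0, ∀ j < s.arr 0 0, ∀ s' : Store, s'.var x = i → s'.var y = j →
      s'.arr 0 = s.arr 0 → P (i * s.arr 0 0 + j) s' → P (i * s.arr 0 0 + j + 1) (c.run s')) :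
    P (s.arr 0 0 * s.arr 0 0) ((loop x (loop y c)).run s) := by
  refine run_loop_induct (fun i s' => P (i * s.arr 0 0) s')
    (by simp only [modVars, List.mem_cons, not_or]; exact ⟨hxy, hx⟩) h0
    (by simpa using hPx _ _ _ start) ?_
  intro i hi s' hvx hs' hP
  have inner := run_loop_induct (s := s') (c := c) (x := y)
    (fun j s'' => s''.var x = i ∧ P (i * s.arr 0 0 + j) s'') hy h0
    ⟨by rw [Store.setVar_var, if_neg hxy, hvx], hPy _ _ _ hP⟩ ?_
  · rw [hs'] at inner
    have := hPx _ _ (i + 1) inner.2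
    rwa [show (i + 1) * s.arr 0 0 = i * s.arr 0 0 + s.arr 0 0 by ring]
  · rintro j hj t hvy ht ⟨h1, h2⟩
    rw [hs'] at hj
    refine ⟨?_, hPy _ _ _ (step i hi j hj t h1 hvy (by rw [ht, hs']) h2)⟩
    rw [Store.setVar_var, if_neg hxy, run_var _ _ hx, h1]

/-! ### Integral weights -/

/-- The product of all denominators. -/
def common : Prog := block
  [assign 15 (const 1), loop 2 <| loop 3 <| assign 15 (var 15 * denom (idx (var 2) (var 3)))]

/-- The weights of the pairs consisting of a vertex of colour 0 and one of colour 1, multiplied by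
the common denominator. -/
def weights : Prog :=
  loop 2 <| loop 3 <| ite (read 3 (var 2)) skip <| ite (read 3 (var 3))
    (write 4 (idx (var 2) (var 3))
      (var 15 / denom (idx (var 2) (var 3)) * numer (idx (var 2) (var 3)))) skip

/-- A first dual solution. -/
def initDual : Prog :=
  loop 2 <| loop 3 <| write 5 (var 2) (read 5 (var 2) + read 4 (idx (var 2) (var 3)))

theorem common_spec (s : Store) (hs : ∀ i < s.arr 0 0, ∀ j < s.arr 0 0,
      0 < s.arr 0 (3 * (i * s.arr 0 0 + j) + 3)) :
    0 < (common.run s).var 15 ∧ ∀ i < s.arr 0 0, ∀ j < s.arr 0 0,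
      s.arr 0 (3 * (i * s.arr 0 0 + j) + 3) ∣ (common.run s).var 15 := by
  have := run_loop_loop_induct (x := 2) (y := 3) (s := (assign 15 (const 1)).run s)
    (c := assign 15 (var 15 * denom (idx (var 2) (var 3))))
    (fun q s' => 0 < s'.var 15 ∧ ∀ i < s.arr 0 0, ∀ j < s.arr 0 0, i * s.arr 0 0 + j < q →
      s.arr 0 (3 * (i * s.arr 0 0 + j) + 3) ∣ s'.var 15)
    (by decide) (by decide) (by decide) (by decide) (fun q s' k h => by simpa [Store.setVar_var] using h)
    (fun q s' k h => by simpa [Store.setVar_var] using h)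
    (by simp [run_assign, Store.setVar_var, eval_const]) ?_
  · exact ⟨this.1, fun i hi j hj => this.2 i hi j hj (idx_lt hi hj)⟩
  · rintro i hi j hj s' hvi hvj h0 ⟨h1, h2⟩
    simp only [run_assign, Store.setVar_arr] at hi hj h0 h1 h2 ⊢
    simp only [eval_mul, eval_var, eval_denom, eval_idx, hvi, hvj, h0, Store.setVar_var, if_true]
    refine ⟨Nat.mul_pos h1 (hs i hi j hj), fun i' hi' j' hj' hlt => ?_⟩
    rcases Nat.lt_succ_iff_lt_or_eq.1 hlt with h | h
    · exact (h2 i' hi' j' hj' h).mul_right _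
    · rw [h]; exact dvd_mul_left _ _

theorem weights_spec (s : Store) (hs : s.arr 4 = fun _ => 0) :
    ∀ i < s.arr 0 0, ∀ j < s.arr 0 0, (weights.run s).arr 4 (i * s.arr 0 0 + j) =
      if s.arr 3 i = 0 ∧ s.arr 3 j ≠ 0 then
        s.var 15 / s.arr 0 (3 * (i * s.arr 0 0 + j) + 3) * s.arr 0 (3 * (i * s.arr 0 0 + j) + 2)
      else 0 := by
  have := run_loop_loop_induct (x := 2) (y := 3) (s := s)
    (c := ite (read 3 (var 2)) skip <| ite (read 3 (var 3))
    (write 4 (idx (var 2) (var 3))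
      (var 15 / denom (idx (var 2) (var 3)) * numer (idx (var 2) (var 3)))) skip)
    (fun q s' => s'.arr 3 = s.arr 3 ∧ s'.var 15 = s.var 15 ∧ ∀ i < s.arr 0 0, ∀ j < s.arr 0 0,
      s'.arr 4 (i * s.arr 0 0 + j) =
      if i * s.arr 0 0 + j < q ∧ s.arr 3 i = 0 ∧ s.arr 3 j ≠ 0 then
        s.var 15 / s.arr 0 (3 * (i * s.arr 0 0 + j) + 3) * s.arr 0 (3 * (i * s.arr 0 0 + j) + 2)
      else 0)
    (by decide) (by decide) (by decide) (by decide) (fun q s' k h => by simpa [Store.setVar_var] using h)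
    (fun q s' k h => by simpa [Store.setVar_var] using h)
    (by simp [hs]) ?_
  · intro i hi j hj
    have h := this.2.2 i hi j hj
    simp only [idx_lt hi hj, true_and] at h
    exact h
  · rintro i hi j hj s' hvi hvj h0 ⟨h3, h15, h4⟩
    simp only [run_ite, eval_read, eval_var, hvi, hvj, run_skip, h3]
    split_ifs with e1 e2
    · refine ⟨h3, h15, fun i' hi' j' hj' => ?_⟩
      rw [h4 i' hi' j' hj']
      have := idx_inj (i := i') (i' := i) hj' hj
      grind
    · simp only [run_write, Store.setArr_arr, Store.setArr_var]
      refine ⟨h3, h15, fun i' hi' j' hj' => ?_⟩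
      simp only [if_true, Function.update_apply, eval_idx, eval_mul, eval_div, eval_numer,
        eval_denom, eval_var, hvi, hvj, h0, h15]
      have := idx_inj (i := i') (i' := i) hj' hj
      rw [h4 i' hi' j' hj']
      by_cases e : i' * s.arr 0 0 + j' = i * s.arr 0 0 + j
      · obtain ⟨rfl, rfl⟩ := this.1 e
        rw [if_pos rfl, if_pos ⟨by omega, e1, e2⟩]
      · rw [if_neg e]
        grind
    · refine ⟨h3, h15, fun i' hi' j' hj' => ?_⟩
      rw [h4 i' hi' j' hj']
      have := idx_inj (i := i') (i' := i) hj' hj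
      grind

/-- A row sum of nonnegative weights dominates each entry, so row sums with zero column duals are
feasible. -/
theorem initDual_spec (s : Store) :
    ∀ i < s.arr 0 0, ∀ j < s.arr 0 0, s.arr 4 (i * s.arr 0 0 + j) ≤ (initDual.run s).arr 5 i := by
  have := run_loop_loop_induct (x := 2) (y := 3) (s := s)
    (c := write 5 (var 2) (read 5 (var 2) + read 4 (idx (var 2) (var 3))))
    (fun q s' => s'.arr 4 = s.arr 4 ∧ ∀ i < s.arr 0 0, ∀ j < s.arr 0 0, i * s.arr 0 0 + j < q →
      s.arr 4 (i * s.arr 0 0 + j) ≤ s'.arr 5 i)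
    (by decide) (by decide) (by decide) (by decide) (fun q s' k h => h) (fun q s' k h => h)
    (by simp) ?_
  · exact fun i hi j hj => this.2 i hi j hj (idx_lt hi hj)
  · rintro i hi j hj s' hvi hvj h0 ⟨h4, h5⟩
    simp only [run_write, Store.setArr_arr]
    refine ⟨h4, fun i' hi' j' hj' hlt => ?_⟩
    simp only [if_true, Function.update_apply, eval_read, eval_var, eval_add, eval_idx, hvi, hvj,
      h0, h4]
    rcases Nat.lt_succ_iff_lt_or_eq.1 hlt with h | h
    · have := h5 i' hi' j' hj' h
      split_ifs with e
      · subst e; omega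
      · exact this
    · obtain ⟨rfl, rfl⟩ := (idx_inj hj' hj).1 h
      rw [if_pos rfl]; omega

/-! ### The Hungarian method -/

/-- The slack of the pair `(i, j)`. -/
def slack : Expr := read 5 (var 2) + read 6 (var 3) - read 4 (idx (var 2) (var 3))

def choosePair : Prog := block
  [assign 8 (const 1), assign 9 slack, assign 10 (var 2), assign 11 (var 3)]

def findMin : Prog := block
  [assign 8 (const 0), loop 2 <| loop 3 <| ite (read 8 (var 2)) (ite (read 9 (var 3)) skip
    (ite (var 8) (ite (var 9 - slack) choosePair skip) choosePair)) skip]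

def updateDual : Prog := block
  [loop 2 <| ite (read 8 (var 2)) (write 5 (var 2) (read 5 (var 2) - var 9)) skip,
    loop 2 <| ite (read 9 (var 2)) (write 6 (var 2) (read 6 (var 2) + var 9)) skip]

def grow : Prog := block
  [assign 12 (read 7 (var 11) - const 1), write 9 (var 11) (const 1), write 8 (var 12) (const 1),
    loop 2 <| write 10 (idx (var 12) (var 2)) (read 10 (idx (var 10) (var 2))),
    write 10 (idx (var 12) (var 11)) (var 10 + const 1)]

def augment : Prog := block
  [assign 7 (const 1), loop 2 <| write 7 (var 2) (read 10 (idx (var 10) (var 2))),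
    write 7 (var 11) (var 10 + const 1)]

def searchStep : Prog := block [findMin, updateDual, ite (read 7 (var 11)) grow augment]

def startSearch : Prog := block
  [loop 2 <| block [write 8 (var 2) (const 0), write 9 (var 2) (const 0),
      write 10 (idx (var 5) (var 2)) (read 7 (var 2))],
    write 8 (var 5) (const 1), assign 7 (const 0)]

def search : Prog := block [startSearch, loop 6 <| ite (var 7) skip searchStep]

def hungarian : Prog := block [initDual, loop 5 search]

/-! ### Correctness of the steps of the Hungarian program -/

open Assignment

theorem findMin_spec (s : Store)
    (hS : ∃ i < s.arr 0 0, s.arr 8 i ≠ 0) (hT : ∃ j < s.arr 0 0, s.arr 9 j = 0) :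
    MinSlack (s.arr 0 0) (fun i j => s.arr 4 (i * s.arr 0 0 + j)) (s.arr 5) (s.arr 6) (s.arr 8)
      (s.arr 9) ((findMin.run s).var 10) ((findMin.run s).var 11) ((findMin.run s).var 9) := by
  set n := s.arr 0 0 with hn
  let sl : ℕ → ℕ → ℕ := fun i j => s.arr 5 i + s.arr 6 j - s.arr 4 (i * n + j)
  have := run_loop_loop_induct (x := 2) (y := 3) (s := (assign 8 (const 0)).run s)
    (c := ite (read 8 (var 2)) (ite (read 9 (var 3)) skip
      (ite (var 8) (ite (var 9 - slack) choosePair skip) choosePair)) skip)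
    -- Register 8 separates "no eligible pair so far" from a recorded minimum, since the value 0 in
    -- register 9 could mean either. The hypotheses on `S` and `T` guarantee that a pair is found in
    -- the end.
    (fun q s' => s'.arr = s.arr ∧
      (s'.var 8 = 0 → ∀ i < n, ∀ j < n, i * n + j < q → s.arr 8 i ≠ 0 → s.arr 9 j ≠ 0) ∧
      (s'.var 8 ≠ 0 → s'.var 10 < n ∧ s.arr 8 (s'.var 10) ≠ 0 ∧ s'.var 11 < n ∧
        s.arr 9 (s'.var 11) = 0 ∧ s'.var 9 = sl (s'.var 10) (s'.var 11) ∧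
        ∀ i < n, ∀ j < n, i * n + j < q → s.arr 8 i ≠ 0 → s.arr 9 j = 0 → s'.var 9 ≤ sl i j))
    (by decide) (by decide) (by decide) (by decide)
    (fun q s' k h => by simpa [Store.setVar_var] using h)
    (fun q s' k h => by simpa [Store.setVar_var] using h)
    (by simp [run_assign, Store.setVar_var, eval_const]) ?_
  · obtain ⟨-, h1, h2⟩ := this
    obtain ⟨i, hi, hSi⟩ := hS
    obtain ⟨j, hj, hTj⟩ := hT
    have h8 : (findMin.run s).var 8 ≠ 0 := fun h => h1 h i hi j hj (idx_lt hi hj) hSi hTj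
    obtain ⟨a1, a2, a3, a4, a5, a6⟩ := h2 h8
    exact ⟨a1, a2, a3, a4, a5, fun i' hi' hS' j' hj' hT' => a6 i' hi' j' hj' (idx_lt hi' hj') hS' hT'⟩
  · rintro i hi j hj s' hvi hvj h0 ⟨ha, h1, h2⟩
    change i < n at hi
    change j < n at hj
    change _ ∧ (_ → ∀ i' < n, ∀ j' < n, i' * n + j' < i * n + j + 1 → _) ∧ (_ → _ ∧ _ ∧ _ ∧ _ ∧ _ ∧
      ∀ i' < n, ∀ j' < n, i' * n + j' < i * n + j + 1 → _)
    change (_ → ∀ i' < n, ∀ j' < n, i' * n + j' < i * n + j → _) at h1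
    change (_ → _ ∧ _ ∧ _ ∧ _ ∧ _ ∧ ∀ i' < n, ∀ j' < n, i' * n + j' < i * n + j → _) at h2
    have hsl : slack.eval s' = sl i j := by
      simp only [slack, eval_sub, eval_add, eval_read, eval_var, eval_idx, hvi, hvj, ha, sl, ← hn]
    have hch : choosePair.run s' = (((s'.setVar 8 1).setVar 9 (sl i j)).setVar 10 i).setVar 11 j := by
      have e : slack.eval (s'.setVar 8 1) = sl i j := by
        simp only [slack, eval_sub, eval_add, eval_read, eval_var, eval_idx, Store.setVar_arr, ha, sl,
          ← hn]
        simp [Store.setVar_var, hvi, hvj]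
      simp [choosePair, run_block_cons, run_block_nil, run_assign, eval_const, e, eval_var,
        Store.setVar_var, hvi, hvj]
    have hcase : ∀ i' < n, ∀ j' < n, i' * n + j' < i * n + j + 1 →
        i' * n + j' < i * n + j ∨ (i' = i ∧ j' = j) := by
      intro i' hi' j' hj' h
      rcases Nat.lt_succ_iff_lt_or_eq.1 h with h | h
      · exact Or.inl h
      · exact Or.inr ((idx_inj hj' hj).1 h)
    simp only [run_ite, eval_read, eval_var, eval_sub, hvi, hvj, ha, hsl, hch, run_skip]
    by_cases c1 : s.arr 8 i = 0
    · rw [if_pos c1]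
      refine ⟨ha, fun h i' hi' j' hj' hlt => ?_, fun h => ?_⟩
      · rcases hcase i' hi' j' hj' hlt with h3 | ⟨rfl, rfl⟩
        exacts [h1 h i' hi' j' hj' h3, fun h => absurd c1 h]
      · obtain ⟨a1, a2, a3, a4, a5, a6⟩ := h2 h
        refine ⟨a1, a2, a3, a4, a5, fun i' hi' j' hj' hlt => ?_⟩
        rcases hcase i' hi' j' hj' hlt with h3 | ⟨rfl, rfl⟩
        exacts [a6 i' hi' j' hj' h3, fun h => absurd c1 h]
    rw [if_neg c1]
    by_cases c2 : s.arr 9 j = 0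
    swap
    · rw [if_neg c2]
      refine ⟨ha, fun h i' hi' j' hj' hlt => ?_, fun h => ?_⟩
      · rcases hcase i' hi' j' hj' hlt with h3 | ⟨rfl, rfl⟩
        exacts [h1 h i' hi' j' hj' h3, fun _ => c2]
      · obtain ⟨a1, a2, a3, a4, a5, a6⟩ := h2 h
        refine ⟨a1, a2, a3, a4, a5, fun i' hi' j' hj' hlt => ?_⟩
        rcases hcase i' hi' j' hj' hlt with h3 | ⟨rfl, rfl⟩
        exacts [a6 i' hi' j' hj' h3, fun _ h => absurd h c2]
    rw [if_pos c2]
    have hchosen : (s'.var 8 ≠ 0 → sl i j ≤ s'.var 9) →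
        ∀ t, t = (((s'.setVar 8 1).setVar 9 (sl i j)).setVar 10 i).setVar 11 j →
        t.arr = s.arr ∧
      (t.var 8 = 0 → ∀ i' < n, ∀ j' < n, i' * n + j' < i * n + j + 1 → s.arr 8 i' ≠ 0 → s.arr 9 j' ≠ 0) ∧
      (t.var 8 ≠ 0 → t.var 10 < n ∧ s.arr 8 (t.var 10) ≠ 0 ∧ t.var 11 < n ∧
        s.arr 9 (t.var 11) = 0 ∧ t.var 9 = sl (t.var 10) (t.var 11) ∧
        ∀ i' < n, ∀ j' < n, i' * n + j' < i * n + j + 1 → s.arr 8 i' ≠ 0 → s.arr 9 j' = 0 → t.var 9 ≤ sl i' j') := by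
      rintro hle t rfl
      simp only [Store.setVar_arr, Store.setVar_var]
      refine ⟨ha, by simp, fun _ => ?_⟩
      simp only [if_true, Nat.reduceEqDiff, if_false]
      refine ⟨hi, c1, hj, c2, trivial, fun i' hi' j' hj' hlt hS' hT' => ?_⟩
      rcases hcase i' hi' j' hj' hlt with h3 | ⟨rfl, rfl⟩
      · by_cases h8 : s'.var 8 = 0
        · exact absurd hT' (h1 h8 i' hi' j' hj' h3 hS')
        · exact (hle h8).trans ((h2 h8).2.2.2.2.2 i' hi' j' hj' h3 hS' hT')
      · exact le_rfl
    by_cases c3 : s'.var 8 = 0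
    · rw [if_pos c3]
      exact hchosen (fun h => absurd c3 h) _ rfl
    rw [if_neg c3]
    by_cases c4 : s'.var 9 - sl i j = 0
    swap
    · rw [if_neg c4]
      exact hchosen (fun _ => by omega) _ rfl
    rw [if_pos c4]
    refine ⟨ha, fun h => absurd h c3, fun h => ?_⟩
    obtain ⟨a1, a2, a3, a4, a5, a6⟩ := h2 h
    refine ⟨a1, a2, a3, a4, a5, fun i' hi' j' hj' hlt => ?_⟩
    rcases hcase i' hi' j' hj' hlt with h3 | ⟨rfl, rfl⟩
    exacts [a6 i' hi' j' hj' h3, fun _ _ => by omega]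

theorem updateDual_spec (s : Store) :
    (∀ i < s.arr 0 0, (updateDual.run s).arr 5 i =
      if s.arr 8 i ≠ 0 then s.arr 5 i - s.var 9 else s.arr 5 i) ∧
    (∀ j < s.arr 0 0, (updateDual.run s).arr 6 j =
      if s.arr 9 j ≠ 0 then s.arr 6 j + s.var 9 else s.arr 6 j) := by
  have h1 := run_loop_induct (x := 2) (s := s)
    (c := ite (read 8 (var 2)) (write 5 (var 2) (read 5 (var 2) - var 9)) skip)
    (fun k s' => s'.var 9 = s.var 9 ∧ s'.arr 8 = s.arr 8 ∧
      s'.arr 5 = fun i => if i < k ∧ s.arr 8 i ≠ 0 then s.arr 5 i - s.var 9 else s.arr 5 i)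
    (by decide) (by decide) (by simp [Store.setVar_var]) (by
      rintro k hk s' hx - ⟨h9, h8, h5⟩
      simp only [run_ite, eval_read, eval_var, hx, h8, run_write, run_skip, eval_sub, h9]
      split_ifs with e
      · refine ⟨by simp [Store.setVar_var, h9], h8, ?_⟩
        simp only [Store.setVar_arr, h5]
        funext i
        grind
      · refine ⟨by simp [Store.setVar_var, h9], h8, ?_⟩
        simp only [Store.setVar_arr, Store.setArr_arr, h5]
        funext i
        simp only [Function.update_apply, if_true]
        grind)
  have f9 : ((loop 2 <| ite (read 8 (var 2)) (write 5 (var 2) (read 5 (var 2) - var 9)) skip).run s).arr 9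
      = s.arr 9 := run_arr _ _ (by decide)
  have f6 : ((loop 2 <| ite (read 8 (var 2)) (write 5 (var 2) (read 5 (var 2) - var 9)) skip).run s).arr 6
      = s.arr 6 := run_arr _ _ (by decide)
  have f0 : ((loop 2 <| ite (read 8 (var 2)) (write 5 (var 2) (read 5 (var 2) - var 9)) skip).run s).arr 0
      = s.arr 0 := run_arr _ _ (by decide)
  simp only [updateDual, run_block_cons, run_block_nil]
  generalize (loop 2 <| ite (read 8 (var 2)) (write 5 (var 2) (read 5 (var 2) - var 9)) skip).run s = t at *
  obtain ⟨g9, -, g5⟩ := h1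
  have h2 := run_loop_induct (x := 2) (s := t)
    (c := ite (read 9 (var 2)) (write 6 (var 2) (read 6 (var 2) + var 9)) skip)
    (fun k s' => s'.var 9 = s.var 9 ∧ s'.arr 9 = s.arr 9 ∧
      s'.arr 6 = fun i => if i < k ∧ s.arr 9 i ≠ 0 then s.arr 6 i + s.var 9 else s.arr 6 i)
    (by decide) (by decide) (by simp [Store.setVar_var, g9, f6, f9]) (by
      rintro k hk s' hx - ⟨h9, h8, h5⟩
      simp only [run_ite, eval_read, eval_var, hx, h8, run_write, run_skip, eval_add, h9]
      split_ifs with e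
      · refine ⟨by simp [Store.setVar_var, h9], h8, ?_⟩
        simp only [Store.setVar_arr, h5]
        funext i
        grind
      · refine ⟨by simp [Store.setVar_var, h9], h8, ?_⟩
        simp only [Store.setVar_arr, Store.setArr_arr, h5]
        funext i
        simp only [Function.update_apply, if_true]
        grind)
  have f5 : ((loop 2 <| ite (read 9 (var 2)) (write 6 (var 2) (read 6 (var 2) + var 9)) skip).run t).arr 5
      = t.arr 5 := run_arr _ _ (by decide)
  refine ⟨fun i hi => ?_, fun j hj => ?_⟩
  · rw [f5, g5]; simp [hi]
  · rw [h2.2.2, f0]; simp [hj]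

end Prog
end RAM

namespace RAM
namespace Prog

open RAM.Expr
open Assignment

/-- The condition `bi ≠ k` ensures that the matching stored for `bi` is not overwritten while it is
copied to `k`. -/
theorem grow_spec (s : Store) {k bi bj : ℕ} (hbi : s.var 10 = bi) (hbj : s.var 11 = bj)
    (hk : s.arr 7 bj = k + 1) (hlt : bj < s.arr 0 0) (hne : bi ≠ k) :
    (∀ j, (grow.run s).arr 9 j = if j = bj then 1 else s.arr 9 j) ∧
    (∀ i, (grow.run s).arr 8 i = if i = k then 1 else s.arr 8 i) ∧
    ∀ i, ∀ j < s.arr 0 0, (grow.run s).arr 10 (i * s.arr 0 0 + j) =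
      if i = k then if j = bj then bi + 1 else s.arr 10 (bi * s.arr 0 0 + j)
      else s.arr 10 (i * s.arr 0 0 + j) := by
  obtain ⟨t, ht⟩ : ∃ t, t = (block [assign 12 (read 7 (var 11) - const 1),
    write 9 (var 11) (const 1), write 8 (var 12) (const 1)]).run s := ⟨_, rfl⟩
  have t0 : t.arr 0 = s.arr 0 := by rw [ht]; exact run_arr _ _ (by decide)
  have t10 : t.arr 10 = s.arr 10 := by rw [ht]; exact run_arr _ _ (by decide)
  have v10 : t.var 10 = bi := by rw [ht, run_var _ _ (by decide), hbi]
  have v11 : t.var 11 = bj := by rw [ht, run_var _ _ (by decide), hbj]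
  have v12 : t.var 12 = k := by
    rw [ht]
    simp [run_block_cons, run_block_nil, run_assign, run_write, Store.setVar_var, eval_sub,
      eval_read, eval_var, eval_const, hbj, hk]
  have t9 : ∀ j, t.arr 9 j = if j = bj then 1 else s.arr 9 j := by
    intro j
    rw [ht]
    simp [run_block_cons, run_block_nil, run_assign, run_write, Store.setVar_var, Store.setArr_arr,
      eval_sub, eval_read, eval_var, eval_const, hbj, Function.update_apply]
  have t8 : ∀ i, t.arr 8 i = if i = k then 1 else s.arr 8 i := by
    intro j
    rw [ht]
    simp [run_block_cons, run_block_nil, run_assign, run_write, Store.setVar_var, Store.setArr_arr,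
      eval_sub, eval_read, eval_var, eval_const, hbj, hk, Function.update_apply]
  have hrun : grow.run s = (write 10 (idx (var 12) (var 11)) (var 10 + const 1)).run
      ((loop 2 <| write 10 (idx (var 12) (var 2)) (read 10 (idx (var 10) (var 2)))).run t) := by
    rw [ht]; rfl
  have hloop := run_loop_induct (x := 2) (s := t)
    (c := write 10 (idx (var 12) (var 2)) (read 10 (idx (var 10) (var 2))))
    (fun q s' => s'.var 10 = bi ∧ s'.var 11 = bj ∧ s'.var 12 = k ∧
      ∀ i, ∀ j < s.arr 0 0, s'.arr 10 (i * s.arr 0 0 + j) =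
        if i = k ∧ j < q then s.arr 10 (bi * s.arr 0 0 + j) else s.arr 10 (i * s.arr 0 0 + j))
    (by decide) (by decide) (by simp [Store.setVar_var, v10, v11, v12, t10]) (by
      rintro q hq s' hx h0 ⟨h10, h11, h12, h⟩
      rw [t0] at hq h0
      refine ⟨by simp [Store.setVar_var, run_write, h10], by simp [Store.setVar_var, run_write, h11],
        by simp [Store.setVar_var, run_write, h12], fun i j hj => ?_⟩
      simp only [Store.setVar_arr, run_write, Store.setArr_arr, if_true, Function.update_apply,
        eval_idx, eval_var, eval_read, hx, h0, h10, h12]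
      have hq' : s'.arr 10 (bi * s.arr 0 0 + q) = s.arr 10 (bi * s.arr 0 0 + q) := by
        rw [h bi q hq]
        exact if_neg fun hc => hne hc.1
      rw [hq', h i j hj]
      clear h
      have := idx_inj (i := i) (i' := k) hj hq
      grind)
  have f0 : ((loop 2 <| write 10 (idx (var 12) (var 2)) (read 10 (idx (var 10) (var 2)))).run t).arr 0
      = t.arr 0 := run_arr _ _ (by decide)
  have f8 : ((loop 2 <| write 10 (idx (var 12) (var 2)) (read 10 (idx (var 10) (var 2)))).run t).arr 8
      = t.arr 8 := run_arr _ _ (by decide)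
  have f9 : ((loop 2 <| write 10 (idx (var 12) (var 2)) (read 10 (idx (var 10) (var 2)))).run t).arr 9
      = t.arr 9 := run_arr _ _ (by decide)
  generalize ((loop 2 <| write 10 (idx (var 12) (var 2)) (read 10 (idx (var 10) (var 2)))).run t) = t'
    at *
  obtain ⟨w10, w11, w12, w⟩ := hloop
  rw [hrun]
  simp only [run_write, Store.setArr_arr]
  refine ⟨fun j => ?_, fun i => ?_, fun i j hj => ?_⟩
  · simp [f9, t9]
  · simp [f8, t8]
  · simp only [if_true, Function.update_apply, eval_idx, eval_var, eval_add, eval_const, w10, w11,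
      w12, f0, t0]
    rw [w i j hj, t0]
    have := idx_inj (i := i) (i' := k) hj hlt
    grind

theorem augment_spec (s : Store) {bi bj : ℕ} (hbi : s.var 10 = bi) (hbj : s.var 11 = bj) :
    (augment.run s).var 7 = 1 ∧ ∀ j < s.arr 0 0, (augment.run s).arr 7 j =
      if j = bj then bi + 1 else s.arr 10 (bi * s.arr 0 0 + j) := by
  have hloop := run_loop_induct (x := 2) (s := (assign 7 (const 1)).run s)
    (c := write 7 (var 2) (read 10 (idx (var 10) (var 2))))
    (fun q s' => s'.var 7 = 1 ∧ s'.var 10 = bi ∧ s'.var 11 = bj ∧ s'.arr 10 = s.arr 10 ∧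
      ∀ j < q, s'.arr 7 j = s.arr 10 (bi * s.arr 0 0 + j))
    (by decide) (by decide)
    (by simp [run_assign, Store.setVar_var, eval_const, hbi, hbj]) (by
      rintro q hq s' hx h0 ⟨h7, h10, h11, a10, h⟩
      refine ⟨by simp [Store.setVar_var, run_write, h7], by simp [Store.setVar_var, run_write, h10],
        by simp [Store.setVar_var, run_write, h11], by simp [run_write, Store.setArr_arr, a10],
        fun j hj => ?_⟩
      simp only [Store.setVar_arr, run_write, Store.setArr_arr, if_true, Function.update_apply,
        eval_idx, eval_var, eval_read, hx, h0, h10, a10, run_assign]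
      grind)
  have hrun : augment.run s = (write 7 (var 11) (var 10 + const 1)).run
      ((loop 2 <| write 7 (var 2) (read 10 (idx (var 10) (var 2)))).run
        ((assign 7 (const 1)).run s)) := rfl
  obtain ⟨h7, h10, h11, -, h⟩ := hloop
  rw [hrun]
  refine ⟨by simp [run_write, h7], fun j hj => ?_⟩
  simp only [run_write, Store.setArr_arr, if_true, Function.update_apply, eval_var, eval_add,
    eval_const, h10, h11]
  split_ifs
  exacts [rfl, h j hj]

theorem startSearch_spec (s : Store) {r : ℕ} (hr : s.var 5 = r) :
    (startSearch.run s).var 7 = 0 ∧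
    (∀ i < s.arr 0 0, (startSearch.run s).arr 8 i ≠ 0 ↔ i = r) ∧
    (∀ j < s.arr 0 0, (startSearch.run s).arr 9 j = 0) ∧
    ∀ j < s.arr 0 0, (startSearch.run s).arr 10 (r * s.arr 0 0 + j) = s.arr 7 j := by
  have hloop := run_loop_induct (x := 2) (s := s)
    (c := block [write 8 (var 2) (const 0), write 9 (var 2) (const 0),
      write 10 (idx (var 5) (var 2)) (read 7 (var 2))])
    (fun q s' => s'.var 5 = r ∧ s'.arr 7 = s.arr 7 ∧ ∀ j < q, s'.arr 8 j = 0 ∧ s'.arr 9 j = 0 ∧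
      s'.arr 10 (r * s.arr 0 0 + j) = s.arr 7 j)
    (by decide) (by decide)
    (by simp [Store.setVar_var, hr]) (by
      rintro q hq s' hx h0 ⟨h5, h7, h⟩
      simp only [run_block_cons, run_block_nil, run_write]
      refine ⟨by simp [Store.setVar_var, h5], by simp [Store.setArr_arr, h7], fun j hj => ?_⟩
      simp only [Store.setVar_arr, Store.setArr_arr, if_true, Function.update_apply, Store.setArr_var,
        eval_idx, eval_var, eval_read, eval_const, hx, h5, Nat.reduceEqDiff, if_false, h7, h0,
        OfNat.zero_ne_ofNat]
      have := h j
      grind)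
  have hrun : startSearch.run s = (assign 7 (const 0)).run ((write 8 (var 5) (const 1)).run
    ((loop 2 <| block [write 8 (var 2) (const 0), write 9 (var 2) (const 0),
      write 10 (idx (var 5) (var 2)) (read 7 (var 2))]).run s)) := rfl
  obtain ⟨h5, h7, h⟩ := hloop
  rw [hrun]
  simp only [run_assign, run_write, Store.setVar_arr, Store.setArr_arr, eval_const, eval_var, h5]
  refine ⟨by simp [Store.setVar_var], fun i hi => ?_, fun j hj => ?_, fun j hj => ?_⟩
  · simp only [if_true, Function.update_apply, (h i hi).1]
    simp
  · simp [(h j hj).2.1]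
  · simp [(h j hj).2.2]

/-- After the dual update the chosen pair is tight: a free column ends the search by an
augmentation, a matched one is added to the reached columns. Their number measures progress. -/
theorem searchStep_spec (s : Store) {r : ℕ} (hr : r < s.arr 0 0) {p : ℕ → ℕ} (hp : s.arr 7 = p)
    (h7 : s.var 7 = 0)
    (h : Search (s.arr 0 0) r (fun i j => s.arr 4 (i * s.arr 0 0 + j)) p (s.arr 5) (s.arr 6)
      (s.arr 8) (s.arr 9) (fun i j => s.arr 10 (i * s.arr 0 0 + j))) :
    ∀ t, t = searchStep.run s →
    (t.var 7 = 0 ∧ t.arr 7 = p ∧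
      Search (s.arr 0 0) r (fun i j => s.arr 4 (i * s.arr 0 0 + j)) p (t.arr 5) (t.arr 6)
      (t.arr 8) (t.arr 9) (fun i j => t.arr 10 (i * s.arr 0 0 + j)) ∧
      ((Finset.range (s.arr 0 0)).filter fun j => t.arr 9 j ≠ 0).card =
        ((Finset.range (s.arr 0 0)).filter fun j => s.arr 9 j ≠ 0).card + 1) ∨
    (t.var 7 ≠ 0 ∧ Optimal (s.arr 0 0) (r + 1) (fun i j => s.arr 4 (i * s.arr 0 0 + j))
      (t.arr 5) (t.arr 6) (t.arr 7)) := by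
  rintro t ht
  set n := s.arr 0 0 with hn
  have hmin := findMin_spec s ⟨r, hr, (h.mem_iff r hr).2 (Or.inl rfl)⟩
    (by obtain ⟨j, hj, -, e⟩ := h.exists_free hr; exact ⟨j, hj, e⟩)
  rw [← hn] at hmin
  have fa : ∀ k, (findMin.run s).arr k = s.arr k := fun k => run_arr _ _ (by
    have : findMin.modArrs = [] := rfl
    simp [this])
  have f7 : (findMin.run s).var 7 = 0 := by rw [run_var _ _ (by decide), h7]
  have ht' : t = (ite (read 7 (var 11)) grow augment).run (updateDual.run (findMin.run s)) := by
    rw [ht]; rfl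
  generalize findMin.run s = s₁ at *
  obtain ⟨bi, hbi⟩ : ∃ bi, s₁.var 10 = bi := ⟨_, rfl⟩
  obtain ⟨bj, hbj⟩ : ∃ bj, s₁.var 11 = bj := ⟨_, rfl⟩
  rw [hbi, hbj] at hmin
  obtain ⟨d5, d6⟩ := updateDual_spec s₁
  simp only [fa, ← hn] at d5 d6
  have g7 : (updateDual.run s₁).var 7 = 0 := by rw [run_var _ _ (by decide), f7]
  have g10 : (updateDual.run s₁).var 10 = bi := by rw [run_var _ _ (by decide), hbi]
  have g11 : (updateDual.run s₁).var 11 = bj := by rw [run_var _ _ (by decide), hbj]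
  have ga : ∀ k, k ≠ 5 → k ≠ 6 → (updateDual.run s₁).arr k = s.arr k := fun k h5 h6 => by
    rw [run_arr, fa]
    have : updateDual.modArrs = [5, 6] := rfl
    simp [this, h5, h6]
  obtain ⟨hs, htight⟩ := h.dualUpdate hr hmin d5 d6
  generalize updateDual.run s₁ = s₂ at *
  have e0 : s₂.arr 0 0 = n := by rw [ga 0 (by decide) (by decide)]
  rw [run_ite, eval_read, eval_var, g11, ga 7 (by decide) (by decide), hp] at ht'
  by_cases hpb : p bj = 0
  · rw [if_pos hpb] at ht'
    right
    obtain ⟨a1, a2⟩ := augment_spec s₂ g10 g11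
    have q5 : t.arr 5 = s₂.arr 5 := by rw [ht']; exact run_arr _ _ (by decide)
    have q6 : t.arr 6 = s₂.arr 6 := by rw [ht']; exact run_arr _ _ (by decide)
    rw [← ht'] at a1 a2
    rw [e0, ga 10 (by decide) (by decide)] at a2
    refine ⟨by rw [a1]; decide, ?_⟩
    rw [q5, q6]
    exact hs.augment hmin.row_lt hmin.row_mem hmin.col_lt htight hpb a2
  · rw [if_neg hpb] at ht'
    left
    obtain ⟨k, hk⟩ : ∃ k, p bj = k + 1 := ⟨p bj - 1, by omega⟩
    have hne : bi ≠ k := by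
      rintro rfl
      rcases (h.mem_iff _ hmin.row_lt).1 hmin.row_mem with rfl | ⟨j, hj, hT, e⟩
      · exact lt_irrefl _ (h.matching.range bj hmin.col_lt _ hk).2
      · obtain rfl := h.matching.inj j hj bj hmin.col_lt _ e hk
        exact hT hmin.col_notMem
    obtain ⟨a1, a2, a3⟩ := grow_spec s₂ g10 g11
      (by rw [ga 7 (by decide) (by decide), hp, hk]) (by rw [e0]; exact hmin.col_lt) hne
    have q5 : t.arr 5 = s₂.arr 5 := by rw [ht']; exact run_arr _ _ (by decide)
    have q6 : t.arr 6 = s₂.arr 6 := by rw [ht']; exact run_arr _ _ (by decide)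
    have q7 : t.arr 7 = p := by
      rw [ht', run_arr _ _ (by decide), ga 7 (by decide) (by decide), hp]
    have v7 : t.var 7 = 0 := by rw [ht', run_var _ _ (by decide), g7]
    rw [← ht'] at a1 a2 a3
    rw [e0, ga 10 (by decide) (by decide)] at a3
    rw [ga 9 (by decide) (by decide)] at a1
    rw [ga 8 (by decide) (by decide)] at a2
    refine ⟨v7, q7, ?_, ?_⟩
    · rw [q5, q6]
      exact hs.grow hmin.row_lt hmin.row_mem hmin.col_lt hmin.col_notMem htight hk a2 a1
        (fun i _ j hj => a3 i j hj)
    · have : (Finset.range n).filter (fun j => t.arr 9 j ≠ 0) =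
          insert bj ((Finset.range n).filter fun j => s.arr 9 j ≠ 0) := by
        ext j
        simp only [Finset.mem_filter, Finset.mem_range, Finset.mem_insert, a1]
        have := hmin.col_lt
        grind
      rw [this, Finset.card_insert_of_notMem]
      simp [hmin.col_notMem]

/-- A search still open after `n` rounds would have reached `n` columns, contradicting
`Search.card_lt`. After an augmentation register 7 makes the remaining rounds idle. -/
theorem search_spec (s : Store) {r : ℕ} (hv : s.var 5 = r) (hr : r < s.arr 0 0)
    (h : Optimal (s.arr 0 0) r (fun i j => s.arr 4 (i * s.arr 0 0 + j)) (s.arr 5) (s.arr 6)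
      (s.arr 7)) :
    Optimal (s.arr 0 0) (r + 1) (fun i j => s.arr 4 (i * s.arr 0 0 + j)) ((search.run s).arr 5)
      ((search.run s).arr 6) ((search.run s).arr 7) := by
  have hrun : search.run s = (loop 6 <| ite (var 7) skip searchStep).run (startSearch.run s) := rfl
  rw [hrun]
  obtain ⟨b7, b8, b9, b10⟩ := startSearch_spec s hv
  have ga : ∀ k, k ≠ 8 → k ≠ 9 → k ≠ 10 → (startSearch.run s).arr k = s.arr k := fun k h5 h6 h7 => by
    rw [run_arr]
    have : startSearch.modArrs = [8, 9, 10, 8] := rfl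
    simp [this, h5, h6, h7]
  have hsearch : Search (s.arr 0 0) r (fun i j => s.arr 4 (i * s.arr 0 0 + j)) (s.arr 7) (s.arr 5)
      (s.arr 6) ((startSearch.run s).arr 8) ((startSearch.run s).arr 9)
      (fun i j => (startSearch.run s).arr 10 (i * s.arr 0 0 + j)) := h.search hr b8 b9 b10
  generalize startSearch.run s = s₁ at *
  set n := s.arr 0 0 with hn
  have e0 : s₁.arr 0 = s.arr 0 := ga 0 (by decide) (by decide) (by decide)
  have main := run_loop_induct (x := 6) (s := s₁) (c := ite (var 7) skip searchStep)
    (fun k s' => s'.arr 4 = s.arr 4 ∧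
      ((s'.var 7 = 0 ∧ s'.arr 7 = s.arr 7 ∧
        Search n r (fun i j => s.arr 4 (i * n + j)) (s.arr 7) (s'.arr 5) (s'.arr 6)
          (s'.arr 8) (s'.arr 9) (fun i j => s'.arr 10 (i * n + j)) ∧
        ((Finset.range n).filter fun j => s'.arr 9 j ≠ 0).card = k) ∨
      (s'.var 7 ≠ 0 ∧ Optimal n (r + 1) (fun i j => s.arr 4 (i * n + j))
        (s'.arr 5) (s'.arr 6) (s'.arr 7))))
    (by decide) (by decide) ?_ ?_
  · rw [e0] at main
    rcases main.2 with ⟨-, -, h1, h2⟩ | ⟨-, h1⟩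
    · exact absurd h2 (h1.card_lt hr).ne
    · exact h1
  · refine ⟨ga 4 (by decide) (by decide) (by decide), Or.inl ⟨by simp [Store.setVar_var, b7],
      ga 7 (by decide) (by decide) (by decide), ?_, ?_⟩⟩
    · simp only [Store.setVar_arr]
      rw [ga 5 (by decide) (by decide) (by decide), ga 6 (by decide) (by decide) (by decide)]
      exact hsearch
    · rw [Finset.card_eq_zero, Finset.filter_eq_empty_iff]
      intro j hj
      simpa using b9 j (by simpa using hj)
  · rintro k hk s' hx h0 ⟨h4, hcase⟩
    rw [e0] at h0
    have g4 : ((ite (var 7) skip searchStep).run s').arr 4 = s.arr 4 := by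
      rw [run_arr _ _ (by decide), h4]
    refine ⟨by simpa using g4, ?_⟩
    rcases hcase with ⟨h7, a7, h1, h2⟩ | ⟨h7, h1⟩
    · have hrun' : (ite (var 7) skip searchStep).run s' = searchStep.run s' := if_pos h7
      rw [hrun']
      rw [Store.setVar_arr, Store.setVar_var, if_neg (by decide)]
      have hn' : s'.arr 0 0 = n := by rw [h0]
      have key := searchStep_spec s' (r := r) (p := s.arr 7) (by rw [hn']; exact hr) a7 h7
        (by rw [hn', h4]; exact h1) _ rfl
      rw [hn', h4, h2] at key
      exact key
    · have hrun' : (ite (var 7) skip searchStep).run s' = s' := if_neg h7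
      rw [hrun']
      exact Or.inr ⟨by simpa [Store.setVar_var] using h7, h1⟩

/-- Stage `r` adds row `r`, starting from the empty matching. Missing edges count as pairs of weight
0, so all rows can be matched. -/
theorem hungarian_spec (s : Store) (h6 : s.arr 6 = fun _ => 0) (h7 : s.arr 7 = fun _ => 0) :
    Optimal (s.arr 0 0) (s.arr 0 0) (fun i j => s.arr 4 (i * s.arr 0 0 + j))
      ((hungarian.run s).arr 5) ((hungarian.run s).arr 6) ((hungarian.run s).arr 7) := by
  have hrun : hungarian.run s = (loop 5 search).run (initDual.run s) := rfl
  have hinit := initDual_spec s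
  have e0 : (initDual.run s).arr 0 = s.arr 0 := run_arr _ _ (by decide)
  have e4 : (initDual.run s).arr 4 = s.arr 4 := run_arr _ _ (by decide)
  have e6 : (initDual.run s).arr 6 = s.arr 6 := run_arr _ _ (by decide)
  have e7 : (initDual.run s).arr 7 = s.arr 7 := run_arr _ _ (by decide)
  rw [hrun]
  generalize initDual.run s = s₁ at *
  set n := s.arr 0 0 with hn
  have main := run_loop_induct (x := 5) (s := s₁) (c := search)
    (fun r s' => s'.arr 4 = s.arr 4 ∧ Optimal n r (fun i j => s.arr 4 (i * n + j))
        (s'.arr 5) (s'.arr 6) (s'.arr 7))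
    (by decide) (by decide) ?_ ?_
  · rw [e0] at main
    exact main.2
  · refine ⟨e4, ⟨fun i hi j hj => ?_, fun j _ _ => ?_, ⟨fun j hj i hi => ?_, fun j _ _ _ i hi => ?_,
      fun i _ hi => absurd hi (Nat.not_lt_zero i)⟩, fun j _ i hi => ?_⟩⟩
    · exact (hinit i hi j hj).trans (Nat.le_add_right _ _)
    · simp [e6, h6]
    all_goals simp [e7, h7] at hi
  · rintro r hr s' hx h0 ⟨h4, hO⟩
    rw [e0] at h0 hr
    have hn' : s'.arr 0 0 = n := by rw [h0]
    have key := search_spec s' hx (by rw [hn']; exact hr) (by rw [hn', h4]; exact hO)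
    rw [hn', h4] at key
    refine ⟨?_, key⟩
    rw [Store.setVar_arr, run_arr _ _ (by decide), h4]

end Prog
end RAM

namespace Quantum

/-! ## Algebraic entries of the block states -/

def algZero : AlgReal := ⟨[0, 1], 0, 0⟩

def algOne : AlgReal := ⟨[-1, 1], 1, 1⟩

/-- `(1 + √s) / 2` for `s = (√5 - 1) / 2`. -/
def algMajor : AlgReal := ⟨[1, -12, 28, -32, 16], 1 / 2, 1⟩

/-- `(1 - √s) / 2` for `s = (√5 - 1) / 2`. -/
def algMinor : AlgReal := ⟨[1, -12, 28, -32, 16], 0, 1 / 2⟩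

/-- `-s / 2` for `s = (√5 - 1) / 2`. -/
def algCross : AlgReal := ⟨[-1, -2, 4], -1, 0⟩

def AlgReal.toComplex (a : AlgReal) : AlgComplex := ⟨a, algZero⟩

/-- The entries of `|0⟩⟨0|` and of `|1⟩⟨1|`. -/
def singleEntries (c : ℕ) : List AlgComplex :=
  if c = 0 then [algOne, algZero, algZero, algZero].map AlgReal.toComplex
  else [algZero, algZero, algZero, algOne].map AlgReal.toComplex

/-- The entries of the projection onto `√((1 + √s) / 2) |01⟩ - √((1 - √s) / 2) |10⟩`. -/
def pairEntries : List AlgComplex :=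
  [algZero, algZero, algZero, algZero, algZero, algMinor, algCross, algZero,
    algZero, algCross, algMajor, algZero, algZero, algZero, algZero, algZero].map AlgReal.toComplex

end Quantum

namespace RAM
namespace Prog

open RAM.Expr
open Assignment

/-! ### Mates and output -/

/-- Record the pairs of positive weight of the matching. -/
def mates : Prog :=
  loop 2 <| ite (read 7 (var 2)) (ite (read 4 (idx (read 7 (var 2) - const 1) (var 2)))
    (block [write 11 (var 2) (read 7 (var 2)), write 11 (read 7 (var 2) - const 1) (var 2 + const 1)])
    skip) skip

/-- Pairs of weight 0 only complete the square assignment and are discarded. Rows and columns are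
two copies of the same vertices, but in a pair of nonzero weight the row has colour 0 and the column
does not; so no vertex is used both as a row and as a column, and the writes do not collide. -/
theorem mates_spec (s : Store) (h11 : s.arr 11 = fun _ => 0)
    (hp : Matching (s.arr 0 0) (· < s.arr 0 0) (s.arr 7)) (col : ℕ → ℕ)
    (hcol : ∀ i < s.arr 0 0, ∀ j < s.arr 0 0, s.arr 4 (i * s.arr 0 0 + j) ≠ 0 →
      col i = 0 ∧ col j ≠ 0) :
    ∀ k < s.arr 0 0, ∀ l, (mates.run s).arr 11 k = l + 1 ↔
      (s.arr 7 k = l + 1 ∧ s.arr 4 (l * s.arr 0 0 + k) ≠ 0) ∨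
      (l < s.arr 0 0 ∧ s.arr 7 l = k + 1 ∧ s.arr 4 (k * s.arr 0 0 + l) ≠ 0) := by
  set n := s.arr 0 0 with hn
  have main := run_loop_induct (x := 2) (s := s)
    (c := ite (read 7 (var 2)) (ite (read 4 (idx (read 7 (var 2) - const 1) (var 2)))
      (block [write 11 (var 2) (read 7 (var 2)),
        write 11 (read 7 (var 2) - const 1) (var 2 + const 1)]) skip) skip)
    (fun q s' => s'.arr 7 = s.arr 7 ∧ s'.arr 4 = s.arr 4 ∧
      ∀ k < n, ∀ l, s'.arr 11 k = l + 1 ↔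
      (k < q ∧ s.arr 7 k = l + 1 ∧ s.arr 4 (l * n + k) ≠ 0) ∨
      (l < q ∧ s.arr 7 l = k + 1 ∧ s.arr 4 (k * n + l) ≠ 0))
    (by decide) (by decide) ⟨rfl, rfl, by simp [h11]⟩ ?_
  · intro k hk l
    rw [mates, main.2.2 k hk l]
    simp [hk, ← hn]
  · rintro j hj s' hx h0 ⟨h7, h4, h⟩
    have h0' : s'.arr 0 0 = n := by rw [h0]
    simp only [run_ite, eval_read, eval_var, eval_idx, eval_sub, eval_const, hx, h7, h4, h0', run_skip,
      run_block_cons, run_block_nil, run_write]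
    by_cases c1 : s.arr 7 j = 0
    · simp only [c1, if_true]
      refine ⟨h7, h4, fun k hk l => ?_⟩
      simp only [Store.setVar_arr, h k hk l]
      grind
    obtain ⟨i, hi⟩ : ∃ i, s.arr 7 j = i + 1 := ⟨s.arr 7 j - 1, by omega⟩
    have hin := (hp.range j hj i hi).1
    simp only [hi, Nat.add_sub_cancel, Nat.succ_ne_zero, if_false]
    by_cases c2 : s.arr 4 (i * n + j) = 0
    · simp only [c2, if_true]
      refine ⟨h7, h4, fun k hk l => ?_⟩
      simp only [Store.setVar_arr, h k hk l]
      grind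
    simp only [c2, if_false]
    refine ⟨by simp [Store.setArr_arr, h7], by simp [Store.setArr_arr, h4], fun k hk l => ?_⟩
    simp only [Store.setVar_arr, Store.setArr_arr, if_true, Function.update_apply, Store.setArr_var,
      hx, eval_var, eval_add, eval_const, Nat.reduceEqDiff, if_false, h7, hi, Nat.add_sub_cancel]
    obtain ⟨ci, cj⟩ := hcol i hin j hj c2
    have hkl : s.arr 7 k = l + 1 → s.arr 4 (l * n + k) ≠ 0 → col l = 0 ∧ col k ≠ 0 :=
      fun e1 e2 => hcol l (hp.range k hk l e1).1 k hk e2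
    by_cases ki : k = i
    · subst ki
      rw [if_pos rfl]
      constructor
      · intro e
        obtain rfl : j = l := by omega
        exact Or.inr ⟨by omega, hi, c2⟩
      · rintro (⟨-, e1, e2⟩ | ⟨e0, e1, e2⟩)
        · exact absurd ci (hkl e1 e2).2
        · rw [hp.inj j hj l (by omega) k hi e1]
    rw [if_neg ki]
    by_cases kj : k = j
    · subst kj
      rw [if_pos rfl]
      constructor
      · intro e
        obtain rfl : i = l := by omega
        exact Or.inl ⟨by omega, hi, c2⟩
      · rintro (⟨-, e1, e2⟩ | ⟨e0, e1, e2⟩)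
        · omega
        · exact absurd (hcol k hk l (by omega) e2).1 cj
    rw [if_neg kj, h k hk l]
    grind

def emit (e : Expr) : Prog := block [write 1 (var 1) e, assign 1 (var 1 + const 1)]

def emitList (l : List ℕ) : Prog := block (l.map fun c => emit (const c))

/-- Write the block of vertex `i`, if there is one. -/
def emitBlock : Prog :=
  ite (read 11 (var 2))
    (ite (read 3 (var 2)) skip
      (block [assign 16 (var 16 + const 1), emit (const 2), emit (var 2),
        emit (read 11 (var 2) - const 1), emitList (Enc.list Enc.algComplex Quantum.pairEntries)]))
    (block [assign 16 (var 16 + const 1), emit (const 1), emit (var 2),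
      ite (read 3 (var 2)) (emitList (Enc.list Enc.algComplex (Quantum.singleEntries 1)))
        (emitList (Enc.list Enc.algComplex (Quantum.singleEntries 0)))])

/-- The number of blocks is known only at the end, so cell 0 of the output is reserved for it and
writing starts at cell 1. -/
def emitBlocks : Prog := block
  [assign 1 (const 1), assign 16 (const 0), loop 2 emitBlock, write 1 (const 0) (var 16)]

theorem emit_spec (e : Expr) (s : Store) : ((emit e).run s).output = s.output ++ [e.eval s] := by
  simp only [emit, run_block_cons, run_block_nil, run_write, run_assign, Store.output, eval_var,
    eval_add, eval_const, Store.setVar_var, Store.setVar_arr, Store.setArr_arr, Store.setArr_var,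
    if_true, List.range_succ, List.map_append, List.map_cons, List.map_nil, Function.update_self]
  congr 1
  refine List.map_congr_left fun i hi => ?_
  rw [Function.update_of_ne]
  rw [List.mem_range] at hi
  omega

theorem modVars_emitList (l : List ℕ) : ∀ x ∈ (emitList l).modVars, x = 1 := by
  induction l with
  | nil => simp [emitList, block, modVars]
  | cons a l ih =>
    intro x hx
    simp only [emitList, List.map_cons, block, emit, modVars, List.mem_append, List.mem_cons,
      List.not_mem_nil] at hx ih
    have := ih x
    tauto

theorem modArrs_emitList (l : List ℕ) : ∀ k ∈ (emitList l).modArrs, k = 1 := by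
  induction l with
  | nil => simp [emitList, block, modArrs]
  | cons a l ih =>
    intro x hx
    simp only [emitList, List.map_cons, block, emit, modArrs, List.mem_append, List.mem_cons,
      List.not_mem_nil] at hx ih
    have := ih x
    tauto

theorem emitList_spec (l : List ℕ) (s : Store) : ((emitList l).run s).output = s.output ++ l := by
  induction l generalizing s with
  | nil => simp [emitList, run_block_nil]
  | cons a l ih =>
    simp only [emitList, List.map_cons, run_block_cons] at ih ⊢
    rw [ih, emit_spec, eval_const]
    simp

/-- The codes of the blocks that belong to vertex `i`. -/
def blockCodes (col mate : ℕ → ℕ) (i : ℕ) : List (List ℕ) :=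
  if mate i = 0 then [1 :: i :: Enc.list Enc.algComplex (Quantum.singleEntries (col i))]
  else if col i = 0 then
    [2 :: i :: (mate i - 1) :: Enc.list Enc.algComplex Quantum.pairEntries] else []

theorem modVars_emitBlock : ∀ x ∈ emitBlock.modVars, x = 1 ∨ x = 16 := by
  intro x hx
  have h := fun l => modVars_emitList l x
  simp only [emitBlock, modVars, block, emit, List.mem_append, List.mem_cons,
    List.not_mem_nil, or_false, false_or] at hx
  grind

theorem modArrs_emitBlock : ∀ x ∈ emitBlock.modArrs, x = 1 := by
  intro x hx
  have h := fun l => modArrs_emitList l x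
  simp only [emitBlock, modArrs, block, emit, List.mem_append, List.mem_cons,
    List.not_mem_nil, or_false, false_or] at hx
  grind

theorem singleEntries_of_ne_zero {c : ℕ} (hc : c ≠ 0) :
    Quantum.singleEntries c = Quantum.singleEntries 1 := by
  simp [Quantum.singleEntries, hc]

theorem emitBlock_spec (s : Store) {i : ℕ} (hi : s.var 2 = i) :
    (emitBlock.run s).output = s.output ++ (blockCodes (s.arr 3) (s.arr 11) i).flatten ∧
    (emitBlock.run s).var 16 = s.var 16 + (blockCodes (s.arr 3) (s.arr 11) i).length := by
  have hl16 : ∀ l s, ((emitList l).run s).var 16 = s.var 16 := fun l s =>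
    run_var _ _ fun h => by simpa using modVars_emitList l 16 h
  have he16 : ∀ e s, ((emit e).run s).var 16 = s.var 16 := fun e s => run_var _ _ (by
    simp [emit, block, modVars])
  have he2 : ∀ e s, ((emit e).run s).var 2 = s.var 2 := fun e s => run_var _ _ (by
    simp [emit, block, modVars])
  have hea : ∀ e s k, k ≠ 1 → ((emit e).run s).arr k = s.arr k := fun e s k hk => run_arr _ _ (by
    simp [emit, block, modArrs, hk])
  have ho : ∀ v, (s.setVar 16 v).output = s.output := fun v => by
    simp [Store.output, Store.setVar_var]
  simp only [emitBlock, run_ite, eval_read, eval_var, hi, blockCodes]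
  by_cases c1 : s.arr 11 i = 0
  · simp only [c1, if_true, run_block_cons, run_block_nil, run_assign, run_ite]
    simp only [eval_read, eval_var, he2, hea _ _ 3 (by decide), Store.setVar_arr]
    have e2 : ∀ v, (s.setVar 16 v).var 2 = i := fun v => by simp [Store.setVar_var, hi]
    simp only [e2]
    by_cases c2 : s.arr 3 i = 0
    · simp only [c2, if_true, emitList_spec, emit_spec, hl16, he16, eval_var, he2, e2, ho, eval_const]
      simp [Store.setVar_var, eval_add, eval_var, eval_const]
    · simp only [c2, if_false, emitList_spec, emit_spec, hl16, he16, eval_var, he2, e2, ho, eval_const]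
      simp [Store.setVar_var, eval_add, eval_var, eval_const, singleEntries_of_ne_zero c2]
  · simp only [c1, if_false, run_block_cons, run_block_nil, run_assign]
    have e2 : ∀ v, (s.setVar 16 v).var 2 = i := fun v => by simp [Store.setVar_var, hi]
    by_cases c2 : s.arr 3 i = 0
    · simp only [c2, if_true, emitList_spec, emit_spec, hl16, he16, eval_var, he2, e2, ho, eval_const,
        eval_sub, eval_read, hea _ _ 11 (by decide), Store.setVar_arr]
      simp [Store.setVar_var, eval_add, eval_var, eval_const]
    · simp [c2, run_skip]

theorem emitBlocks_spec (s : Store) :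
    (emitBlocks.run s).output =
      ((List.range (s.arr 0 0)).flatMap (blockCodes (s.arr 3) (s.arr 11))).length ::
        ((List.range (s.arr 0 0)).flatMap (blockCodes (s.arr 3) (s.arr 11))).flatten := by
  obtain ⟨t, ht⟩ : ∃ t, t = (assign 16 (const 0)).run ((assign 1 (const 1)).run s) := ⟨_, rfl⟩
  have hrun : emitBlocks.run s = (write 1 (const 0) (var 16)).run ((loop 2 emitBlock).run t) := by
    rw [ht]; rfl
  have ta : t.arr = s.arr := by rw [ht]; rfl
  have t1 : t.var 1 = 1 := by rw [ht]; simp [run_assign, Store.setVar_var, eval_const]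
  have t16 : t.var 16 = 0 := by rw [ht]; simp [run_assign, Store.setVar_var, eval_const]
  have main := run_loop_induct (x := 2) (s := t) (c := emitBlock)
    (fun q s' => s'.arr 3 = s.arr 3 ∧ s'.arr 11 = s.arr 11 ∧
      s'.output = s.arr 1 0 :: ((List.range q).flatMap (blockCodes (s.arr 3) (s.arr 11))).flatten ∧
      s'.var 16 = ((List.range q).flatMap (blockCodes (s.arr 3) (s.arr 11))).length)
    (fun h => by simpa using modVars_emitBlock 2 h) (fun h => by simpa using modArrs_emitBlock 0 h)
    (by simp [ta, Store.output, Store.setVar_var, t1, t16]) ?_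
  · rw [hrun]
    rw [ta] at main
    obtain ⟨-, -, h1, h2⟩ := main
    rw [← h2]
    generalize (loop 2 emitBlock).run t = t' at *
    generalize ((List.range (s.arr 0 0)).flatMap (blockCodes (s.arr 3) (s.arr 11))).flatten = L at *
    simp only [run_write, eval_const, eval_var]
    simp only [Store.output, Store.setArr_var, Store.setArr_arr, if_true] at h1 ⊢
    cases hv : t'.var 1 with
    | zero => simp [hv] at h1
    | succ m =>
      rw [hv, List.range_succ_eq_map, List.map_cons, List.cons.injEq] at h1
      rw [List.range_succ_eq_map, List.map_cons, Function.update_self, ← h1.2]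
      congr 1
      refine List.map_congr_left fun i hi => ?_
      rw [Function.update_of_ne]
      simp only [List.mem_map] at hi
      obtain ⟨a, -, rfl⟩ := hi
      simp
  · rintro q hq s' hx h0 ⟨h3, h11, h1, h2⟩
    obtain ⟨a1, a2⟩ := emitBlock_spec s' hx
    have e3 : (emitBlock.run s').arr 3 = s'.arr 3 :=
      run_arr _ _ fun h => by simpa using modArrs_emitBlock 3 h
    have e11 : (emitBlock.run s').arr 11 = s'.arr 11 :=
      run_arr _ _ fun h => by simpa using modArrs_emitBlock 11 h
    refine ⟨by simp [e3, h3], by simp [e11, h11], ?_, ?_⟩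
    · have : ((emitBlock.run s').setVar 2 (q + 1)).output = (emitBlock.run s').output := by
        simp [Store.output, Store.setVar_var]
      rw [this, a1, h1, h3, h11]
      simp [List.range_succ, List.flatMap_append]
    · rw [Store.setVar_var, if_neg (by decide), a2, h2, h3, h11]
      simp [List.range_succ, List.flatMap_append]

/-- The whole algorithm. -/
def algorithm : Prog := block [colour, common, weights, hungarian, mates, emitBlocks]

theorem tame_block (l : List Prog) (h : ∀ c ∈ l, c.Tame) : (block l).Tame := by
  induction l with
  | nil => trivial
  | cons c l ih => exact ⟨h c (by simp), ih fun d hd => h d (by simp [hd])⟩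

theorem tame_emitList (l : List ℕ) : (emitList l).Tame := by
  refine tame_block _ fun c hc => ?_
  simp only [List.mem_map] at hc
  obtain ⟨a, -, rfl⟩ := hc
  simp [emit, block, Prog.Tame, tame_var, tame_const, tame_add]

theorem tame_algorithm : algorithm.Tame := by
  refine tame_block _ fun c hc => ?_
  simp only [List.mem_cons, List.not_mem_nil, or_false] at hc
  rcases hc with rfl | rfl | rfl | rfl | rfl | rfl
  · simp [colour, merge, renumber, block, Prog.Tame, modVars, tame_var, tame_const, tame_sub,
      tame_read, tame_ne, tame_idx, tame_numer]
  · simp [common, block, Prog.Tame, modVars, tame_var, tame_const, tame_mul_denom, tame_idx]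
  · simp [weights, Prog.Tame, modVars, tame_var, tame_read, tame_idx, tame_mul_numer, tame_div,
      tame_denom]
  · simp [hungarian, initDual, search, startSearch, searchStep, findMin, choosePair, slack,
      updateDual, grow, augment, block, Prog.Tame, modVars, tame_var, tame_const, tame_add, tame_sub,
      tame_read, tame_idx]
  · simp [mates, block, Prog.Tame, modVars, tame_var, tame_const, tame_add, tame_sub, tame_read,
      tame_idx]
  · have h2 : 2 ∉ emitBlock.modVars := fun h => by simpa using modVars_emitBlock 2 h
    refine tame_block _ fun c hc => ?_
    simp only [List.mem_cons, List.not_mem_nil, or_false] at hc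
    rcases hc with rfl | rfl | rfl | rfl
    · simp [Prog.Tame, tame_const]
    · simp [Prog.Tame, tame_const]
    · refine ⟨h2, ?_⟩
      simp [emitBlock, emit, block, Prog.Tame, tame_var, tame_const, tame_add, tame_sub, tame_read,
        tame_emitList]
    · simp [Prog.Tame, tame_const, tame_var]

end Prog
end RAM

/-! ### Paired colourings and their certificates of optimality -/

namespace Quantum

/-- A colouring of the qubits by 0 and 1 together with a matching of qubits of different colours. -/
structure PairedColouring (n : ℕ) where
  col : Fin n → ℕ
  mate : Fin n → Option (Fin n)
  symm : ∀ {i j}, mate i = some j → mate j = some i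
  bichromatic : ∀ {i j}, mate i = some j → (col i = 0 ↔ col j ≠ 0)

namespace PairedColouring

variable {n : ℕ} (G : PairedColouring n)

/-- The blocks that belong to qubit `i`: pairs belong to their qubit of colour 0. -/
def blocks (i : Fin n) : List (Block n) :=
  match G.mate i with
  | none => [⟨[i], singleEntries (G.col i)⟩]
  | some j => if G.col i = 0 then [⟨[i, j], pairEntries⟩] else []

def description : Description n := (List.finRange n).flatMap G.blocks

/-- The weight of the matching. -/
def weight (w : Matrix (Fin n) (Fin n) ℚ) : ℝ :=
  ∑ i, if G.col i = 0 then (match G.mate i with | none => 0 | some j => (w i j : ℝ)) else 0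

/-- `G` is a proper colouring with a matching of maximum weight, certified by a dual solution. -/
structure Optimal (w : Matrix (Fin n) (Fin n) ℚ) : Prop where
  proper : ∀ i j, i ≠ j → w i j ≠ 0 → (G.col i = 0 ↔ G.col j ≠ 0)
  dual : ∃ y : Fin n → ℝ, (∀ i, 0 ≤ y i) ∧ (∀ i j, i ≠ j → (w i j : ℝ) ≤ y i + y j) ∧
    ∑ i, y i ≤ G.weight w

end PairedColouring
end Quantum

/-! ### Positions of the matrix entries in the input -/

namespace Enc

theorem getD_flatMap {α : Type*} (l : List α) (f : α → List ℕ) (L : ℕ) (hf : ∀ a, (f a).length = L)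
    (i t : ℕ) (hi : i < l.length) (ht : t < L) :
    (l.flatMap f).getD (i * L + t) 0 = (f l[i]).getD t 0 := by
  induction l generalizing i with
  | nil => simp at hi
  | cons a l ih =>
    rw [List.flatMap_cons]
    cases i with
    | zero =>
      rw [List.getD_append _ _ _ _ (by rw [hf]; omega)]
      simp
    | succ i =>
      rw [List.getD_append_right _ _ _ _ (by rw [hf]; nlinarith), hf,
        show (i + 1) * L + t - L = i * L + t by rw [add_mul, one_mul]; omega,
        ih i (by simpa using hi)]
      simp

theorem length_flatMap_finRange {n : ℕ} (f : Fin n → List ℕ) (L : ℕ) (hf : ∀ a, (f a).length = L) :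
    ((List.finRange n).flatMap f).length = n * L := by
  simp [List.length_flatMap, hf]

theorem matrix_getD {n : ℕ} (w : Matrix (Fin n) (Fin n) ℚ) (i j : Fin n) (t : ℕ) (ht : t < 3) :
    (Enc.matrix w).getD (3 * ((i : ℕ) * n + j) + t + 1) 0 = (Enc.rat (w i j)).getD t 0 := by
  have h3 : ∀ q, (Enc.rat q).length = 3 := fun q => rfl
  rw [Enc.matrix, List.getD_cons_succ,
    show 3 * ((i : ℕ) * n + j) + t = i * (n * 3) + (j * 3 + t) by ring,
    getD_flatMap _ (fun i => (List.finRange n).flatMap fun j => Enc.rat (w i j)) (n * 3) (fun a => length_flatMap_finRange _ 3 fun b => h3 _) _ _ (by simp)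
      (by have := j.2; nlinarith)]
  rw [getD_flatMap _ _ 3 (fun b => h3 _) _ _ (by simp) ht]
  simp

end Enc

/-! ### From the integral primal and dual solutions to a paired colouring -/

namespace RAM
namespace Prog

open RAM.Expr

/-- The weight of the assignment, summed over columns, is reindexed by rows: every nonzero term
belongs to a recorded pair, whose row is its vertex of colour 0. -/
theorem matching_sum_eq {n : ℕ} {a : ℕ → ℕ → ℕ} {p mate col : ℕ → ℕ}
    (hp : Assignment.Matching n (· < n) p)
    (hcol : ∀ i < n, ∀ j < n, a i j ≠ 0 → col i = 0 ∧ col j ≠ 0)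
    (hmate : ∀ k < n, ∀ l, mate k = l + 1 ↔
      (p k = l + 1 ∧ a l k ≠ 0) ∨ (l < n ∧ p l = k + 1 ∧ a k l ≠ 0)) :
    ∑ j ∈ Finset.range n, (if p j = 0 then 0 else a (p j - 1) j) =
      ∑ i ∈ Finset.range n, (if col i = 0 ∧ mate i ≠ 0 then a i (mate i - 1) else 0) := by
  have hpair : ∀ j < n, (if p j = 0 then 0 else a (p j - 1) j) ≠ 0 →
      ∃ i < n, p j = i + 1 ∧ a i j ≠ 0 ∧ col i = 0 ∧ mate i = j + 1 := by
    intro j hj h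
    have h0 : p j ≠ 0 := by rintro h0; simp [h0] at h
    rw [if_neg h0] at h
    have hi : p j = (p j - 1) + 1 := by omega
    have hlt := (hp.range j hj _ hi).1
    exact ⟨p j - 1, hlt, hi, h, (hcol _ hlt j hj h).1, (hmate _ hlt j).2 (Or.inr ⟨hj, hi, h⟩)⟩
  refine Finset.sum_bij_ne_zero (fun j _ _ => p j - 1) ?_ ?_ ?_ ?_
  · intro j hj h
    obtain ⟨i, hi, h1, -⟩ := hpair j (by simpa using hj) h
    simpa [h1] using hi
  · intro j hj h j' hj' h' e
    simp only [Finset.mem_range] at hj hj'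
    obtain ⟨i, hi, h1, -⟩ := hpair j hj h
    obtain ⟨i', hi', h1', -⟩ := hpair j' hj' h'
    have : i = i' := by simp only [h1, h1'] at e; omega
    exact hp.inj j hj j' hj' i h1 (by rw [h1', this])
  · intro i hi h
    simp only [Finset.mem_range] at hi
    have hc : col i = 0 ∧ mate i ≠ 0 := by by_contra hc; simp [hc] at h
    rw [if_pos hc] at h
    have hm : mate i = (mate i - 1) + 1 := by omega
    rcases (hmate i hi _).1 hm with ⟨h1, h2⟩ | ⟨h1, h2, h3⟩
    · exact absurd hc.1 (hcol _ (hp.range i hi _ h1).1 i hi h2).2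
    · exact ⟨mate i - 1, by simpa using h1, by simpa [h2] using h3, by simp [h2]⟩
  · intro j hj h
    obtain ⟨i, hi, h1, h2, h3, h4⟩ := hpair j (by simpa using hj) h
    simp [h1, h3, h4]

/-- The state of the store after the algorithm has computed the colours and the mates. -/
theorem algorithm_certificate {n : ℕ} (x : ℕ → ℕ) (hx : x 0 = n) (s : Store) (hs0 : s.arr 0 = x)
    (hs : ∀ k, k ≠ 0 → s.arr k = fun _ => 0) (A : ℕ → Prop)
    (hden : ∀ i < n, ∀ j < n, 0 < x (3 * (i * n + j) + 3))
    (hA : ∀ i < n, ∀ j < n, i ≠ j → x (3 * (i * n + j) + 2) ≠ 0 → (A i ↔ ¬ A j)) :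
    ∃ (col mate u v : ℕ → ℕ) (a : ℕ → ℕ → ℕ) (p : ℕ → ℕ) (P : ℕ),
      (algorithm.run s).output = ((List.range n).flatMap (blockCodes col mate)).length ::
        ((List.range n).flatMap (blockCodes col mate)).flatten ∧
      (∀ i < n, ∀ j < n, i ≠ j → x (3 * (i * n + j) + 2) ≠ 0 → (col i = 0 ↔ col j ≠ 0)) ∧
      0 < P ∧ (∀ i < n, ∀ j < n, x (3 * (i * n + j) + 3) ∣ P) ∧
      (∀ i < n, ∀ j < n, a i j = if col i = 0 ∧ col j ≠ 0 then
        P / x (3 * (i * n + j) + 3) * x (3 * (i * n + j) + 2) else 0) ∧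
      Assignment.Optimal n n a u v p ∧
      (∀ k < n, ∀ l, mate k = l + 1 ↔
        (p k = l + 1 ∧ a l k ≠ 0) ∨ (l < n ∧ p l = k + 1 ∧ a k l ≠ 0)) := by
  subst hs0 hx
  obtain ⟨n, hn⟩ : ∃ n, n = s.arr 0 0 := ⟨_, rfl⟩
  rw [← hn] at hden hA ⊢
  -- Colours.
  obtain ⟨c1, c2⟩ := colour_spec s A (hs 3 (by decide)) (by rwa [← hn])
  rw [← hn] at c1 c2
  have hca : ∀ k, k ≠ 2 → k ≠ 3 → (colour.run s).arr k = s.arr k := fun k h2 h3 => by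
    rw [run_arr]
    have : colour.modArrs = [2, 3, 2] := rfl
    simp [this, h2, h3]
  have hrun : algorithm.run s = emitBlocks.run (mates.run (hungarian.run (weights.run (common.run
    (colour.run s))))) := rfl
  rw [hrun]
  generalize colour.run s = s₁ at *
  have h10 := hca 0 (by decide) (by decide)
  -- The common denominator.
  obtain ⟨p1, p2⟩ := common_spec s₁ (by rw [h10, ← hn]; exact hden)
  rw [h10, ← hn] at p2
  have hpa : ∀ k, (common.run s₁).arr k = s₁.arr k := fun k => run_arr _ _ (by
    have : common.modArrs = [] := rfl
    simp [this])
  generalize common.run s₁ = s₂ at *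
  -- Weights.
  have w1 := weights_spec s₂ (by rw [hpa, hca 4 (by decide) (by decide), hs 4 (by decide)])
  have hwa : ∀ k, k ≠ 4 → (weights.run s₂).arr k = s₂.arr k := fun k h4 => run_arr _ _ (by
    have : weights.modArrs = [4] := rfl
    simp [this, h4])
  rw [hpa 0, hpa 3, h10, ← hn] at w1
  generalize weights.run s₂ = s₃ at *
  -- The matching.
  have h30 : s₃.arr 0 0 = n := by rw [hwa 0 (by decide), hpa, h10, hn]
  have hun := hungarian_spec s₃
    (by rw [hwa 6 (by decide), hpa, hca 6 (by decide) (by decide), hs 6 (by decide)])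
    (by rw [hwa 7 (by decide), hpa, hca 7 (by decide) (by decide), hs 7 (by decide)])
  rw [h30] at hun
  have f0 : (hungarian.run s₃).arr 0 = s₃.arr 0 := run_arr _ _ (by decide)
  have f3 : (hungarian.run s₃).arr 3 = s₃.arr 3 := run_arr _ _ (by decide)
  have f4 : (hungarian.run s₃).arr 4 = s₃.arr 4 := run_arr _ _ (by decide)
  have f11 : (hungarian.run s₃).arr 11 = s₃.arr 11 := run_arr _ _ (by decide)
  generalize hungarian.run s₃ = s₄ at *
  -- Mates.
  have h40 : s₄.arr 0 0 = n := by rw [f0, h30]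
  have hcol : ∀ i < n, ∀ j < n, s₄.arr 4 (i * n + j) ≠ 0 → s₁.arr 3 i = 0 ∧ s₁.arr 3 j ≠ 0 := by
    intro i hi j hj h
    rw [f4, w1 i hi j hj] at h
    by_contra hc
    rw [if_neg hc] at h
    exact h rfl
  have m1 := mates_spec s₄
    (by rw [f11, hwa 11 (by decide), hpa, hca 11 (by decide) (by decide), hs 11 (by decide)])
    (by rw [h40]; exact hun.matching) (s₁.arr 3) (by rw [h40]; exact hcol)
  rw [h40] at m1
  have g0 : (mates.run s₄).arr 0 = s₄.arr 0 := run_arr _ _ (by decide)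
  have g3 : (mates.run s₄).arr 3 = s₄.arr 3 := run_arr _ _ (by decide)
  generalize mates.run s₄ = s₅ at *
  refine ⟨s₁.arr 3, s₅.arr 11, s₄.arr 5, s₄.arr 6, fun i j => s₃.arr 4 (i * n + j), s₄.arr 7,
    s₂.var 15, ?_, fun i hi j hj hij hne => ?_, p1, p2, w1, hun, ?_⟩
  · rw [emitBlocks_spec, g0, h40, g3, f3, hwa 3 (by decide), hpa]
  · have e1 := c1 i hi
    have e2 := c1 j hj
    have e3 := c2 i hi j hj hij hne
    omega
  · intro k hk l
    rw [m1 k hk l, f4]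

open Quantum in
/-- The primal and dual solutions over the integers yield an optimal paired colouring. -/
theorem exists_optimal {n : ℕ} {w : Matrix (Fin n) (Fin n) ℚ} (hw : IsInteraction w)
    {col mate u v : ℕ → ℕ} {a : ℕ → ℕ → ℕ} {p : ℕ → ℕ} {P : ℕ} (hP : 0 < P)
    (hcol' : ∀ i j : Fin n, i ≠ j → w i j ≠ 0 → (col i = 0 ↔ col j ≠ 0))
    (hdvd : ∀ i j : Fin n, (w i j).den ∣ P)
    (ha : ∀ i j : Fin n, a i j = if col i = 0 ∧ col j ≠ 0 then
      P / (w i j).den * (w i j).num.natAbs else 0)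
    (hopt : Assignment.Optimal n n a u v p)
    (hmate : ∀ k < n, ∀ l, mate k = l + 1 ↔
        (p k = l + 1 ∧ a l k ≠ 0) ∨ (l < n ∧ p l = k + 1 ∧ a k l ≠ 0)) :
    ∃ G : PairedColouring n, G.Optimal w ∧
      ∀ i : Fin n, (G.blocks i).map Enc.block = blockCodes col mate i := by
  have hacol : ∀ i < n, ∀ j < n, a i j ≠ 0 → col i = 0 ∧ col j ≠ 0 := by
    intro i hi j hj h
    rw [ha ⟨i, hi⟩ ⟨j, hj⟩] at h
    by_contra hc
    rw [if_neg hc] at h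
    exact h rfl
  have hP' : (P : ℝ) ≠ 0 := by positivity
  have haw : ∀ i j : Fin n, col i = 0 → col j ≠ 0 → (w i j : ℝ) = a i j / P := by
    intro i j hi hj
    rw [ha i j, if_pos ⟨hi, hj⟩]
    have hd := hdvd i j
    have hd0 : ((w i j).den : ℝ) ≠ 0 := by exact_mod_cast (w i j).den_nz
    rw [Nat.cast_mul, Nat.cast_div hd hd0]
    have hnn : ((w i j).num.natAbs : ℝ) = ((w i j).num : ℝ) := by
      have h0 : (0 : ℤ) ≤ (w i j).num := Rat.num_nonneg.2 (hw.2 i j)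
      rw [Nat.cast_natAbs, abs_of_nonneg h0]
    rw [hnn, Rat.cast_def]
    field_simp
  have hmlt : ∀ k < n, ∀ l, mate k = l + 1 → l < n := by
    intro k hk l h
    rcases (hmate k hk l).1 h with ⟨h1, -⟩ | ⟨h1, -⟩
    · exact (hopt.matching.range k hk l h1).1
    · exact h1
  have hmsymm : ∀ k < n, ∀ l, mate k = l + 1 → mate l = k + 1 := by
    intro k hk l h
    rw [hmate l (hmlt k hk l h) k]
    rcases (hmate k hk l).1 h with ⟨h1, h2⟩ | ⟨-, h1, h2⟩
    · exact Or.inr ⟨hk, h1, h2⟩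
    · exact Or.inl ⟨h1, h2⟩
  have hmcol : ∀ k < n, ∀ l, mate k = l + 1 → (col k = 0 ↔ col l ≠ 0) := by
    intro k hk l h
    have hl := hmlt k hk l h
    rcases (hmate k hk l).1 h with ⟨h1, h2⟩ | ⟨-, h1, h2⟩
    · have := hacol l hl k hk h2
      exact ⟨fun h => absurd h this.2, fun h => absurd this.1 h⟩
    · have := hacol k hk l hl h2
      exact ⟨fun _ => this.2, fun _ => this.1⟩
  let m : Fin n → Option (Fin n) := fun i =>
    if h : mate i - 1 < n ∧ mate i ≠ 0 then some ⟨mate i - 1, h.1⟩ else none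
  have hm : ∀ i j : Fin n, m i = some j ↔ mate i = j + 1 := by
    intro i j
    simp only [m]
    split_ifs with h
    · simp only [Option.some.injEq, Fin.ext_iff]
      omega
    · simp only [false_iff]
      intro hc
      have := j.2
      exact h ⟨by omega, by omega⟩
  have hm0 : ∀ i : Fin n, m i = none ↔ mate i = 0 := by
    intro i
    simp only [m]
    split_ifs with h
    · simp [h.2]
    · simp only [true_iff]
      by_contra hc
      have := hmlt i i.2 (mate i - 1) (by omega)
      exact h ⟨this, hc⟩
  let G : PairedColouring n :=
    { col := fun i => col i
      mate := m
      symm := fun {i j} h => by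
        rw [hm] at h ⊢
        exact hmsymm i i.2 j h
      bichromatic := fun {i j} h => hmcol i i.2 j ((hm i j).1 h) }
  have hblocks : ∀ i : Fin n, (G.blocks i).map Enc.block = blockCodes col mate i := by
    intro i
    simp only [PairedColouring.blocks, blockCodes, G]
    cases e : m i with
    | none =>
      rw [if_pos ((hm0 i).1 e)]
      simp [Enc.block, Enc.list]
    | some j =>
      have e' := (hm i j).1 e
      rw [if_neg (by omega), e']
      split_ifs with h
      · simp [Enc.block, Enc.list]
      · simp
  -- Vertices of colour 0 act as rows and the others as columns, so one of the two duals is kept at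
  -- each vertex. Dropping the other, which is nonnegative, only lowers the sum; an inequality
  -- between the dual value and the weight is thus all that is needed.
  refine ⟨G, ⟨hcol', fun i => (if col i = 0 then (u i : ℝ) else v i) / P, fun i => ?_, ?_, ?_⟩, hblocks⟩
  · beta_reduce
    split_ifs <;> positivity
  · have key : ∀ i j : Fin n, col i = 0 → col j ≠ 0 → (w i j : ℝ) ≤ u i / P + v j / P := by
      intro i j hi hj
      rw [haw i j hi hj, ← add_div]
      gcongr
      exact_mod_cast hopt.feas i i.2 j j.2
    intro i j hij
    beta_reduce
    by_cases h0 : w i j = 0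
    · rw [h0, Rat.cast_zero]
      split_ifs <;> positivity
    · have hc := hcol' i j hij h0
      by_cases hi : col i = 0
      · rw [if_pos hi, if_neg (hc.1 hi)]
        exact key i j hi (hc.1 hi)
      · have hj : col j = 0 := by_contra fun hj => hi (hc.2 hj)
        rw [if_neg hi, if_pos hj, ← hw.1.apply i j, add_comm]
        exact key j i hj hi
  · rw [← Finset.sum_div, div_le_iff₀ (by positivity)]
    calc ∑ i : Fin n, (if col i = 0 then (u i : ℝ) else v i)
        ≤ ∑ i : Fin n, ((u i : ℝ) + v i) := by
          refine Finset.sum_le_sum fun i _ => ?_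
          split_ifs <;> simp
      _ = ((∑ i ∈ Finset.range n, u i + ∑ j ∈ Finset.range n, v j : ℕ) : ℝ) := by
          rw [Finset.sum_add_distrib, ← Fin.sum_univ_eq_sum_range, ← Fin.sum_univ_eq_sum_range]
          push_cast
          rfl
      _ = ((∑ i ∈ Finset.range n, (if col i = 0 ∧ mate i ≠ 0 then a i (mate i - 1) else 0) : ℕ) : ℝ) := by
          rw [← hopt.sum_eq, matching_sum_eq hopt.matching hacol hmate]
      _ = G.weight w * P := by
          rw [← Fin.sum_univ_eq_sum_range
            (fun i => if col i = 0 ∧ mate i ≠ 0 then a i (mate i - 1) else 0),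
            PairedColouring.weight, Finset.sum_mul, Nat.cast_sum]
          refine Finset.sum_congr rfl fun i _ => ?_
          simp only [G]
          by_cases hi : col i = 0
          · cases e : m i with
            | none => simp [(hm0 i).1 e]
            | some j =>
              have e' := (hm i j).1 e
              have hj := (hmcol i i.2 j e').1 hi
              simp only [hi, e', if_true]
              rw [haw i j hi hj]
              field_simp
              simp
          · simp [hi]
      _ ≤ _ := le_rfl

open Quantum in
theorem algorithm_spec {n : ℕ} (w : Matrix (Fin n) (Fin n) ℚ) (hw : IsInteraction w)
    (hb : IsBipartite w) : ∃ G : PairedColouring n, G.Optimal w ∧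
      (algorithm.run (initStore (Enc.matrix w))).output = Enc.description G.description := by
  obtain ⟨A, hA⟩ := hb
  have harr : (initStore (Enc.matrix w)).arr 0 = fun i => (Enc.matrix w).getD i 0 := by
    simp [initStore]
  have hnum : ∀ i j : Fin n, (Enc.matrix w).getD (3 * ((i : ℕ) * n + j) + 2) 0
      = (w i j).num.natAbs := fun i j => Enc.matrix_getD w i j 1 (by decide)
  have hden : ∀ i j : Fin n, (Enc.matrix w).getD (3 * ((i : ℕ) * n + j) + 3) 0
      = (w i j).den := fun i j => Enc.matrix_getD w i j 2 (by decide)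
  have hne : ∀ i j : Fin n, (w i j).num.natAbs ≠ 0 ↔ w i j ≠ 0 := fun i j => by simp
  obtain ⟨col, mate, u, v, a, p, P, hout, hcol, hP, hdvd, ha, hopt, hmate⟩ :=
    algorithm_certificate (n := n) _ (by simp [Enc.matrix]) (initStore (Enc.matrix w)) harr
      (fun k hk => by simp [initStore, hk]) (fun i => ∃ h : i < n, (⟨i, h⟩ : Fin n) ∈ A)
      (fun i hi j hj => by
        rw [hden ⟨i, hi⟩ ⟨j, hj⟩]; exact Rat.den_pos _)
      (fun i hi j hj hij h => by
        rw [hnum ⟨i, hi⟩ ⟨j, hj⟩, hne] at h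
        simp only [hi, hj, exists_true_left]
        by_contra hc
        exact h (hA _ _ (by simpa using hij) (not_iff_not.1 (not_iff.1 hc))))
  have hcol' : ∀ i j : Fin n, i ≠ j → w i j ≠ 0 → (col i = 0 ↔ col j ≠ 0) := fun i j hij h =>
    hcol i i.2 j j.2 (by simpa [Fin.ext_iff] using hij) (by rwa [hnum, hne])
  obtain ⟨G, hG, hblocks⟩ := exists_optimal hw hP hcol'
    (fun i j => by rw [← hden]; exact hdvd i i.2 j j.2)
    (fun i j => by rw [← hden, ← hnum]; exact ha i i.2 j j.2) hopt hmate
  refine ⟨G, hG, ?_⟩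
  rw [hout]
  have hmap : G.description.map Enc.block = (List.range n).flatMap (blockCodes col mate) := by
    rw [PairedColouring.description, List.map_flatMap]
    simp only [hblocks]
    rw [← List.map_coe_finRange_eq_range, List.flatMap_map]
  rw [Enc.description, Enc.list, ← hmap, List.length_map, List.flatMap_def]

end Prog
end RAM

namespace Quantum

/-! ## The upper bound on the energy -/

variable {n : ℕ}

/-- Exchange of two qubits in a basis state. -/
def exch (i j : Fin n) (x : Fin n → Fin 2) : Fin n → Fin 2 := x ∘ Equiv.swap i j

theorem exch_exch (i j : Fin n) (x : Fin n → Fin 2) : exch i j (exch i j x) = x := by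
  funext k; simp [exch]

theorem exch_comm (i j : Fin n) (x : Fin n → Fin 2) : exch i j x = exch j i x := by
  simp [exch, Equiv.swap_comm]

/-- The expectation of the exchange of two qubits. -/
def exchSum (ψ : (Fin n → Fin 2) → ℝ) (i j : Fin n) : ℝ := ∑ x, ψ x * ψ (exch i j x)

theorem sum_exch {M : Type*} [AddCommMonoid M] (i j : Fin n) (f : (Fin n → Fin 2) → M) :
    ∑ x, f (exch i j x) = ∑ x, f x :=
  Equiv.sum_comp (Function.Involutive.toPerm _ (exch_exch i j)) f

theorem exchSum_comm (ψ : (Fin n → Fin 2) → ℝ) (i j : Fin n) : exchSum ψ i j = exchSum ψ j i := by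
  simp only [exchSum, exch_comm i j]

theorem exchSum_le (ψ : (Fin n → Fin 2) → ℝ) (i j : Fin n) : exchSum ψ i j ≤ ∑ x, ψ x ^ 2 := by
  have h : ∑ x, ψ (exch i j x) ^ 2 = ∑ x, ψ x ^ 2 := sum_exch i j fun x => ψ x ^ 2
  have : 0 ≤ ∑ x, (ψ x - ψ (exch i j x)) ^ 2 := Finset.sum_nonneg fun x _ => sq_nonneg _
  have e : ∑ x, (ψ x - ψ (exch i j x)) ^ 2
      = ∑ x, ψ x ^ 2 + ∑ x, ψ (exch i j x) ^ 2 - 2 * exchSum ψ i j := by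
    rw [exchSum, Finset.mul_sum, ← Finset.sum_add_distrib, ← Finset.sum_sub_distrib]
    exact Finset.sum_congr rfl fun x _ => by ring
  rw [e, h] at this
  linarith

/-- Antisymmetrization over three qubits gives zero. -/
theorem antisymm_eq_zero (ψ : (Fin n → Fin 2) → ℝ) {i j l : Fin n} (hij : i ≠ j) (hil : i ≠ l)
    (hjl : j ≠ l) (x : Fin n → Fin 2) :
    ψ x - ψ (exch i j x) - ψ (exch i l x) - ψ (exch j l x) + ψ (exch i l (exch i j x))
      + ψ (exch i j (exch i l x)) = 0 := by
  -- Three bits take only two values. The transposition of two equal bits fixes `x`, and the six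
  -- terms cancel in pairs of opposite sign.
  have key : x i = x j ∨ x i = x l ∨ x j = x l := by
    omega
  have ext3 : ∀ f g : Fin n → Fin 2, f i = g i → f j = g j → f l = g l →
      (∀ k, k ≠ i → k ≠ j → k ≠ l → f k = g k) → f = g := by
    intro f g h1 h2 h3 h4
    funext k
    by_cases k1 : k = i
    · rw [k1, h1]
    by_cases k2 : k = j
    · rw [k2, h2]
    by_cases k3 : k = l
    · rw [k3, h3]
    exact h4 k k1 k2 k3
  rcases key with h | h | h
  · have e1 : exch i j x = x := by
      refine ext3 _ _ ?_ ?_ ?_ (fun k k1 k2 k3 => ?_) <;>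
        simp [exch, Equiv.swap_apply_def, hil.symm, hjl.symm, *]
    have e2 : exch i j (exch i l x) = exch j l x := by
      refine ext3 _ _ ?_ ?_ ?_ (fun k k1 k2 k3 => ?_) <;>
        simp [exch, Equiv.swap_apply_def, hij.symm, hil.symm, hjl.symm, *]
    rw [e2, e1]; ring
  · have e1 : exch i l x = x := by
      refine ext3 _ _ ?_ ?_ ?_ (fun k k1 k2 k3 => ?_) <;>
        simp [exch, Equiv.swap_apply_def, hij.symm, *]
    have e2 : exch i l (exch i j x) = exch j l x := by
      refine ext3 _ _ ?_ ?_ ?_ (fun k k1 k2 k3 => ?_) <;>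
        simp [exch, Equiv.swap_apply_def, hij.symm, hil.symm, hjl.symm, *]
    rw [e2, e1]; ring
  · have e1 : exch j l x = x := by
      refine ext3 _ _ ?_ ?_ ?_ (fun k k1 k2 k3 => ?_) <;>
        simp [exch, Equiv.swap_apply_def, *]
    have e2 : exch i l (exch i j x) = exch i j x := by
      refine ext3 _ _ ?_ ?_ ?_ (fun k k1 k2 k3 => ?_) <;>
        simp [exch, Equiv.swap_apply_def, hij.symm, hil.symm, hjl.symm, *]
    have e3 : exch i j (exch i l x) = exch i l x := by
      refine ext3 _ _ ?_ ?_ ?_ (fun k k1 k2 k3 => ?_) <;>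
        simp [exch, Equiv.swap_apply_def, hij.symm, hil.symm, hjl.symm, *]
    rw [e2, e3, e1]; ring

/-- Pair the vanishing antisymmetrization with `ψ`. The two 3-cycles are inverse to each other and
contribute equally, and each can be rewritten as a correlation of two transpositions. -/
theorem two_mul_sum_exch_mul_exch (ψ : (Fin n → Fin 2) → ℝ) {i j l : Fin n} (hij : i ≠ j)
    (hil : i ≠ l) (hjl : j ≠ l) :
    2 * ∑ x, ψ (exch i j x) * ψ (exch i l x)
      = exchSum ψ i j + exchSum ψ i l + exchSum ψ j l - ∑ x, ψ x ^ 2 := by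
  have h1 : ∑ x, ψ x * ψ (exch i l (exch i j x)) = ∑ x, ψ (exch i j x) * ψ (exch i l x) := by
    rw [← sum_exch i j]
    simp only [exch_exch]
  have h2 : ∑ x, ψ x * ψ (exch i j (exch i l x)) = ∑ x, ψ (exch i j x) * ψ (exch i l x) := by
    rw [← sum_exch i l]
    simp only [exch_exch]
    exact Finset.sum_congr rfl fun x _ => mul_comm _ _
  have h3 : ∑ x, ψ x * (ψ x - ψ (exch i j x) - ψ (exch i l x) - ψ (exch j l x)
      + ψ (exch i l (exch i j x)) + ψ (exch i j (exch i l x))) = 0 :=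
    Finset.sum_eq_zero fun x _ => by rw [antisymm_eq_zero ψ hij hil hjl, mul_zero]
  simp only [mul_add, mul_sub, Finset.sum_add_distrib, Finset.sum_sub_distrib] at h3
  rw [h1, h2] at h3
  simp only [exchSum, sq]
  linarith

/-- Monogamy of entanglement on a star. -/
theorem sum_neg_exchSum_le (ψ : (Fin n → Fin 2) → ℝ) (i : Fin n) (T : Finset (Fin n))
    (hT : i ∉ T) : ∑ j ∈ T, -exchSum ψ i j ≤ ∑ x, ψ x ^ 2 := by
  set N := ∑ x, ψ x ^ 2 with hN
  set J := ∑ j ∈ T, exchSum ψ i j with hJ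
  have hR : ∀ j ∈ T, ∀ l ∈ T, ∑ x, ψ (exch i j x) * ψ (exch i l x)
      ≤ (exchSum ψ i j + exchSum ψ i l) / 2 + if j = l then N - exchSum ψ i j else 0 := by
    intro j hj l hl
    by_cases e : j = l
    · subst e
      rw [if_pos rfl]
      have : ∑ x, ψ (exch i j x) * ψ (exch i j x) = N := by
        rw [sum_exch i j fun x => ψ x * ψ x, hN]
        exact Finset.sum_congr rfl fun x _ => (sq _).symm
      linarith
    · rw [if_neg e]
      have h1 := two_mul_sum_exch_mul_exch ψ (i := i) (j := j) (l := l)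
        (by rintro rfl; exact hT hj) (by rintro rfl; exact hT hl) e
      have h2 := exchSum_le ψ j l
      linarith
  -- The squared norm of (1 + ∑ SWAP_ij) ψ. The off-diagonal terms are controlled by the three-qubit
  -- identity together with ⟨SWAP_jl⟩ ≤ N.
  have hsq : 0 ≤ ∑ x, (ψ x + ∑ j ∈ T, ψ (exch i j x)) ^ 2 :=
    Finset.sum_nonneg fun x _ => sq_nonneg _
  have hexp : ∑ x, (ψ x + ∑ j ∈ T, ψ (exch i j x)) ^ 2
      = N + 2 * J + ∑ j ∈ T, ∑ l ∈ T, ∑ x, ψ (exch i j x) * ψ (exch i l x) := by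
    have e1 : ∀ x, (ψ x + ∑ j ∈ T, ψ (exch i j x)) ^ 2 = ψ x ^ 2
        + 2 * ∑ j ∈ T, ψ x * ψ (exch i j x)
        + ∑ j ∈ T, ∑ l ∈ T, ψ (exch i j x) * ψ (exch i l x) := by
      intro x
      rw [← Finset.mul_sum, ← Finset.sum_mul_sum]
      ring
    simp only [e1, Finset.sum_add_distrib]
    rw [← Finset.mul_sum, hJ, hN]
    congr 1
    · congr 2
      simp only [exchSum]
      rw [Finset.sum_comm]
    · rw [Finset.sum_comm]
      refine Finset.sum_congr rfl fun j _ => ?_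
      rw [Finset.sum_comm]
  have hbound : ∑ j ∈ T, ∑ l ∈ T, ∑ x, ψ (exch i j x) * ψ (exch i l x)
      ≤ T.card * J + (T.card * N - J) := by
    refine (Finset.sum_le_sum fun j hj => Finset.sum_le_sum fun l hl => hR j hj l hl).trans ?_
    have e1 : ∀ j ∈ T, ∑ l ∈ T, ((exchSum ψ i j + exchSum ψ i l) / 2
        + if j = l then N - exchSum ψ i j else 0)
        = T.card * exchSum ψ i j / 2 + J / 2 + (N - exchSum ψ i j) := by
      intro j hj
      rw [Finset.sum_add_distrib, Finset.sum_ite_eq, if_pos hj, ← Finset.sum_div,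
        Finset.sum_add_distrib, Finset.sum_const, nsmul_eq_mul, ← hJ]
      ring
    rw [Finset.sum_congr rfl e1]
    simp only [Finset.sum_add_distrib, Finset.sum_sub_distrib, Finset.sum_const, nsmul_eq_mul,
      ← Finset.sum_div, ← Finset.mul_sum, ← hJ]
    apply le_of_eq
    ring
  rw [hexp] at hsq
  -- The bound N + 2J + |T| J + |T| N - J factors, so the size of the star cancels.
  have : 0 ≤ ((T.card : ℝ) + 1) * (N + J) := by nlinarith
  have : 0 ≤ N + J := nonneg_of_mul_nonneg_right this (by positivity)
  rw [Finset.sum_neg_distrib]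
  linarith

/-- Double counting: each unordered pair is charged to both of its ends, which turns a sum over
edges into a sum over stars. -/
theorem sum_lt_add_mul {f : Fin n → Fin n → ℝ} (hf : ∀ i j, f i j = f j i) (y : Fin n → ℝ) :
    ∑ i, ∑ j with i < j, (y i + y j) * f i j = ∑ i, y i * ∑ j with j ≠ i, f i j := by
  have h1 : ∑ i, ∑ j with i < j, (y i + y j) * f i j
      = ∑ i, ∑ j, (if i < j then y i * f i j else 0) + ∑ i, ∑ j, (if i < j then y j * f i j else 0) := by
    simp only [Finset.sum_filter, ← Finset.sum_add_distrib]
    refine Finset.sum_congr rfl fun i _ => Finset.sum_congr rfl fun j _ => ?_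
    split_ifs <;> ring
  rw [h1, Finset.sum_comm (f := fun i j => if i < j then y j * f i j else 0),
    ← Finset.sum_add_distrib]
  refine Finset.sum_congr rfl fun i _ => ?_
  rw [← Finset.sum_add_distrib, Finset.mul_sum, Finset.sum_filter]
  refine Finset.sum_congr rfl fun j _ => ?_
  rcases lt_trichotomy i j with h | h | h
  · simp [h, h.not_gt, h.ne']
  · simp [h]
  · simp [h, h.not_gt, h.ne, hf i j]

/-- A dual solution bounds the expectation of weighted exchanges. -/
theorem neg_sum_mul_exchSum_le (ψ : (Fin n → Fin 2) → ℝ) {w : Fin n → Fin n → ℝ}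
    (hw : ∀ i j, 0 ≤ w i j) {y : Fin n → ℝ} (hy : ∀ i, 0 ≤ y i)
    (hwy : ∀ i j, i ≠ j → w i j ≤ y i + y j) :
    ∑ i, ∑ j with i < j, w i j * -exchSum ψ i j ≤ (∑ i, y i) * ∑ x, ψ x ^ 2 := by
  calc ∑ i, ∑ j with i < j, w i j * -exchSum ψ i j
      ≤ ∑ i, ∑ j with i < j, (y i + y j) * max (-exchSum ψ i j) 0 := by
        refine Finset.sum_le_sum fun i _ => Finset.sum_le_sum fun j hj => ?_
        have hij : i ≠ j := (Finset.mem_filter.1 hj).2.ne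
        calc w i j * -exchSum ψ i j ≤ w i j * max (-exchSum ψ i j) 0 :=
              mul_le_mul_of_nonneg_left (le_max_left _ _) (hw i j)
          _ ≤ _ := mul_le_mul_of_nonneg_right (hwy i j hij) (le_max_right _ _)
    _ = ∑ i, y i * ∑ j with j ≠ i, max (-exchSum ψ i j) 0 :=
        sum_lt_add_mul (fun i j => by rw [exchSum_comm]) y
    _ ≤ ∑ i, y i * ∑ x, ψ x ^ 2 := by
        refine Finset.sum_le_sum fun i _ => mul_le_mul_of_nonneg_left ?_ (hy i)
        -- Monogamy holds for every set of leaves. Taking those with a positive contribution bounds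
        -- the sum of the positive parts.
        have := sum_neg_exchSum_le ψ i
          ((Finset.univ.filter fun j => j ≠ i).filter fun j => 0 < -exchSum ψ i j) (by simp)
        refine le_of_eq_of_le ?_ this
        rw [Finset.sum_filter (fun j => 0 < -exchSum ψ i j)]
        refine Finset.sum_congr rfl fun j _ => ?_
        split_ifs with h
        · exact max_eq_left h.le
        · exact max_eq_right (not_lt.1 h)
    _ = _ := (Finset.sum_mul _ _ _).symm

theorem singlet_mul_star (a b c d : Fin 2) :
    singlet (a, b) * star (singlet (c, d)) =
      ((if a = c ∧ b = d then 1 else 0) - (if c = b ∧ d = a then 1 else 0)) / 2 := by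
  have h2 : ((√2 : ℝ) : ℂ) * ((√2 : ℝ) : ℂ) = 2 := by
    rw [← Complex.ofReal_mul, Real.mul_self_sqrt (by norm_num)]; norm_num
  have h0 : ((√2 : ℝ) : ℂ) ≠ 0 := by
    intro h; rw [h] at h2; norm_num at h2
  have hinv : (((√2 : ℝ) : ℂ))⁻¹ * (((√2 : ℝ) : ℂ))⁻¹ = 1 / 2 := by
    rw [← mul_inv, h2]; norm_num
  fin_cases a <;> fin_cases b <;> fin_cases c <;> fin_cases d <;>
    simp [singlet, div_eq_mul_inv, hinv]

/-- In coordinates, the singlet projection is (1 - SWAP)/2; this reduces all energies to swap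
expectations. -/
theorem singletProj_apply (i j : Fin n) (x y : Fin n → Fin 2) :
    singletProj i j x y = ((if y = x then 1 else 0) - (if y = exch i j x then 1 else 0)) / 2 := by
  rw [singletProj, Matrix.of_apply]
  have he1 : exch i j x i = x j := by simp [exch]
  have he2 : exch i j x j = x i := by simp [exch]
  have he3 : ∀ k, k ≠ i → k ≠ j → exch i j x k = x k := fun k h1 h2 => by
    simp [exch, Equiv.swap_apply_of_ne_of_ne h1 h2]
  have hext : ∀ f g : Fin n → Fin 2, (∀ k, k ≠ i → k ≠ j → g k = f k) →
      (f = g ↔ f i = g i ∧ f j = g j) := by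
    intro f g h
    refine ⟨by rintro rfl; exact ⟨rfl, rfl⟩, fun ⟨h1, h2⟩ => ?_⟩
    funext k
    by_cases k1 : k = i
    · rw [k1, h1]
    by_cases k2 : k = j
    · rw [k2, h2]
    exact (h k k1 k2).symm
  split_ifs with h h1 h2 h2 h1 h2
  all_goals try rw [singlet_mul_star]
  · rw [if_pos (by simp [h1]), if_pos (by
      have := (hext y (exch i j x) (fun k a b => by rw [he3 k a b, h k a b])).1 h2
      rw [he1, he2] at this; exact this)]
  · rw [if_pos (by simp [h1]), if_neg (by
      intro hc
      exact h2 ((hext y (exch i j x) (fun k a b => by rw [he3 k a b, h k a b])).2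
        (by rw [he1, he2]; exact hc)))]
  · rw [if_neg (by
      intro hc
      exact h1 ((hext y x h).2 ⟨hc.1.symm, hc.2.symm⟩)), if_pos (by
      have := (hext y (exch i j x) (fun k a b => by rw [he3 k a b, h k a b])).1 h2
      rw [he1, he2] at this; exact this)]
  · rw [if_neg (by
      intro hc
      exact h1 ((hext y x h).2 ⟨hc.1.symm, hc.2.symm⟩)), if_neg (by
      intro hc
      exact h2 ((hext y (exch i j x) (fun k a b => by rw [he3 k a b, h k a b])).2
        (by rw [he1, he2]; exact hc)))]
  · exact absurd (fun k _ _ => by rw [h1]) h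
  · exact absurd (fun k _ _ => by rw [h1]) h
  · exact absurd (fun k a b => by rw [‹y = exch i j x›, he3 k a b]) h
  · simp

theorem singletProj_mulVec (i j : Fin n) (v : (Fin n → Fin 2) → ℂ)
    (x : Fin n → Fin 2) :
    (singletProj i j).mulVec v x = (v x - v (exch i j x)) / 2 := by
  simp only [Matrix.mulVec, dotProduct, singletProj_apply, sub_div, sub_mul,
    Finset.sum_sub_distrib, div_mul_eq_mul_div, ite_mul, one_mul, zero_mul]
  rw [← Finset.sum_div, ← Finset.sum_div]
  simp

theorem qmcHamiltonian_mulVec (w : Matrix (Fin n) (Fin n) ℚ) (v : (Fin n → Fin 2) → ℂ)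
    (x : Fin n → Fin 2) : (qmcHamiltonian w).mulVec v x
      = ∑ i, ∑ j with i < j, (w i j : ℂ) * ((v x - v (exch i j x)) / 2) := by
  rw [qmcHamiltonian, Matrix.sum_mulVec, Finset.sum_apply]
  refine Finset.sum_congr rfl fun i _ => ?_
  rw [Matrix.sum_mulVec, Finset.sum_apply]
  refine Finset.sum_congr rfl fun j _ => ?_
  rw [Matrix.smul_mulVec, Pi.smul_apply, singletProj_mulVec,
    smul_eq_mul]

/-- The sum of all weights. -/
def totalWeight (w : Matrix (Fin n) (Fin n) ℚ) : ℝ := ∑ i, ∑ j with i < j, (w i j : ℝ)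

/-- Pairing the eigenvalue equation with `ψ` expresses `μ` times the squared norm through swap
expectations, to which the dual bound applies. -/
theorem eigenvalue_le {w : Matrix (Fin n) (Fin n) ℚ} (hw : IsInteraction w) {y : Fin n → ℝ}
    (hy : ∀ i, 0 ≤ y i) (hwy : ∀ i j, i ≠ j → (w i j : ℝ) ≤ y i + y j) {μ : ℝ}
    {ψ : (Fin n → Fin 2) → ℝ} (hψ : ψ ≠ 0)
    (h : ∀ x, μ * ψ x = ∑ i, ∑ j with i < j, (w i j : ℝ) * ((ψ x - ψ (exch i j x)) / 2)) :
    μ ≤ (totalWeight w + ∑ i, y i) / 2 := by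
  set N := ∑ x, ψ x ^ 2 with hN
  have hNpos : 0 < N := by
    obtain ⟨x, hx⟩ := Function.ne_iff.1 hψ
    exact Finset.sum_pos' (fun x _ => sq_nonneg _) ⟨x, Finset.mem_univ x, by
      have : ψ x ≠ 0 := hx
      positivity⟩
  have h1 : μ * N = ∑ i, ∑ j with i < j, (w i j : ℝ) * ((N - exchSum ψ i j) / 2) := by
    calc μ * N = ∑ x, ψ x * (μ * ψ x) := by
          rw [hN, Finset.mul_sum]; exact Finset.sum_congr rfl fun x _ => by ring
      _ = ∑ x, ∑ i, ∑ j with i < j, (w i j : ℝ) * ((ψ x ^ 2 - ψ x * ψ (exch i j x)) / 2) := by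
          refine Finset.sum_congr rfl fun x _ => ?_
          rw [h x, Finset.mul_sum]
          refine Finset.sum_congr rfl fun i _ => ?_
          rw [Finset.mul_sum]
          exact Finset.sum_congr rfl fun j _ => by ring
      _ = _ := by
          rw [Finset.sum_comm]
          refine Finset.sum_congr rfl fun i _ => ?_
          rw [Finset.sum_comm]
          refine Finset.sum_congr rfl fun j _ => ?_
          rw [← Finset.mul_sum, ← Finset.sum_div, Finset.sum_sub_distrib, exchSum]
  have h2 := neg_sum_mul_exchSum_le ψ (w := fun i j => (w i j : ℝ))
    (fun i j => by exact_mod_cast hw.2 i j) hy hwy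
  have h3 : ∑ i, ∑ j with i < j, (w i j : ℝ) * ((N - exchSum ψ i j) / 2)
      = (totalWeight w * N + ∑ i, ∑ j with i < j, (w i j : ℝ) * -exchSum ψ i j) / 2 := by
    rw [totalWeight, Finset.sum_mul, ← Finset.sum_add_distrib, Finset.sum_div]
    refine Finset.sum_congr rfl fun i _ => ?_
    rw [Finset.sum_mul, ← Finset.sum_add_distrib, Finset.sum_div]
    exact Finset.sum_congr rfl fun j _ => by ring
  rw [h3] at h1
  rw [← hN] at h2
  have : μ * N ≤ (totalWeight w + ∑ i, y i) / 2 * N := by rw [h1]; linarith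
  exact le_of_mul_le_mul_right this hNpos

theorem lambdaMax_le {w : Matrix (Fin n) (Fin n) ℚ} (hw : IsInteraction w) {y : Fin n → ℝ}
    (hy : ∀ i, 0 ≤ y i) (hwy : ∀ i j, i ≠ j → (w i j : ℝ) ≤ y i + y j) :
    lambdaMax (qmcHamiltonian w) ≤ (totalWeight w + ∑ i, y i) / 2 := by
  have hW : 0 ≤ totalWeight w :=
    Finset.sum_nonneg fun i _ => Finset.sum_nonneg fun j _ => by exact_mod_cast hw.2 i j
  -- The bound must be nonnegative because the supremum of an empty set of reals is 0 by convention.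
  refine Real.sSup_le (fun μ hμ => ?_)
    (div_nonneg (add_nonneg hW (Finset.sum_nonneg fun i _ => hy i)) (by norm_num))
  rw [spectrum.mem_iff, Matrix.isUnit_iff_isUnit_det, isUnit_iff_ne_zero, not_not,
    ← Matrix.exists_mulVec_eq_zero_iff] at hμ
  obtain ⟨v, hv, h⟩ := hμ
  have hx : ∀ x, (μ : ℂ) * v x
      = ∑ i, ∑ j with i < j, (w i j : ℂ) * ((v x - v (exch i j x)) / 2) := by
    intro x
    have := congrFun h x
    rw [Algebra.algebraMap_eq_smul_one, Matrix.sub_mulVec, Matrix.smul_mulVec, Matrix.one_mulVec,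
      Pi.sub_apply, Pi.smul_apply, qmcHamiltonian_mulVec, Pi.zero_apply, sub_eq_zero] at this
    rw [← this, Complex.real_smul]
  -- The Hamiltonian is real, so the real and the imaginary part of an eigenvector satisfy the same
  -- equation, and one of them is nonzero.
  by_cases hre : (fun x => (v x).re) = 0
  · have him : (fun x => (v x).im) ≠ 0 := by
      intro him
      apply hv
      funext x
      exact Complex.ext (congrFun hre x) (congrFun him x)
    refine eigenvalue_le hw hy hwy him fun x => ?_
    have := congrArg Complex.im (hx x)
    simpa using this
  · refine eigenvalue_le hw hy hwy hre fun x => ?_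
    have := congrArg Complex.re (hx x)
    simpa using this

end Quantum

namespace Quantum

open scoped ComplexOrder

/-! ## The states of the blocks -/

/-- The golden ratio conjugate, `sin 2θ` for the angle `θ` of the pair states. -/
def gold : ℝ := (√5 - 1) / 2

/-- `cos 2θ` for the angle `θ` of the pair states. -/
def cosTwo : ℝ := √gold

/-- The balance that fixes θ. With s = sin 2θ, matched edges have energy (1 + s)/2 and other edges
at least (1 + cos² 2θ)/4, against shares 1 and 1/2 of the upper bound. The two ratios agree exactly
when 1 - s² = s. -/
theorem gold_sq : gold ^ 2 + gold = 1 := by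
  have : √5 ^ 2 = (5 : ℝ) := Real.sq_sqrt (by norm_num)
  rw [gold]; nlinarith

theorem gold_pos : 0 < gold := by
  have : (1 : ℝ) < √5 := by
    rw [show (1 : ℝ) = √1 by simp]
    exact Real.sqrt_lt_sqrt (by norm_num) (by norm_num)
  rw [gold]; linarith

theorem gold_lt_one : gold < 1 := by nlinarith [gold_sq, gold_pos]

theorem cosTwo_sq : cosTwo ^ 2 = gold := Real.sq_sqrt gold_pos.le

theorem cosTwo_nonneg : 0 ≤ cosTwo := Real.sqrt_nonneg _

theorem cosTwo_le_one : cosTwo ≤ 1 := Real.sqrt_le_one.2 gold_lt_one.le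

/-- This is cos θ and `sinAmp` is sin θ, by the half-angle formulas. -/
def cosAmp : ℝ := √((1 + cosTwo) / 2)

def sinAmp : ℝ := √((1 - cosTwo) / 2)

theorem cosAmp_sq : cosAmp * cosAmp = (1 + cosTwo) / 2 :=
  Real.mul_self_sqrt (by linarith [cosTwo_nonneg])

theorem sinAmp_sq : sinAmp * sinAmp = (1 - cosTwo) / 2 :=
  Real.mul_self_sqrt (by linarith [cosTwo_le_one])

theorem cosAmp_mul_sinAmp : cosAmp * sinAmp = gold / 2 := by
  rw [cosAmp, sinAmp, ← Real.sqrt_mul (by linarith [cosTwo_nonneg]),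
    show (1 + cosTwo) / 2 * ((1 - cosTwo) / 2) = (gold / 2) ^ 2 by
      nlinarith [cosTwo_sq, gold_sq]]
  exact Real.sqrt_sq (by linarith [gold_pos])

theorem algZero_represents : algZero.Represents 0 := by
  intro y
  simp only [algZero, AlgReal.polyEval]
  norm_num
  constructor
  · rintro ⟨h1, h2, -⟩; linarith
  · rintro rfl; simp

theorem algOne_represents : algOne.Represents 1 := by
  intro y
  simp only [algOne, AlgReal.polyEval]
  norm_num
  constructor
  · rintro ⟨h1, h2, -⟩; linarith
  · rintro rfl; simp

/-- With z = 2y - 1 the quartic is z⁴ + z² - 1 = (z² - s)(z² + s + 1), and the second factor is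
positive. The real roots are therefore z = ±√s, which lie on different sides of y = 1/2. -/
theorem quartic_eq (y : ℝ) : (1 : ℝ) + y * (-12 + y * (28 + y * (-32 + y * 16))) =
    ((2 * y - 1) ^ 2 - cosTwo ^ 2) * ((2 * y - 1) ^ 2 + gold + 1) := by
  rw [cosTwo_sq]
  linear_combination gold_sq

theorem algMajor_represents : algMajor.Represents ((1 + cosTwo) / 2) := by
  intro y
  simp only [algMajor, AlgReal.polyEval]
  norm_num
  rw [quartic_eq, mul_eq_zero]
  have hpos : (2 * y - 1) ^ 2 + gold + 1 ≠ 0 := by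
    have := gold_pos; positivity
  constructor
  · rintro ⟨h1, -, h2⟩
    have h3 := h2.resolve_right hpos
    have : 2 * y - 1 = cosTwo := by
      rw [← sq_eq_sq₀ (by linarith) cosTwo_nonneg]; linarith
    linarith
  · rintro rfl
    refine ⟨by linarith [cosTwo_nonneg], by linarith [cosTwo_le_one], Or.inl (by ring)⟩

theorem algMinor_represents : algMinor.Represents ((1 - cosTwo) / 2) := by
  intro y
  simp only [algMinor, AlgReal.polyEval]
  norm_num
  rw [quartic_eq, mul_eq_zero]
  have hpos : (2 * y - 1) ^ 2 + gold + 1 ≠ 0 := by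
    have := gold_pos; positivity
  constructor
  · rintro ⟨-, h1, h2⟩
    have h3 := h2.resolve_right hpos
    have : 1 - 2 * y = cosTwo := by
      rw [← sq_eq_sq₀ (by linarith) cosTwo_nonneg]; linarith
    linarith
  · rintro rfl
    refine ⟨by linarith [cosTwo_le_one], by linarith [cosTwo_nonneg], Or.inl (by ring)⟩

theorem algCross_represents : algCross.Represents (-gold / 2) := by
  intro y
  simp only [algCross, AlgReal.polyEval]
  norm_num
  -- The other root (1 + s)/2 is positive, hence outside the interval.
  have hfac : (-1 : ℝ) + y * (-2 + y * 4) = (2 * y + gold) * (2 * y - gold - 1) := by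
    linear_combination gold_sq
  rw [hfac, mul_eq_zero]
  constructor
  · rintro ⟨-, h1, h2 | h2⟩
    · linarith
    · linarith [gold_pos]
  · rintro rfl
    exact ⟨by linarith [gold_lt_one], by linarith [gold_pos], Or.inl (by ring)⟩

theorem AlgReal.Represents.toComplex {a : AlgReal} {r : ℝ} (h : a.Represents r) :
    a.toComplex.Represents (r : ℂ) := by
  refine ⟨by simpa [AlgReal.toComplex] using h, ?_⟩
  simpa [AlgReal.toComplex] using algZero_represents

/-- Amplitudes of a single qubit of the given colour. -/
def singleAmp (c : ℕ) (a : Fin 2) : ℝ := if (a = 0 ↔ c = 0) then 1 else 0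

/-- Amplitudes of a pair of qubits, the first of which has colour 0. -/
def pairAmp (a b : Fin 2) : ℝ :=
  if a = b then 0 else if a = 0 then cosAmp else -sinAmp

/-- Amplitudes of a block. -/
def blockAmp {n : ℕ} (col : Fin n → ℕ) : (l : List (Fin n)) → (Fin l.length → Fin 2) → ℝ
  | [i] => fun z => singleAmp (col i) (z 0)
  | [_, _] => fun z => pairAmp (z 0) (z 1)
  | _ => fun _ => 0

/-- The pure state with given real amplitudes. -/
def pureState {k : ℕ} (φ : (Fin k → Fin 2) → ℝ) : Operator k :=
  Matrix.of fun x y => ((φ x * φ y : ℝ) : ℂ)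

theorem isState_pureState {k : ℕ} {φ : (Fin k → Fin 2) → ℝ} (h : ∑ x, φ x ^ 2 = 1) :
    IsState (pureState φ) := by
  constructor
  · have : pureState φ = Matrix.vecMulVec (fun x => (φ x : ℂ)) (star fun x => (φ x : ℂ)) := by
      ext x y
      simp [pureState, Matrix.vecMulVec_apply]
    rw [this]
    exact Matrix.posSemidef_vecMulVec_self_star _
  · rw [Matrix.trace]
    simp only [Matrix.diag_apply, pureState, Matrix.of_apply]
    rw [← Complex.ofReal_sum, ← Complex.ofReal_one, ← h]
    simp [sq]

theorem sum_fin_one {M : Type*} [AddCommMonoid M] (f : (Fin 1 → Fin 2) → M) :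
    ∑ z, f z = f ![0] + f ![1] := by
  rw [← (Equiv.funUnique (Fin 1) (Fin 2)).symm.sum_comp f, Fin.sum_univ_two]
  congr 1 <;> congr 1 <;> funext i <;> fin_cases i <;> rfl

theorem sum_fin_two {M : Type*} [AddCommMonoid M] (f : (Fin 2 → Fin 2) → M) :
    ∑ z, f z = f ![0, 0] + f ![0, 1] + (f ![1, 0] + f ![1, 1]) := by
  rw [← (finTwoArrowEquiv (Fin 2)).symm.sum_comp f, Fintype.sum_prod_type, Fin.sum_univ_two,
    Fin.sum_univ_two, Fin.sum_univ_two]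
  rfl

theorem singleEntries_describes {n : ℕ} (col : Fin n → ℕ) (i : Fin n) :
    (⟨[i], singleEntries (col i)⟩ : Block n).Describes (pureState (blockAmp col [i])) := by
  refine ⟨isState_pureState ?_, ?_, ?_⟩
  · refine (sum_fin_one (fun z => blockAmp col [i] z ^ 2)).trans ?_
    by_cases h : col i = 0 <;> simp [blockAmp, singleAmp, h]
  · simp only [singleEntries]
    split_ifs <;> rfl
  · intro x y
    change Fin 1 → Fin 2 at x
    change Fin 1 → Fin 2 at y
    have hb : ∀ z : Fin 1 → Fin 2, basisIndex z = (z 0 : ℕ) := fun z => by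
      rw [basisIndex, finFunctionFinEquiv_apply]; simp
    change ∃ c, (singleEntries (col i))[basisIndex x * 2 ^ 1 + basisIndex y]? = some c ∧
      c.Represents ((singleAmp (col i) (x 0) * singleAmp (col i) (y 0) : ℝ) : ℂ)
    rw [hb, hb]
    generalize x 0 = a
    generalize y 0 = b
    have h0 := algZero_represents.toComplex
    have h1 := algOne_represents.toComplex
    by_cases h : col i = 0 <;> fin_cases a <;> fin_cases b <;>
      simp [singleEntries, singleAmp, h] <;> simpa using by assumption

theorem pairEntries_describes {n : ℕ} (col : Fin n → ℕ) (i j : Fin n) :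
    (⟨[i, j], pairEntries⟩ : Block n).Describes (pureState (blockAmp col [i, j])) := by
  refine ⟨isState_pureState ?_, rfl, ?_⟩
  · refine (sum_fin_two (fun z => blockAmp col [i, j] z ^ 2)).trans ?_
    simp [blockAmp, pairAmp, sq, cosAmp_sq, sinAmp_sq]
    ring
  · intro x y
    change Fin 2 → Fin 2 at x
    change Fin 2 → Fin 2 at y
    -- The first qubit is the least significant bit: |01⟩ has index 2 and |10⟩ index 1, which is why
    -- the larger diagonal entry comes last.
    have hb : ∀ z : Fin 2 → Fin 2, basisIndex z = (z 0 : ℕ) + (z 1 : ℕ) * 2 := fun z => by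
      rw [basisIndex, finFunctionFinEquiv_apply]; simp [Fin.sum_univ_two]
    change ∃ c, pairEntries[basisIndex x * 2 ^ 2 + basisIndex y]? = some c ∧
      c.Represents ((pairAmp (x 0) (x 1) * pairAmp (y 0) (y 1) : ℝ) : ℂ)
    rw [hb, hb]
    generalize x 0 = a
    generalize x 1 = a'
    generalize y 0 = b
    generalize y 1 = b'
    have h0 : algZero.toComplex.Represents 0 := by simpa using algZero_represents.toComplex
    have h1 := algMajor_represents.toComplex
    have h2 := algMinor_represents.toComplex
    have h3 := algCross_represents.toComplex
    rw [← cosAmp_sq] at h1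
    rw [← sinAmp_sq] at h2
    rw [show -gold / 2 = -(cosAmp * sinAmp) by rw [cosAmp_mul_sinAmp]; ring] at h3
    have h3' : algCross.toComplex.Represents ((-(sinAmp * cosAmp) : ℝ) : ℂ) := by
      rwa [mul_comm sinAmp]
    simp only [Complex.ofReal_neg, Complex.ofReal_mul] at h1 h2 h3 h3'
    fin_cases a <;> fin_cases a' <;> fin_cases b <;> fin_cases b' <;>
      simp [pairEntries, pairAmp] <;> assumption

end Quantum

namespace Quantum

open scoped ComplexOrder

/-! ## The product state and its energy -/

namespace PairedColouring

variable {n : ℕ} (G : PairedColouring n)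

/-- The qubit to which the block of a qubit belongs. -/
def rep (i : Fin n) : Fin n :=
  match G.mate i with
  | none => i
  | some j => if G.col i = 0 then i else j

theorem rep_of_none {i : Fin n} (h : G.mate i = none) : G.rep i = i := by simp [rep, h]

theorem rep_of_some {i j : Fin n} (h : G.mate i = some j) :
    G.rep i = if G.col i = 0 then i else j := by simp [rep, h]

theorem blocks_of_none {i : Fin n} (h : G.mate i = none) :
    G.blocks i = [⟨[i], singleEntries (G.col i)⟩] := by simp [blocks, h]

theorem blocks_of_some {i j : Fin n} (h : G.mate i = some j) :
    G.blocks i = if G.col i = 0 then [⟨[i, j], pairEntries⟩] else [] := by simp [blocks, h]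

theorem mate_ne {i j : Fin n} (h : G.mate i = some j) : i ≠ j := by
  rintro rfl
  have := G.bichromatic h
  tauto

/-- Every qubit lies in the block of exactly one representative. Covering and disjointness of the
blocks both follow. -/
theorem mem_blocks_qubits (k a : Fin n) :
    a ∈ (G.blocks k).flatMap Block.qubits ↔ G.rep a = k := by
  cases hk : G.mate k with
  | none =>
    simp only [G.blocks_of_none hk, List.flatMap_cons, List.flatMap_nil, List.append_nil,
      List.mem_singleton]
    constructor
    · rintro rfl; exact G.rep_of_none hk
    · intro h
      cases ha : G.mate a with
      | none => rwa [G.rep_of_none ha] at h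
      | some j =>
        rw [G.rep_of_some ha] at h
        split_ifs at h
        · exact h
        · subst h
          rw [G.symm ha] at hk
          simp at hk
  | some j =>
    rw [G.blocks_of_some hk]
    have hb := G.bichromatic hk
    split_ifs with hc
    · simp only [List.flatMap_cons, List.flatMap_nil, List.append_nil, List.mem_cons,
        List.not_mem_nil, or_false]
      constructor
      · rintro (rfl | rfl)
        · rw [G.rep_of_some hk, if_pos hc]
        · rw [G.rep_of_some (G.symm hk), if_neg (hb.1 hc)]
      · intro h
        cases ha : G.mate a with
        | none => rw [G.rep_of_none ha] at h; exact Or.inl h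
        | some l =>
          rw [G.rep_of_some ha] at h
          split_ifs at h
          · exact Or.inl h
          · subst h
            have := G.symm ha
            rw [hk, Option.some.injEq] at this
            exact Or.inr this.symm
    · simp only [List.flatMap_nil, List.not_mem_nil, false_iff]
      intro h
      cases ha : G.mate a with
      | none => rw [G.rep_of_none ha] at h; subst h; rw [hk] at ha; simp at ha
      | some l =>
        rw [G.rep_of_some ha] at h
        split_ifs at h with hca
        · subst h; exact hc hca
        · subst h
          exact hc ((G.bichromatic (G.symm ha)).2 hca)

theorem flatMap_qubits_perm :
    (G.description.flatMap Block.qubits).Perm (List.finRange n) := by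
  rw [description, List.flatMap_assoc, List.perm_ext_iff_of_nodup _ (List.nodup_finRange n)]
  · intro a
    simp only [List.mem_finRange, iff_true]
    rw [List.mem_flatMap]
    exact ⟨G.rep a, List.mem_finRange _, (G.mem_blocks_qubits _ _).2 rfl⟩
  · rw [List.nodup_flatMap]
    refine ⟨fun k _ => ?_, ?_⟩
    · cases hk : G.mate k with
      | none => simp [G.blocks_of_none hk]
      | some j =>
        rw [G.blocks_of_some hk]
        split_ifs
        · simp [G.mate_ne hk]
        · simp
    · refine (List.nodup_finRange n).pairwise_of_forall_ne fun k _ l _ hkl => ?_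
      intro a ha hb
      exact hkl (((G.mem_blocks_qubits k a).1 ha).symm.trans ((G.mem_blocks_qubits l a).1 hb))

/-- The qubits of the blocks are all the qubits. -/
def siteEquiv :
    (Σ b : Fin G.description.length, Fin (G.description.get b).qubits.length) ≃ Fin n :=
  Equiv.ofBijective (fun s => (G.description.get s.1).qubits.get s.2) (by
    rw [Fintype.bijective_iff_surjective_and_card]
    constructor
    · intro i
      have h : i ∈ G.description.flatMap Block.qubits :=
        (G.flatMap_qubits_perm.mem_iff).2 (List.mem_finRange i)
      obtain ⟨b, hb, hi⟩ := List.mem_flatMap.1 h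
      obtain ⟨k, rfl⟩ := List.mem_iff_get.1 hb
      obtain ⟨a, rfl⟩ := List.mem_iff_get.1 hi
      exact ⟨⟨k, a⟩, rfl⟩
    · rw [Fintype.card_sigma]
      simp only [Fintype.card_fin]
      have h := G.flatMap_qubits_perm.length_eq
      rw [List.length_flatMap, List.length_finRange] at h
      exact (Fin.sum_univ_fun_getElem G.description fun b => b.qubits.length).trans h)

theorem siteEquiv_apply (b : Fin G.description.length)
    (a : Fin (G.description.get b).qubits.length) :
    G.siteEquiv ⟨b, a⟩ = (G.description.get b).qubits.get a := rfl

theorem prod_description {M : Type*} [CommMonoid M] (F : Block n → M) :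
    ∏ b, F (G.description.get b) = ∏ k, ((G.blocks k).map F).prod := by
  have h := Fin.prod_univ_fun_getElem G.description F
  refine h.trans ?_
  rw [description, List.map_flatMap, Fin.prod_univ_def]
  induction List.finRange n with
  | nil => simp
  | cons a l ih => simp [ih]

/-- Sums over basis states factor over the blocks. -/
theorem sum_prod_blocks
    (f : (b : Fin G.description.length) → (Fin (G.description.get b).qubits.length → Fin 2) → ℝ) :
    ∑ x : Fin n → Fin 2, ∏ b, f b (fun a => x ((G.description.get b).qubits.get a)) =
      ∏ b, ∑ z, f b z := by
  rw [Finset.prod_univ_sum, Fintype.piFinset_univ]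
  refine Fintype.sum_bijective
    (fun (x : Fin n → Fin 2) b a => x ((G.description.get b).qubits.get a)) ⟨?_, ?_⟩ _ _
    (fun x => rfl)
  · intro x y h
    funext i
    obtain ⟨⟨b, a⟩, rfl⟩ := G.siteEquiv.surjective i
    exact congrFun (congrFun h b) a
  · intro z
    refine ⟨fun i => z (G.siteEquiv.symm i).1 (G.siteEquiv.symm i).2, ?_⟩
    funext b a
    beta_reduce
    rw [← G.siteEquiv_apply, Equiv.symm_apply_apply]

/-- The amplitudes of the product state. -/
def amp (x : Fin n → Fin 2) : ℝ :=
  ∏ b : Fin G.description.length, blockAmp G.col (G.description.get b).qubits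
    (fun a => x ((G.description.get b).qubits.get a))

/-- The factor of the amplitude that belongs to qubit `k`. -/
def siteAmp (x : Fin n → Fin 2) (k : Fin n) : ℝ :=
  match G.mate k with
  | none => singleAmp (G.col k) (x k)
  | some j => if G.col k = 0 then pairAmp (x k) (x j) else 1

theorem siteAmp_of_none {k : Fin n} (h : G.mate k = none) (x : Fin n → Fin 2) :
    G.siteAmp x k = singleAmp (G.col k) (x k) := by simp [siteAmp, h]

theorem siteAmp_of_some {k j : Fin n} (h : G.mate k = some j) (x : Fin n → Fin 2) :
    G.siteAmp x k = if G.col k = 0 then pairAmp (x k) (x j) else 1 := by simp [siteAmp, h]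

theorem amp_eq (x : Fin n → Fin 2) : G.amp x = ∏ k, G.siteAmp x k := by
  rw [amp, G.prod_description fun b => blockAmp G.col b.qubits fun a => x (b.qubits.get a)]
  refine Finset.prod_congr rfl fun k _ => ?_
  cases hk : G.mate k with
  | none => simp [G.blocks_of_none hk, G.siteAmp_of_none hk, blockAmp]
  | some j =>
    rw [G.blocks_of_some hk, G.siteAmp_of_some hk]
    split_ifs <;> simp [blockAmp]

/-- The expectation of a product of functions of the qubits, by blocks. -/
def siteExp (h : Fin n → Fin 2 → ℝ) (k : Fin n) : ℝ :=
  match G.mate k with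
  | none => if G.col k = 0 then h k 0 else h k 1
  | some j => if G.col k = 0 then
      (1 + cosTwo) / 2 * (h k 0 * h j 1) + (1 - cosTwo) / 2 * (h k 1 * h j 0) else 1

theorem siteExp_of_none {k : Fin n} (hk : G.mate k = none) (h : Fin n → Fin 2 → ℝ) :
    G.siteExp h k = if G.col k = 0 then h k 0 else h k 1 := by simp [siteExp, hk]

theorem siteExp_of_some {k j : Fin n} (hk : G.mate k = some j) (h : Fin n → Fin 2 → ℝ) :
    G.siteExp h k = if G.col k = 0 then
      (1 + cosTwo) / 2 * (h k 0 * h j 1) + (1 - cosTwo) / 2 * (h k 1 * h j 0) else 1 := by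
  simp [siteExp, hk]

/-- Squared amplitudes are the outcome probabilities in the computational basis, and distinct blocks
are independent; expectations of products over qubits therefore factor over blocks. -/
theorem sum_amp_sq_mul_prod (h : Fin n → Fin 2 → ℝ) :
    ∑ x, G.amp x ^ 2 * ∏ k, h k (x k) = ∏ k, G.siteExp h k := by
  have e1 : ∀ x : Fin n → Fin 2, G.amp x ^ 2 * ∏ k, h k (x k) =
      ∏ b : Fin G.description.length, (blockAmp G.col (G.description.get b).qubits
        (fun a => x ((G.description.get b).qubits.get a)) ^ 2 *
        ∏ a, h ((G.description.get b).qubits.get a) (x ((G.description.get b).qubits.get a))) := by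
    intro x
    rw [Finset.prod_mul_distrib, amp, Finset.prod_pow, ← G.siteEquiv.prod_comp, Fintype.prod_sigma]
    rfl
  simp only [e1]
  rw [G.sum_prod_blocks fun b z => blockAmp G.col (G.description.get b).qubits z ^ 2 *
    ∏ a, h ((G.description.get b).qubits.get a) (z a)]
  rw [G.prod_description fun b => ∑ z, blockAmp G.col b.qubits z ^ 2 *
    ∏ a, h (b.qubits.get a) (z a)]
  refine Finset.prod_congr rfl fun k _ => ?_
  cases hk : G.mate k with
  | none =>
    rw [G.blocks_of_none hk, G.siteExp_of_none hk]
    simp only [List.map_cons, List.map_nil, List.prod_cons, List.prod_nil, mul_one]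
    refine (sum_fin_one _).trans ?_
    split_ifs with hc <;> simp [blockAmp, singleAmp, hc]
  | some j =>
    rw [G.blocks_of_some hk, G.siteExp_of_some hk]
    split_ifs with hc
    · simp only [List.map_cons, List.map_nil, List.prod_cons, List.prod_nil, mul_one]
      refine (sum_fin_two _).trans ?_
      simp [blockAmp, pairAmp, sq, cosAmp_sq, sinAmp_sq, Fin.prod_univ_two]
    · simp

theorem sum_amp_sq : ∑ x, G.amp x ^ 2 = 1 := by
  have h := G.sum_amp_sq_mul_prod fun _ _ => 1
  simp only [Finset.prod_const_one, mul_one] at h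
  rw [h]
  refine Finset.prod_eq_one fun k _ => ?_
  cases hk : G.mate k with
  | none => simp [G.siteExp_of_none hk]
  | some j =>
    rw [G.siteExp_of_some hk]
    split_ifs
    · ring
    · rfl

theorem eq_of_amp_ne_zero {x : Fin n → Fin 2} (h : G.amp x ≠ 0) {k : Fin n}
    (hk : G.mate k = none) : x k = 0 ↔ G.col k = 0 := by
  rw [amp_eq] at h
  have := Finset.prod_ne_zero_iff.1 h k (Finset.mem_univ k)
  rw [G.siteAmp_of_none hk, singleAmp] at this
  by_contra hc
  rw [if_neg hc] at this
  exact this rfl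

theorem ne_of_amp_ne_zero {x : Fin n → Fin 2} (h : G.amp x ≠ 0) {k j : Fin n}
    (hk : G.mate k = some j) : x k ≠ x j := by
  rw [amp_eq] at h
  have key : ∀ k j, G.mate k = some j → G.col k = 0 → x k ≠ x j := by
    intro k j hk hc e
    have := Finset.prod_ne_zero_iff.1 h k (Finset.mem_univ k)
    rw [G.siteAmp_of_some hk, if_pos hc, pairAmp, if_pos e] at this
    exact this rfl
  by_cases hc : G.col k = 0
  · exact key k j hk hc
  · have hj : G.col j = 0 := by_contra fun hj => hc ((G.bichromatic hk).2 hj)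
    exact (key j k (G.symm hk) hj).symm

/-- Matched qubits are strongly correlated. -/
theorem exchSum_of_mate {i j : Fin n} (hij : G.mate i = some j) (hi : G.col i = 0) :
    exchSum G.amp i j = -gold := by
  have hne := G.mate_ne hij
  have hp : cosAmp ≠ 0 := by
    intro h; have := cosAmp_mul_sinAmp; rw [h] at this; linarith [gold_pos]
  have hq : sinAmp ≠ 0 := by
    intro h; have := cosAmp_mul_sinAmp; rw [h] at this; linarith [gold_pos]
  -- The ratio of the swapped amplitude to the original one depends on the first bit alone, so the
  -- swap becomes a diagonal observable on the support and the factorization over blocks applies.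
  let r : Fin 2 → ℝ := fun a => if a = 0 then -(sinAmp / cosAmp) else -(cosAmp / sinAmp)
  have hpair : ∀ a b, pairAmp a b * pairAmp b a = pairAmp a b ^ 2 * r a := by
    intro a b
    fin_cases a <;> fin_cases b <;> simp [pairAmp, r] <;> field_simp
  have hterm : ∀ x, G.amp x * G.amp (exch i j x)
      = G.amp x ^ 2 * ∏ k, (if k = i then r else fun _ => 1) (x k) := by
    intro x
    rw [amp_eq, amp_eq, ← Finset.prod_mul_distrib, ← Finset.prod_pow, ← Finset.prod_mul_distrib]
    refine Finset.prod_congr rfl fun k _ => ?_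
    by_cases hk : k = i
    · subst hk
      rw [G.siteAmp_of_some hij, G.siteAmp_of_some hij, if_pos hi, if_pos hi, if_pos rfl]
      simp only [exch, Function.comp_apply, Equiv.swap_apply_left, Equiv.swap_apply_right]
      exact hpair _ _
    · rw [if_neg hk, mul_one, sq]
      congr 1
      by_cases hkj : k = j
      · subst hkj
        rw [G.siteAmp_of_some (G.symm hij), G.siteAmp_of_some (G.symm hij),
          if_neg ((G.bichromatic hij).1 hi), if_neg ((G.bichromatic hij).1 hi)]
      · have hxk : exch i j x k = x k := by
          simp [exch, Equiv.swap_apply_of_ne_of_ne hk hkj]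
        cases hm : G.mate k with
        | none => rw [G.siteAmp_of_none hm, G.siteAmp_of_none hm, hxk]
        | some l =>
          have hl1 : l ≠ i := by
            rintro rfl
            have := G.symm hm
            rw [hij, Option.some.injEq] at this
            exact hkj this.symm
          have hl2 : l ≠ j := by
            rintro rfl
            have := G.symm hm
            rw [G.symm hij, Option.some.injEq] at this
            exact hk this.symm
          have hxl : exch i j x l = x l := by
            simp [exch, Equiv.swap_apply_of_ne_of_ne hl1 hl2]
          rw [G.siteAmp_of_some hm, G.siteAmp_of_some hm, hxk, hxl]
  rw [exchSum, Finset.sum_congr rfl fun x _ => hterm x,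
    G.sum_amp_sq_mul_prod fun k => if k = i then r else fun _ => 1]
  rw [Finset.prod_eq_single i]
  · rw [G.siteExp_of_some hij, if_pos hi, if_pos rfl, if_neg hne.symm, ← cosAmp_sq, ← sinAmp_sq]
    simp only [r, if_true, Fin.one_eq_zero_iff, OfNat.ofNat_ne_one, if_false, mul_one]
    have := cosAmp_mul_sinAmp
    field_simp
    linarith
  · intro k _ hk
    cases hm : G.mate k with
    | none => rw [G.siteExp_of_none hm]; simp [hk]
    | some l =>
      rw [G.siteExp_of_some hm]
      by_cases hc : G.col k = 0
      · have hl1 : l ≠ i := by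
          rintro rfl
          exact (G.bichromatic hm).1 hc hi
        rw [if_pos hc, if_neg hk, if_neg hl1]
        ring
      · rw [if_neg hc]
  · simp

/-- The expectation of the sign of a qubit: a sign given by the colour times a number in
`[cosTwo, 1]`. -/
def bias (i : Fin n) : ℝ := (if G.col i = 0 then 1 else -1) * if G.mate i = none then 1 else cosTwo

/-- For qubits in different blocks the swap has the same expectation as its diagonal part (1 + Z_i
Z_j)/2. Independence turns this into (1 + bias_i · bias_j)/2, and the biases of opposite colours
have opposite signs. -/
theorem exchSum_le_of_ne_mate {i j : Fin n} (hij : i ≠ j) (hm : G.mate i ≠ some j)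
    (hc : G.col i = 0 ↔ G.col j ≠ 0) : exchSum G.amp i j ≤ (1 - gold) / 2 := by
  let sgn : Fin 2 → ℝ := fun a => if a = 0 then 1 else -1
  let h : Fin n → Fin 2 → ℝ := fun k => if k = i ∨ k = j then sgn else fun _ => 1
  have hm' : G.mate j ≠ some i := fun e => hm (G.symm e)
  have hprod : ∀ x : Fin n → Fin 2, ∏ k, h k (x k) = sgn (x i) * sgn (x j) := by
    intro x
    rw [Finset.prod_eq_mul i j hij]
    · simp [h]
    · rintro k - ⟨h1, h2⟩
      simp [h, h1, h2]
    · simp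
    · simp
  have hterm : ∀ x, G.amp x * G.amp (exch i j x)
      = (G.amp x ^ 2 + G.amp x ^ 2 * ∏ k, h k (x k)) / 2 := by
    intro x
    rw [hprod]
    by_cases hx : x i = x j
    · have : exch i j x = x := by
        funext k
        simp only [exch, Function.comp_apply, Equiv.swap_apply_def]
        split_ifs with h1 h2
        · rw [h1, hx]
        · rw [h2, hx]
        · rfl
      have hs : sgn (x j) * sgn (x j) = 1 := by simp only [sgn]; split_ifs <;> norm_num
      rw [this, hx, hs]; ring
    · have hs : sgn (x i) * sgn (x j) = -1 := by
        have : ∀ a b : Fin 2, a ≠ b → sgn a * sgn b = -1 := by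
          intro a b hab
          fin_cases a <;> fin_cases b <;> simp [sgn] at hab ⊢
        exact this _ _ hx
      -- Swapping two different bits flips bit `i`. In the support this bit is fixed, or is opposite
      -- to that of a mate which the swap leaves alone, so `x` and its image are not both in the
      -- support.
      have hz : G.amp x * G.amp (exch i j x) = 0 := by
        by_contra hne
        have h1 := left_ne_zero_of_mul hne
        have h2 := right_ne_zero_of_mul hne
        have hei : exch i j x i = x j := by simp [exch]
        cases hmi : G.mate i with
        | none =>
          have a1 := G.eq_of_amp_ne_zero h1 hmi
          have a2 := G.eq_of_amp_ne_zero h2 hmi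
          rw [hei, ← a1] at a2
          omega
        | some l =>
          have hl1 : l ≠ i := (G.mate_ne hmi).symm
          have hl2 : l ≠ j := by rintro rfl; exact hm hmi
          have a1 := G.ne_of_amp_ne_zero h1 hmi
          have a2 := G.ne_of_amp_ne_zero h2 hmi
          have hel : exch i j x l = x l := by
            simp [exch, Equiv.swap_apply_of_ne_of_ne hl1 hl2]
          rw [hei, hel] at a2
          omega
      rw [hz, hs]; ring
  have hsite : ∀ a b : Fin n, a ≠ b → G.mate a ≠ some b → (∀ k, h k = if k = a ∨ k = b then sgn else fun _ => 1) →
      G.siteExp h (G.rep a) = G.bias a := by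
    intro a b hab hmab hh
    cases hma : G.mate a with
    | none =>
      rw [G.rep_of_none hma, G.siteExp_of_none hma, hh a, bias, hma]
      simp [sgn]
    | some l =>
      have hl : l ≠ a := (G.mate_ne hma).symm
      have hlb : l ≠ b := by rintro rfl; exact hmab hma
      have e1 : h a = sgn := by rw [hh]; simp
      have e2 : h l = fun _ => 1 := by rw [hh]; simp [hl, hlb]
      rw [G.rep_of_some hma, bias, hma]
      by_cases hca : G.col a = 0
      · rw [if_pos hca, G.siteExp_of_some hma, if_pos hca, e1, e2]
        simp [sgn, hca]
        ring
      · have hcl : G.col l = 0 := by_contra fun hj => hca ((G.bichromatic hma).2 hj)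
        rw [if_neg hca, G.siteExp_of_some (G.symm hma), if_pos hcl, e1, e2]
        simp [sgn, hca]
        ring
  -- Two distinct qubits that are not mates belong to different blocks, so their expectations occur
  -- as separate factors.
  have hrep : G.rep i ≠ G.rep j := by
    intro e
    have h1 := (G.mem_blocks_qubits (G.rep i) i).2 rfl
    have h2 := (G.mem_blocks_qubits (G.rep i) j).2 e.symm
    cases hk : G.mate (G.rep i) with
    | none =>
      rw [G.blocks_of_none hk] at h1 h2
      simp at h1 h2
      exact hij (h1.trans h2.symm)
    | some l =>
      rw [G.blocks_of_some hk] at h1 h2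
      split_ifs at h1 h2
      · simp at h1 h2
        rcases h1 with h1 | h1 <;> rcases h2 with h2 | h2
        · exact hij (h1.trans h2.symm)
        · rw [← h1, ← h2] at hk; exact hm hk
        · rw [← h1, ← h2] at hk; exact hm' hk
        · exact hij (h1.trans h2.symm)
      · simp at h1
  have hexp : ∑ x, G.amp x ^ 2 * ∏ k, h k (x k) = G.bias i * G.bias j := by
    rw [G.sum_amp_sq_mul_prod, Finset.prod_eq_mul (G.rep i) (G.rep j) hrep]
    · rw [hsite i j hij hm fun k => rfl, hsite j i hij.symm hm' fun k => by simp only [h, or_comm]]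
    · rintro k - ⟨k1, k2⟩
      have hki : i ∉ (G.blocks k).flatMap Block.qubits := fun e => k1 ((G.mem_blocks_qubits k i).1 e).symm
      have hkj : j ∉ (G.blocks k).flatMap Block.qubits := fun e => k2 ((G.mem_blocks_qubits k j).1 e).symm
      have h1 : ∀ a, a ≠ i → a ≠ j → h a = fun _ => 1 := fun a a1 a2 => by simp [h, a1, a2]
      cases hk : G.mate k with
      | none =>
        rw [G.blocks_of_none hk] at hki hkj
        simp at hki hkj
        rw [G.siteExp_of_none hk, h1 k (Ne.symm hki) (Ne.symm hkj)]
        simp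
      | some l =>
        rw [G.blocks_of_some hk] at hki hkj
        rw [G.siteExp_of_some hk]
        split_ifs at hki hkj ⊢
        · simp at hki hkj
          rw [h1 k (Ne.symm hki.1) (Ne.symm hkj.1), h1 l (Ne.symm hki.2) (Ne.symm hkj.2)]
          ring
        · rfl
    · simp
    · simp
  -- Both absolute values are at least √s; the extreme case is that both qubits are matched.
  have hbias : G.bias i * G.bias j ≤ -gold := by
    have c0 := cosTwo_nonneg
    have c1 := cosTwo_le_one
    have c2 := cosTwo_sq
    have hsign : G.bias i * G.bias j = -((if G.mate i = none then 1 else cosTwo) *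
        (if G.mate j = none then 1 else cosTwo)) := by
      simp only [bias]
      by_cases h0 : G.col i = 0
      · rw [if_pos h0, if_neg (hc.1 h0)]; ring
      · have hj : G.col j = 0 := by_contra fun hj => h0 (hc.2 hj)
        rw [if_neg h0, if_pos hj]; ring
    rw [hsign]
    split_ifs <;> nlinarith
  rw [exchSum, Finset.sum_congr rfl fun x _ => hterm x, ← Finset.sum_div, Finset.sum_add_distrib,
    G.sum_amp_sq, hexp]
  linarith

/-- The state described by the output of the algorithm. -/
def state : Operator n := pureState G.amp

theorem isState_state : IsState G.state := isState_pureState G.sum_amp_sq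

theorem blockDescribes {B : Block n} (hB : B ∈ G.description) :
    B.Describes (pureState (blockAmp G.col B.qubits)) := by
  rw [description, List.mem_flatMap] at hB
  obtain ⟨k, -, hk⟩ := hB
  cases hm : G.mate k with
  | none =>
    rw [G.blocks_of_none hm, List.mem_singleton] at hk
    subst hk
    exact singleEntries_describes G.col k
  | some j =>
    rw [G.blocks_of_some hm] at hk
    split_ifs at hk
    · rw [List.mem_singleton] at hk
      subst hk
      exact pairEntries_describes G.col k j
    · simp at hk

theorem describes_state : Describes G.description G.state := by
  refine ⟨G.flatMap_qubits_perm,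
    fun b => pureState (blockAmp G.col (G.description.get b).qubits),
    fun b => G.blockDescribes (List.get_mem _ _), fun x y => ?_⟩
  simp only [state, pureState, Matrix.of_apply, amp, ← Finset.prod_mul_distrib]
  push_cast
  rfl

end PairedColouring

/-! ### Energy of the product state and the approximation ratio -/

theorem energy_pureState {n : ℕ} (w : Matrix (Fin n) (Fin n) ℚ) {φ : (Fin n → Fin 2) → ℝ}
    (hφ : ∑ x, φ x ^ 2 = 1) : energy (pureState φ) (qmcHamiltonian w)
      = ∑ i, ∑ j with i < j, (w i j : ℝ) * ((1 - exchSum φ i j) / 2) := by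
  have h1 : (pureState φ * qmcHamiltonian w).trace
      = ∑ y, (φ y : ℂ) * (qmcHamiltonian w).mulVec (fun x => (φ x : ℂ)) y := by
    rw [Matrix.trace_mul_comm, Matrix.trace]
    refine Finset.sum_congr rfl fun y _ => ?_
    rw [Matrix.diag_apply, Matrix.mul_apply, Matrix.mulVec, dotProduct, Finset.mul_sum]
    refine Finset.sum_congr rfl fun x _ => ?_
    simp only [pureState, Matrix.of_apply]
    push_cast
    ring
  have h2 : (pureState φ * qmcHamiltonian w).trace
      = ((∑ y, φ y * ∑ i, ∑ j with i < j, (w i j : ℝ) * ((φ y - φ (exch i j y)) / 2) : ℝ) : ℂ) := by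
    rw [h1]
    simp only [qmcHamiltonian_mulVec]
    push_cast
    rfl
  rw [energy, h2, Complex.ofReal_re]
  simp only [Finset.mul_sum]
  rw [Finset.sum_comm]
  refine Finset.sum_congr rfl fun i _ => ?_
  rw [Finset.sum_comm]
  refine Finset.sum_congr rfl fun j _ => ?_
  rw [← hφ, exchSum, ← Finset.sum_sub_distrib, Finset.sum_div, Finset.mul_sum]
  exact Finset.sum_congr rfl fun x _ => by ring

namespace PairedColouring

variable {n : ℕ} (G : PairedColouring n)

/-- Each matched pair has exactly one end of colour 0, so charging edges to such ends counts it
once. -/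
theorem weight_eq {w : Matrix (Fin n) (Fin n) ℚ} (hw : w.IsSymm) :
    ∑ i, ∑ j with i < j, (w i j : ℝ) * (if G.mate i = some j then 1 else 0) = G.weight w := by
  have h1 := sum_lt_add_mul (f := fun i j => (w i j : ℝ) * (if G.mate i = some j then 1 else 0))
    (fun i j => by
      rw [hw.apply i j]
      congr 2
      exact propext ⟨G.symm, G.symm⟩) (fun i => if G.col i = 0 then 1 else 0)
  have h2 : ∑ i, ∑ j with i < j, (w i j : ℝ) * (if G.mate i = some j then 1 else 0)
      = ∑ i, ∑ j with i < j, ((if G.col i = 0 then 1 else 0) + (if G.col j = 0 then 1 else 0)) *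
        ((w i j : ℝ) * (if G.mate i = some j then 1 else 0)) := by
    refine Finset.sum_congr rfl fun i _ => Finset.sum_congr rfl fun j _ => ?_
    by_cases h : G.mate i = some j
    · have hb := G.bichromatic h
      by_cases hi : G.col i = 0
      · simp [hi, hb.1 hi]
      · have hj : G.col j = 0 := by_contra fun hj => hi (hb.2 hj)
        simp [hi, hj]
    · simp [h]
  rw [h2, h1, weight]
  refine Finset.sum_congr rfl fun i _ => ?_
  by_cases hi : G.col i = 0
  · simp only [hi, if_true, one_mul]
    cases hm : G.mate i with
    | none => simp
    | some l =>
      rw [Finset.sum_eq_single l]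
      · simp
      · intro j _ hj
        simp [Ne.symm hj]
      · intro h
        exact (h (by simp [(G.mate_ne hm).symm])).elim
  · simp [hi]

/-- The inequality holds edge by edge. A matched edge occurs in both W and M, so it must supply
twice the share of an unmatched one. -/
theorem energy_state_ge {w : Matrix (Fin n) (Fin n) ℚ} (hw : IsInteraction w)
    (hproper : ∀ i j, i ≠ j → w i j ≠ 0 → (G.col i = 0 ↔ G.col j ≠ 0)) :
    (1 + gold) / 2 * ((totalWeight w + G.weight w) / 2) ≤ energy G.state (qmcHamiltonian w) := by
  rw [state, energy_pureState w G.sum_amp_sq, ← G.weight_eq hw.1, totalWeight,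
    ← Finset.sum_add_distrib, Finset.sum_div, Finset.mul_sum]
  refine Finset.sum_le_sum fun i _ => ?_
  rw [← Finset.sum_add_distrib, Finset.sum_div, Finset.mul_sum]
  refine Finset.sum_le_sum fun j hj => ?_
  have hij : i ≠ j := (Finset.mem_filter.1 hj).2.ne
  by_cases h0 : w i j = 0
  · simp [h0]
  have hc := hproper i j hij h0
  have hw0 : (0 : ℝ) ≤ w i j := by exact_mod_cast hw.2 i j
  have hE : (1 + gold) / 2 * ((1 + if G.mate i = some j then 1 else 0) / 2)
      ≤ (1 - exchSum G.amp i j) / 2 := by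
    split_ifs with hm
    · by_cases hi : G.col i = 0
      · rw [G.exchSum_of_mate hm hi]; linarith
      · have hcj : G.col j = 0 := by_contra fun hj => hi (hc.2 hj)
        rw [exchSum_comm, G.exchSum_of_mate (G.symm hm) hcj]; linarith
    · have := G.exchSum_le_of_ne_mate hij hm hc
      linarith
  calc _ = (w i j : ℝ) * ((1 + gold) / 2 * ((1 + if G.mate i = some j then 1 else 0) / 2)) := by ring
    _ ≤ _ := mul_le_mul_of_nonneg_left hE hw0

theorem Optimal.approx {G : PairedColouring n} {w : Matrix (Fin n) (Fin n) ℚ} (hG : G.Optimal w)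
    (hw : IsInteraction w) :
    (1 + √5) / 4 * lambdaMax (qmcHamiltonian w) ≤ energy G.state (qmcHamiltonian w) := by
  obtain ⟨y, hy, hwy, hsum⟩ := hG.dual
  have h1 := lambdaMax_le hw hy hwy
  have h2 := G.energy_state_ge hw hG.proper
  have h3 : (1 + √5) / 4 = (1 + gold) / 2 := by rw [gold]; ring
  rw [h3]
  refine le_trans (mul_le_mul_of_nonneg_left ?_ (by linarith [gold_pos])) h2
  linarith

end PairedColouring
end Quantum

/-! ### Bit lengths of input and output, and the running time -/

namespace RAM

theorem size_le_bitLength {l : List ℕ} {a : ℕ} (h : a ∈ l) : a.size ≤ bitLength l :=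
  (Nat.le_succ _).trans (List.single_le_sum (by simp) _ (List.mem_map_of_mem h))

theorem length_le_bitLength (l : List ℕ) : l.length ≤ bitLength l := by
  induction l with
  | nil => simp
  | cons a l ih =>
    simp only [bitLength, List.map_cons, List.sum_cons, List.length_cons] at ih ⊢
    omega

theorem bitLength_le {l : List ℕ} {B : ℕ} (h : ∀ a ∈ l, a.size ≤ B) :
    bitLength l ≤ l.length * (B + 1) := by
  refine (List.sum_le_card_nsmul _ (B + 1) fun a ha => ?_).trans (by simp)
  obtain ⟨b, hb, rfl⟩ := List.mem_map.1 ha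
  exact Nat.succ_le_succ (h b hb)

theorem size_le_self (a : ℕ) : a.size ≤ a := Nat.size_le.2 a.lt_two_pow_self

theorem bounded_initStore (l : List ℕ) : (initStore l).Bounded (bitLength l) := by
  have hget : ∀ i, (l.getD i 0).size ≤ bitLength l := fun i => by
    by_cases hi : i < l.length
    · rw [List.getD_eq_getElem _ _ hi]
      exact size_le_bitLength (List.getElem_mem hi)
    · rw [List.getD_eq_default _ _ (not_lt.1 hi)]
      simp
  refine ⟨fun x => ?_, fun k i => ?_⟩
  · simp only [initStore]
    split_ifs
    · exact (size_le_self _).trans (length_le_bitLength l)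
    · simp
  · simp only [initStore]
    split_ifs
    · exact hget i
    · simp

theorem Store.Bounded.bitLength_output {s : Store} {B : ℕ} (h : s.Bounded B) :
    bitLength s.output ≤ s.output.length * (B + 1) :=
  bitLength_le fun a ha => by
    obtain ⟨i, -, rfl⟩ := List.mem_map.1 ha
    exact h.2 1 i

end RAM

theorem Enc.le_length_matrix {n : ℕ} (w : Matrix (Fin n) (Fin n) ℚ) :
    n ≤ (Enc.matrix w).length := by
  have h3 : ∀ q, (Enc.rat q).length = 3 := fun q => rfl
  simp only [Enc.matrix, List.length_cons, List.length_flatMap, h3, List.map_const',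
    List.length_finRange, List.sum_replicate, smul_eq_mul]
  nlinarith [Nat.le_mul_self n]

namespace Quantum.PairedColouring

variable {n : ℕ} (G : PairedColouring n)

/-- A bound for the length of the code of a block. -/
def codeLength : ℕ :=
  4 + (Enc.list Enc.algComplex (singleEntries 0)).length +
    (Enc.list Enc.algComplex (singleEntries 1)).length +
    (Enc.list Enc.algComplex pairEntries).length

theorem length_blockCodes_le (i : Fin n) :
    ((G.blocks i).flatMap Enc.block).length ≤ codeLength := by
  have hs : ∀ c, (Enc.list Enc.algComplex (singleEntries c)).length ≤
      (Enc.list Enc.algComplex (singleEntries 0)).length +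
        (Enc.list Enc.algComplex (singleEntries 1)).length := fun c => by
    by_cases hc : c = 0
    · subst hc; omega
    · rw [show singleEntries c = singleEntries 1 by simp [singleEntries, hc]]; omega
  cases hm : G.mate i with
  | none =>
    rw [G.blocks_of_none hm]
    have := hs (G.col i)
    simp only [List.flatMap_singleton, Enc.block, List.length_append, codeLength]
    simp only [Enc.list, List.length_cons, List.length_nil, List.flatMap_cons, List.flatMap_nil,
      List.length_append] at this ⊢
    omega
  | some j =>
    rw [G.blocks_of_some hm]
    split_ifs
    · simp only [List.flatMap_singleton, Enc.block, List.length_append, codeLength]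
      simp only [Enc.list, List.length_cons, List.length_nil, List.flatMap_cons, List.flatMap_nil,
        List.length_append]
      omega
    · simp

theorem length_description_le :
    (Enc.description G.description).length ≤ 1 + n * codeLength := by
  have h : ((List.finRange n).map fun i => ((G.blocks i).flatMap Enc.block).length).sum
      ≤ n * codeLength := by
    refine (List.sum_le_card_nsmul _ codeLength fun a ha => ?_).trans (by simp)
    obtain ⟨i, -, rfl⟩ := List.mem_map.1 ha
    exact G.length_blockCodes_le i
  rw [Enc.description, Enc.list, description, List.flatMap_assoc, List.length_cons,
    List.length_flatMap]
  omega

end Quantum.PairedColouring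

open RAM Quantum in
theorem RAM.Prog.algorithm_computes : ∃ p : Polynomial ℕ, ∀ (n : ℕ)
    (w : Matrix (Fin n) (Fin n) ℚ), IsInteraction w → IsBipartite w →
    ∃ (t : ℕ) (G : PairedColouring n), G.Optimal w ∧
      Computes algorithm.compile (Enc.matrix w) (Enc.description G.description) t ∧
      t ≤ p.eval (bitLength (Enc.matrix w)) := by
  obtain ⟨C, d, hC⟩ := tame_algorithm.exec
  -- With b the input length, the first summand bounds the execution, the parameters of
  -- `Prog.Tame.exec` being b + 1 and b. The second bounds delivery: at most `1 + n * codeLength`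
  -- numbers, each of at most b + C (b + 1)^d bits and one delimiter.
  refine ⟨Polynomial.C C * (Polynomial.X + 1) ^ d * (Polynomial.X + 1) +
    (1 + Polynomial.X * Polynomial.C PairedColouring.codeLength) *
      (Polynomial.X + Polynomial.C C * (Polynomial.X + 1) ^ d + 1), fun n w hw hb => ?_⟩
  obtain ⟨G, hG, hout⟩ := algorithm_spec w hw hb
  set b := bitLength (Enc.matrix w)
  have hn : n ≤ b := (Enc.le_length_matrix w).trans (length_le_bitLength _)
  have hB : (initStore (Enc.matrix w)).Bounded b := bounded_initStore _
  obtain ⟨t, hexec, ht, hbd⟩ := hC (initStore (Enc.matrix w)) (b + 1) b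
    (Nat.succ_le_succ hn) (fun i => (hB.2 0 i).trans (Nat.le_succ b)) hB
  refine ⟨_, G, hG, ⟨t, _, hexec, hout, rfl⟩, ?_⟩
  have hlen := hbd.bitLength_output
  rw [hout] at hlen
  simp only [Polynomial.eval_add, Polynomial.eval_mul, Polynomial.eval_pow, Polynomial.eval_C,
    Polynomial.eval_X, Polynomial.eval_one]
  refine add_le_add ht (hlen.trans (Nat.mul_le_mul_right _ ?_))
  exact G.length_description_le.trans (by gcongr)

theorem corollary2 : ∃ c : RAM.Cmd, IsPolyTimeApproxAlgorithm ((1 + √5) / 4)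
    (fun _ w => Quantum.IsInteraction w ∧ Quantum.IsBipartite w)
    (fun _ w => Quantum.qmcHamiltonian w) c := by
  obtain ⟨p, hp⟩ := RAM.Prog.algorithm_computes
  refine ⟨RAM.Prog.algorithm.compile, p, fun n w hw => ?_⟩
  obtain ⟨t, G, hG, hcomp, ht⟩ := hp n w hw.1 hw.2
  exact ⟨t, G.description, G.state, hcomp, ht, G.describes_state, G.isState_state,
    hG.approx hw.1⟩

end
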